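/- **Setting.** Let $r\in H^s(\mathbb R)$ with $s>1/2$ (complex valued), let $z_1,\dots,z_N$ ($N\ge 0$) be distinct points of the open upper half-plane, let $c_1,\dots,c_N\in\mathbb C$ and $y\ge 0$. Put $\theta(z)=\theta(z;y)=-\tfrac14\left(z-\tfrac1z\right)y$. For $f\in L^2(\mathbb R)$ let $\mathcal Cf(z)=\frac1{2\pi i}\int_{\mathbb R}\frac{f(s)}{s-z}\,ds$, $z\notin\mathbb R$, be the Cauchy integral, and let $\mathcal C_\pm$ be the Cauchy projections (the boundary values of $\mathcal Cf$ from $\mathbb C^\pm$), i.e. $(\mathcal C_\pm f)^\wedge=\pm\chi_{\mathbb R^\pm}\hat f$. On $m\times2$ matrix functions $f=(f_1,f_2)\in L^2(\mathbb R)$ with columns $f_1,f_2$ and norm $\|f\|^2=\|f_1\|_2^2+\|f_2\|_2^2$ ($m=1$: row functions, $m=2$: $2\times2$ matrix functions) define $$\mathcal K f=\big((\mathcal A_1+\mathcal A_2)f_2,\ (\mathcal B_1+\mathcal B_2)f_1\big),$$ $$\mathcal A_1f_2=\mathcal C_-(re^{-2i\theta}f_2),\qquad \mathcal A_2f_2(z)=\sum_{j=1}^N\frac{c_je^{-2i\theta(z_j)}}{z-z_j}\,\mathcal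 Cf_2(z_j),$$ $$\mathcal B_1f_1=\mathcal C_+(\bar re^{2i\theta}f_1),\qquad \mathcal B_2f_1(z)=\sum_{j=1}^N\frac{-\bar c_je^{2i\theta(\bar z_j)}}{z-\bar z_j}\,\big(-\mathcal Cf_1(\bar z_j)\big).$$ (For boundary values $f_2$, $f_1$ of Hardy functions of the upper and the lower half-plane, $\mathcal Cf_2(z_j)$ and $-\mathcal Cf_1(\bar z_j)$ are their values at $z_j$ and $\bar z_j$.) **Proposition 3.1.** The function $r$ is essentially bounded. For all such $N,z_j,c_j$, all $y\ge0$ and all $m$, the operator $I-\mathcal K$ is a bounded Fredholm operator of index zero on $L^2(\mathbb R)$, and it has a bounded two-sided inverse, with $$\|(I-\mathcal K)^{-1}\|\le C,\qquad C=1+\|r\|_{L^\infty(\mathbb R)}.$$ In particular, the bound is uniform in $y$ and in the discrete data, and it is at most $2$ if $\|r\|_{L^\infty}\le1$. Moreover, for all such $N,z_j,c_j$ and all $y\ge0$ the following Riemann–Hilbert problem for $M_l$ has one and only one solution: find a $2\times2$ matrix function $M$, analytic on $\mathbb C\setminus(\mathbb R\cup\{z_j,\bar z_j\}_{j=1}^{N})$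 with at most simple poles at the $z_j,\bar z_j$, such that * $\displaystyle\operatorname{Res}_{z_j}M=\lim_{z\to z_j}M(z)\begin{pmatrix}0&0\\ c_je^{-2i\theta(z_j)}&0\end{pmatrix}$ and $\displaystyle\operatorname{Res}_{\bar z_j}M=\lim_{z\to\bar z_j}M(z)\begin{pmatrix}0&-\bar c_je^{2i\theta(\bar z_j)}\\0&0\end{pmatrix}$ for every $j$; * $M-I$ is $L^2$-normalized: for every $\varepsilon>0$ the integrals of $|M-I|^2$ over the horizontal lines $\operatorname{Im}z=\gamma\ne0$, with the $\varepsilon$-discs around the points $z_j,\bar z_j$ removed, are bounded uniformly in $\gamma$; * $M(\cdot\pm i\gamma)\to M_\pm$ in $L^2(\mathbb R)$ as $\gamma\downarrow0$, where $M_\pm-I\in L^2(\mathbb R)$, and $M_+=M_-V_l$ almost everywhere on $\mathbb R$, with $$V_l=\begin{pmatrix}1+|r|^2&\bar re^{2i\theta}\\ re^{-2i\theta}&1\end{pmatrix}.$$ -/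

import Mathlib

open MeasureTheory Filter Topology Complex
open scoped ENNReal NNReal FourierTransform ComplexConjugate

noncomputable section

namespace MCH

/-- `L²(ℝ; E)`. -/
abbrev L2 (E : Type*) [NormedAddCommGroup E] := Lp E 2 (volume : Measure ℝ)

/-- Columns of height `m`. -/
abbrev Col (m : ℕ) := EuclideanSpace ℂ (Fin m)

/-- Square integrable `m × 2` matrix functions `f = (f₁, f₂)`, given by their two columns, with the
Hilbert norm `‖f‖² = ‖f₁‖² + ‖f₂‖²`: row functions for `m = 1`, `2 × 2` matrix functions for
`m = 2`. -/
abbrev MatL2 (m : ℕ) := WithLp 2 (L2 (Col m) × L2 (Col m))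

/-- The phase `θ(z; y) = -(1/4) (z - 1/z) y`. -/
def theta (z : ℂ) (y : ℝ) : ℂ := -(1 / 4) * (z - 1 / z) * y

/-- The weight `r(x) e^{-2iθ(x; y)}` on the real line; its conjugate is `conj r · e^{2iθ}`. -/
def weight (r : ℝ → ℂ) (y : ℝ) (x : ℝ) : ℂ := r x * exp (-2 * I * theta x y)

/-- Discrete scattering data: distinct points `z₁, …, z_N` of the upper half-plane, with norming
constants `c₁, …, c_N`. -/
structure DiscreteData (N : ℕ) where
  pole : Fin N → ℂ
  pole_im_pos : ∀ j, 0 < (pole j).im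
  pole_injective : Function.Injective pole
  norming : Fin N → ℂ

/-- The residue coefficient `c_j e^{-2iθ(z_j; y)}`; its conjugate is
`conj c_j · e^{2iθ(conj z_j; y)}`. -/
def DiscreteData.coeff {N : ℕ} (D : DiscreteData N) (y : ℝ) (j : Fin N) : ℂ :=
  D.norming j * exp (-2 * I * theta (D.pole j) y)

/-- Multiplication by an essentially bounded function, as an operator on `L²(ℝ; ℂᵐ)`. -/
def mulOp (m : ℕ) (φ : Lp ℂ ∞ (volume : Measure ℝ)) : L2 (Col m) →L[ℂ] L2 (Col m) :=
  (ContinuousLinearMap.lsmul ℂ ℂ).holderL volume ∞ 2 2 φ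

open Classical in
/-- Multiplication by a function `φ`, as an operator on `L²(ℝ; ℂᵐ)`; it is the zero operator if `φ`
is not essentially bounded. -/
def mulFun (m : ℕ) (φ : ℝ → ℂ) : L2 (Col m) →L[ℂ] L2 (Col m) :=
  if h : MemLp φ ∞ volume then mulOp m h.toLp else 0

lemma memLp_indicator (s : Set ℝ) (hs : MeasurableSet s) :
    MemLp (s.indicator fun _ => (1 : ℂ)) ∞ (volume : Measure ℝ) :=
  (memLp_top_const (1 : ℂ)).indicator hs

/-- The Fourier multiplier on `L²(ℝ; ℂᵐ)` whose symbol is the characteristic function of `s`. -/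
def fourierCutoff (m : ℕ) (s : Set ℝ) (hs : MeasurableSet s) : L2 (Col m) →L[ℂ] L2 (Col m) :=
  let F := Lp.fourierTransformₗᵢ ℝ (Col m)
  (F.symm.toContinuousLinearEquiv : L2 (Col m) →L[ℂ] L2 (Col m)) ∘L
    mulOp m (memLp_indicator s hs).toLp ∘L
    (F.toContinuousLinearEquiv : L2 (Col m) →L[ℂ] L2 (Col m))

/-- The Cauchy projection `𝒞₊`, the boundary value from the upper half-plane of the Cauchy
integral: `(𝒞₊ f)^ = χ_{ξ > 0} f^`. -/
def cauchyPlus (m : ℕ) : L2 (Col m) →L[ℂ] L2 (Col m) :=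
  fourierCutoff m (Set.Ioi 0) measurableSet_Ioi

/-- The Cauchy projection `𝒞₋`, the boundary value from the lower half-plane of the Cauchy
integral: `(𝒞₋ f)^ = -χ_{ξ < 0} f^`. -/
def cauchyMinus (m : ℕ) : L2 (Col m) →L[ℂ] L2 (Col m) :=
  -fourierCutoff m (Set.Iio 0) measurableSet_Iio

lemma memLp_kernel (z : ℂ) (hz : z.im ≠ 0) :
    MemLp (fun s : ℝ => ((s : ℂ) - z)⁻¹) 2 (volume : Measure ℝ) := by
  have hne : ∀ s : ℝ, (s : ℂ) - z ≠ 0 := fun s h => hz (by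
    have := congrArg Complex.im h
    simpa using this)
  have hcont : Continuous fun s : ℝ => ((s : ℂ) - z)⁻¹ :=
    (continuous_ofReal.sub continuous_const).inv₀ hne
  rw [memLp_two_iff_integrable_sq_norm hcont.aestronglyMeasurable]
  have h1 : Integrable (fun s : ℝ => (z.im ^ 2)⁻¹ * (1 + ((s - z.re) / z.im) ^ 2)⁻¹) :=
    ((integrable_inv_one_add_sq.comp_div hz).comp_sub_right z.re).const_mul _
  refine h1.congr (Eventually.of_forall fun s => ?_)
  have h2 : ‖(s : ℂ) - z‖ ^ 2 = (s - z.re) ^ 2 + z.im ^ 2 := by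
    rw [← Complex.normSq_eq_norm_sq, Complex.normSq_apply]
    simp
    ring
  simp only [norm_inv, inv_pow, h2]
  rw [← mul_inv]
  congr 1
  field_simp
  ring

/-- The Cauchy integral `𝒞f(z) = (2πi)⁻¹ ∫ f(s) / (s - z) ds` at a point `z` off the real line, as
a functional of `f ∈ L²`. -/
def cauchyAt (m : ℕ) (z : ℂ) (hz : z.im ≠ 0) : L2 (Col m) →L[ℂ] Col m :=
  (2 * Real.pi * I)⁻¹ •
    (ContinuousLinearMap.lsmul ℂ ℂ).lpPairing volume 2 2 (memLp_kernel z hz).toLp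

lemma cauchyAt_apply (m : ℕ) (z : ℂ) (hz : z.im ≠ 0) (f : L2 (Col m)) :
    cauchyAt m z hz f = (2 * Real.pi * I)⁻¹ • ∫ s : ℝ, ((s : ℂ) - z)⁻¹ • f s := by
  simp only [cauchyAt, smul_apply, ContinuousLinearMap.lpPairing_eq_integral]
  congr 1
  refine integral_congr_ae ?_
  filter_upwards [(memLp_kernel z hz).coeFn_toLp] with s hs
  simp [hs]

/-- `v ↦ (x ↦ (x - z)⁻¹ v)`, from `ℂᵐ` to `L²(ℝ; ℂᵐ)`. -/
def poleFun (m : ℕ) (z : ℂ) (hz : z.im ≠ 0) : Col m →L[ℂ] L2 (Col m) :=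
  LinearMap.toContinuousLinearMap
    { toFun := fun v => (ContinuousLinearMap.toSpanSingleton ℂ v).compLp (memLp_kernel z hz).toLp
      map_add' := fun v w => by
        rw [← ContinuousLinearMap.add_compLp]
        congr 1
        ext
        simp
      map_smul' := fun c v => by
        rw [RingHom.id_apply, ← ContinuousLinearMap.smul_compLp]
        congr 1
        ext
        simp }

lemma coeFn_poleFun (m : ℕ) (z : ℂ) (hz : z.im ≠ 0) (v : Col m) :
    poleFun m z hz v =ᵐ[volume] fun x : ℝ => ((x : ℂ) - z)⁻¹ • v := by
  filter_upwards [(ContinuousLinearMap.toSpanSingleton ℂ v).coeFn_compLp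
    (memLp_kernel z hz).toLp, (memLp_kernel z hz).coeFn_toLp] with x h1 h2
  change ((ContinuousLinearMap.toSpanSingleton ℂ v).compLp (memLp_kernel z hz).toLp :
    L2 (Col m)) x = _
  rw [h1, h2]
  simp

lemma DiscreteData.im_ne {N : ℕ} (D : DiscreteData N) (j : Fin N) : (D.pole j).im ≠ 0 :=
  (D.pole_im_pos j).ne'

lemma DiscreteData.conj_im_ne {N : ℕ} (D : DiscreteData N) (j : Fin N) :
    (conj (D.pole j)).im ≠ 0 := by
  simpa using D.im_ne j

section Operator

variable (m : ℕ) {N : ℕ} (r : ℝ → ℂ) (D : DiscreteData N) (y : ℝ)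

/-- `𝒜₁ g = 𝒞₋(r e^{-2iθ} g)`. -/
def opA1 : L2 (Col m) →L[ℂ] L2 (Col m) :=
  cauchyMinus m ∘L mulFun m (weight r y)

/-- `𝒜₂ g (x) = ∑ⱼ cⱼ e^{-2iθ(zⱼ)} / (x - zⱼ) · 𝒞g(zⱼ)`. -/
def opA2 : L2 (Col m) →L[ℂ] L2 (Col m) :=
  ∑ j, D.coeff y j • (poleFun m (D.pole j) (D.im_ne j) ∘L cauchyAt m (D.pole j) (D.im_ne j))

/-- `ℬ₁ f = 𝒞₊(conj r · e^{2iθ} f)`. -/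
def opB1 : L2 (Col m) →L[ℂ] L2 (Col m) :=
  cauchyPlus m ∘L mulFun m (fun x => conj (weight r y x))

/-- `ℬ₂ f (x) = ∑ⱼ -conj cⱼ · e^{2iθ(conj zⱼ)} / (x - conj zⱼ) · f(conj zⱼ)`. Here `f(conj zⱼ)` is
the value at `conj zⱼ` of the analytic extension to the lower half-plane, that is, the Cauchy
integral over the real line oriented as the boundary of the lower half-plane: `-𝒞f(conj zⱼ)`. -/
def opB2 : L2 (Col m) →L[ℂ] L2 (Col m) :=
  ∑ j, (-conj (D.coeff y j)) • (poleFun m (conj (D.pole j)) (D.conj_im_ne j) ∘L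
    (-cauchyAt m (conj (D.pole j)) (D.conj_im_ne j)))

/-- `𝒦(f₁, f₂) = ((𝒜₁ + 𝒜₂) f₂, (ℬ₁ + ℬ₂) f₁)`. -/
def opK : MatL2 m →L[ℂ] MatL2 m :=
  let e := WithLp.prodContinuousLinearEquiv 2 ℂ (L2 (Col m)) (L2 (Col m))
  (e.symm : _ →L[ℂ] MatL2 m) ∘L
    (((opA1 m r y + opA2 m D y) ∘L ContinuousLinearMap.snd ℂ _ _).prod
      ((opB1 m r y + opB2 m D y) ∘L ContinuousLinearMap.fst ℂ _ _)) ∘L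
    (e : MatL2 m →L[ℂ] _)

end Operator

section RiemannHilbert

/-- The jump matrix `V_l`. -/
def jumpMatrix (r : ℝ → ℂ) (y x : ℝ) : Matrix (Fin 2) (Fin 2) ℂ :=
  !![1 + (‖r x‖ : ℂ) ^ 2, conj (weight r y x); weight r y x, 1]

/-- Points off the real line other than the `z_j` and the `conj z_j`. -/
def DiscreteData.domain {N : ℕ} (D : DiscreteData N) : Set ℂ :=
  {z | z.im ≠ 0 ∧ ∀ j, z ≠ D.pole j ∧ z ≠ conj (D.pole j)}

/-- At the point `p` the function `M` has at most a simple pole, and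
`Res_p M = lim_{z → p} M(z) A`. -/
def HasResidueCondition (M : ℂ → Matrix (Fin 2) (Fin 2) ℂ) (p : ℂ)
    (A : Matrix (Fin 2) (Fin 2) ℂ) : Prop :=
  ∃ L : Matrix (Fin 2) (Fin 2) ℂ,
    Tendsto (fun z => (z - p) • M z) (𝓝[≠] p) (𝓝 L) ∧
    Tendsto (fun z => M z * A) (𝓝[≠] p) (𝓝 L)

/-- `M` solves, in the `L²` sense, the Riemann–Hilbert problem for `M_l` with reflection
coefficient `r`, discrete data `D` and parameter `y`. -/
structure IsRHSolution {N : ℕ} (r : ℝ → ℂ) (D : DiscreteData N) (y : ℝ)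
    (M : ℂ → Matrix (Fin 2) (Fin 2) ℂ) : Prop where
  analytic : ∀ a b, DifferentiableOn ℂ (fun z => M z a b) D.domain
  residue : ∀ j, HasResidueCondition M (D.pole j) !![0, 0; D.coeff y j, 0]
  residue_conj : ∀ j,
    HasResidueCondition M (conj (D.pole j)) !![0, -conj (D.coeff y j); 0, 0]
  /-- Normalization `M → I`: away from the poles, `M - I` is square integrable on the horizontal
  lines, with a uniform bound. -/
  normalized : ∀ a b, ∀ ε : ℝ, 0 < ε → ∃ C : ℝ≥0, ∀ γ : ℝ, γ ≠ 0 →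
    ∫⁻ x in {x : ℝ | ∀ j, ε ≤ ‖(x + γ * I : ℂ) - D.pole j‖ ∧
        ε ≤ ‖(x + γ * I : ℂ) - conj (D.pole j)‖},
      ‖M (x + γ * I) a b - (1 : Matrix (Fin 2) (Fin 2) ℂ) a b‖ₑ ^ 2 ≤ C
  /-- The boundary values on the real line exist, as limits in `L²`, and `M₊ = M₋ V_l`. -/
  jump : ∃ Mplus Mminus : ℝ → Matrix (Fin 2) (Fin 2) ℂ,
    (∀ a b, MemLp (fun x => Mplus x a b - (1 : Matrix (Fin 2) (Fin 2) ℂ) a b) 2 volume) ∧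
    (∀ a b, MemLp (fun x => Mminus x a b - (1 : Matrix (Fin 2) (Fin 2) ℂ) a b) 2 volume) ∧
    (∀ a b, Tendsto (fun γ : ℝ => eLpNorm (fun x : ℝ => M (x + γ * I) a b - Mplus x a b) 2 volume)
      (𝓝[>] 0) (𝓝 0)) ∧
    (∀ a b, Tendsto (fun γ : ℝ => eLpNorm (fun x : ℝ => M (x - γ * I) a b - Mminus x a b) 2 volume)
      (𝓝[>] 0) (𝓝 0)) ∧
    ∀ᵐ x : ℝ, Mplus x = Mminus x * jumpMatrix r y x

end RiemannHilbert

end MCH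

end

noncomputable section

namespace MCH

/-! Let `P₊`, `P₋` be the orthogonal projections of `L²` onto the Hardy spaces of the upper and
lower half-plane, let `Q(f₁, f₂) = (P₋ f₁, P₊ f₂)`, and write `w = r e^{-2iθ}`. Since `θ` is real on
the line, `|w| = |r|`, and `r` is bounded because `s > 1/2` makes its Fourier transform integrable.

The range of `𝒦` lies in that of `Q`, and there `𝒦` is skew-adjoint. For the continuous part, the
compressions of multiplication by `w` and by `conj w` between the two Hardy spaces are adjoint, and
the sign in `𝒞₋` makes the adjoint negative. For the discrete part, `(x - conj z)⁻¹` is, up to the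
factor `2πi`, the reproducing kernel of the Cauchy integral at `z` (`inner_poleFun_left`);
conjugating `2πi` supplies the sign. So `Re ⟨(1 - 𝒦Q)f, f⟩ = ‖f‖²`, and `1 - 𝒦Q` has an inverse `R`
with `‖R‖ ≤ 1`. With `L = 𝒦(1 - Q)` one has `L𝒦 = 0`, hence `1 - 𝒦 = (1 - L)(1 - 𝒦Q)` and `(1 - 𝒦)⁻¹
= R(1 + L)`. On the range of `1 - Q` the point evaluations vanish, so `‖L‖ ≤ ‖r‖_∞`: neither `y` nor
the discrete data enter the bound. This is `exists_inverse_one_sub`, applied in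
`exists_inverse_one_sub_opK`; Fredholmness and index zero follow from invertibility.

For the Riemann–Hilbert problem, `V_l` is the product of an upper and a lower unitriangular matrix
with off-diagonal entries `conj w` and `w`. Hence `M₊ = M₋ V_l` says that the first column jumps by
`w` times the second column of `M₊`, and the second by `conj w` times the first column of `M₋`. With
`f₁`, `f₂` the deviations of those two boundary columns from `e₁`, `e₂`, the problem becomes `f =
𝒦(I + f)`, which has exactly one solution by the first part.

The equivalence has two halves. From a density, the columns are Cauchy integrals of their jumps plus
simple fractions (`IsDensity.isRHSolution`); slices of a Cauchy integral along horizontal lines are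
damped Fourier cutoffs, which gives their `L²` bounds and boundary values. Conversely, subtracting
the poles of a solution leaves a Hardy function on each side, recovered from its boundary values by
Cauchy's formula (`eq_cauchy_integral_add_poles`), so every solution comes from a density
(`IsRHSolution.exists_isDensity`). -/

/-! ### Fourier inversion and the Sobolev embedding -/

lemma continuous_fourierInv {E : Type*} [NormedAddCommGroup E] [NormedSpace ℂ E] {v : ℝ → E}
    (hv : Integrable v) : Continuous (𝓕⁻ v : ℝ → E) :=
  VectorFourier.fourierIntegral_continuous Real.continuous_fourierChar
    (by simp; fun_prop) hv

section FourierInverse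

variable {F : Type*} [NormedAddCommGroup F] [InnerProductSpace ℂ F] [CompleteSpace F]

open scoped SchwartzMap

lemma integral_schwartz_fourierInv_smul {v : ℝ → F} (hv : Integrable v) (φ : 𝓢(ℝ, ℂ)) :
    ∫ ξ : ℝ, (𝓕⁻ φ) ξ • v ξ = ∫ x : ℝ, φ x • (𝓕⁻ v : ℝ → F) x := by
  have h := VectorFourier.integral_fourierIntegral_smul_eq_flip (e := 𝐞) (μ := volume)
    (ν := volume) (L := -innerₗ ℝ) (f := (φ : ℝ → ℂ)) (g := v) Real.continuous_fourierChar
    (by simp; fun_prop) φ.integrable hv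
  have h2 : (-innerₗ ℝ : ℝ →ₗ[ℝ] ℝ →ₗ[ℝ] ℝ).flip = -innerₗ ℝ := by
    ext
    simp
  rw [h2] at h
  rw [SchwartzMap.fourierInv_coe]
  exact h

/-- An `L²` function whose Fourier transform, as a tempered distribution, is an integrable function
is given by the inverse Fourier integral. -/
theorem ae_eq_fourierInv_of_fourier_eq (u : Lp F 2 (volume : Measure ℝ))
    (v : Lp F 1 (volume : Measure ℝ))
    (h : 𝓕 (Lp.toTemperedDistribution u) = Lp.toTemperedDistribution v) :
    u =ᵐ[volume] (𝓕⁻ (v : ℝ → F) : ℝ → F) := by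
  have hv : Integrable v := L1.integrable_coeFn v
  refine ae_eq_of_integral_contDiff_smul_eq ((Lp.memLp u).locallyIntegrable (by norm_num))
    (continuous_fourierInv hv).locallyIntegrable fun g hg hgc => ?_
  have hg₁ : HasCompactSupport (Complex.ofRealCLM ∘ g) := hgc.comp_left rfl
  have hg₂ : ContDiff ℝ (⊤ : ℕ∞) (Complex.ofRealCLM ∘ g) := by fun_prop
  let φ := hg₁.toSchwartzMap hg₂
  have hφ : ∀ x, φ x = (g x : ℂ) := fun x => rfl
  -- Tested on `𝓕⁻ φ`, the left side is the integral of `φ u`, and the right side moves `𝓕⁻` onto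
  -- `v`.
  have h1 := congrArg (fun T => T (𝓕⁻ φ)) h
  simp only [TemperedDistribution.fourier_apply, FourierTransform.fourier_fourierInv_eq,
    Lp.toTemperedDistribution_apply] at h1
  rw [integral_schwartz_fourierInv_smul hv] at h1
  simpa [hφ] using h1

/-- Above half the dimension the weight `(1 + |ξ|²)^{-s/2}` is square integrable, so the Fourier
transform is integrable by Cauchy–Schwarz, and its `L¹` norm bounds the function. -/
theorem memLp_top_of_memSobolev {s : ℝ} (hs : 1 / 2 < s) (r : Lp F 2 (volume : Measure ℝ))
    (hr : TemperedDistribution.MemSobolev s 2 (r : TemperedDistribution ℝ F)) :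
    MemLp r ∞ volume := by
  obtain ⟨v, hv⟩ := hr.fourier_memL1 (by simp; linarith)
  refine memLp_top_of_bound (Lp.aestronglyMeasurable r) (∫ ξ, ‖v ξ‖) ?_
  filter_upwards [ae_eq_fourierInv_of_fourier_eq r v hv] with x hx
  rw [hx]
  exact VectorFourier.norm_fourierIntegral_le_integral_norm _ _ _ _ _

/-- The inverse Fourier transform of a function in `L¹ ∩ L²` is the inverse Fourier integral. -/
theorem coeFn_fourierTransform_symm (h : Lp F 2 (volume : Measure ℝ)) (hi : Integrable h) :
    ((Lp.fourierTransformₗᵢ ℝ F).symm h : Lp F 2 (volume : Measure ℝ)) =ᵐ[volume]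
      fun x => ∫ ξ : ℝ, exp (2 * Real.pi * I * x * ξ) • h ξ := by
  have key := ae_eq_fourierInv_of_fourier_eq ((Lp.fourierTransformₗᵢ ℝ F).symm h)
    hi.toL1 (by
      rw [Lp.fourier_toTemperedDistribution_eq]
      have : 𝓕 ((Lp.fourierTransformₗᵢ ℝ F).symm h) = h :=
        (Lp.fourierTransformₗᵢ ℝ F).apply_symm_apply h
      rw [this]
      ext φ
      simp only [Lp.toTemperedDistribution_apply]
      refine integral_congr_ae ?_
      filter_upwards [hi.coeFn_toL1] with x hx
      rw [hx])
  refine key.trans (Eventually.of_forall fun x => ?_)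
  simp only [Real.fourierInv_eq']
  refine integral_congr_ae ?_
  filter_upwards [hi.coeFn_toL1] with ξ hξ
  rw [hξ]
  congr 2
  simp
  ring

end FourierInverse

/-! ### Exponentials on a half-line -/

/-- The half-plane sign: `1` in the open upper half-plane, `-1` in the lower one. -/
def side (z : ℂ) : ℂ := if 0 < z.im then 1 else -1

/-- `e^{2πizξ}`, cut off to the half-line of those `ξ` on which it decays. -/
def symbol (z : ℂ) : ℝ → ℂ :=
  {ξ : ℝ | 0 < z.im * ξ}.indicator fun ξ => exp (2 * Real.pi * I * z * ξ)

lemma side_mul_self (z : ℂ) : side z * side z = 1 := by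
  unfold side
  split_ifs <;> norm_num

lemma side_neg {z : ℂ} (hz : z.im ≠ 0) : side (-z) = -side z := by
  unfold side
  rcases hz.lt_or_gt with h | h
  · simp [h, h.not_gt]
  · simp [h, h.le]

lemma side_conj {z : ℂ} (hz : z.im ≠ 0) : side (conj z) = -side z := by
  rw [← side_neg hz]
  simp [side]

lemma conj_side (z : ℂ) : conj (side z) = side z := by
  unfold side
  split_ifs <;> simp

lemma halfLine_of_pos {z : ℂ} (hz : 0 < z.im) : {ξ : ℝ | 0 < z.im * ξ} = Set.Ioi 0 := by
  ext ξ
  simp [hz]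

lemma halfLine_of_neg {z : ℂ} (hz : z.im < 0) : {ξ : ℝ | 0 < z.im * ξ} = Set.Iio 0 := by
  ext ξ
  simp [mul_pos_iff, hz, hz.le]

lemma measurableSet_halfLine (z : ℂ) : MeasurableSet {ξ : ℝ | 0 < z.im * ξ} :=
  measurableSet_lt measurable_const (by fun_prop)

lemma measurable_symbol (z : ℂ) : Measurable (symbol z) :=
  Measurable.indicator (by fun_prop) (measurableSet_halfLine z)

lemma integrable_symbol {z : ℂ} (hz : z.im ≠ 0) : Integrable (symbol z) := by
  rw [symbol, integrable_indicator_iff (measurableSet_halfLine z)]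
  rcases hz.lt_or_gt with h | h
  · rw [halfLine_of_neg h]
    exact (integrableOn_exp_mul_complex_Iic (a := 2 * Real.pi * I * z) (by
      simp only [mul_re, mul_im, re_ofNat, im_ofNat, ofReal_re, ofReal_im, I_re, I_im]
      nlinarith [Real.pi_pos]) 0).mono_set Set.Iio_subset_Iic_self
  · rw [halfLine_of_pos h]
    exact integrableOn_exp_mul_complex_Ioi (a := 2 * Real.pi * I * z) (by
      simp only [mul_re, mul_im, re_ofNat, im_ofNat, ofReal_re, ofReal_im, I_re, I_im]
      nlinarith [Real.pi_pos]) 0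

lemma integral_symbol {z : ℂ} (hz : z.im ≠ 0) :
    ∫ ξ, symbol z ξ = -side z / (2 * Real.pi * I * z) := by
  rw [symbol, integral_indicator (measurableSet_halfLine z)]
  rcases hz.lt_or_gt with h | h
  · rw [halfLine_of_neg h, ← integral_Iic_eq_integral_Iio,
      integral_exp_mul_complex_Iic (a := 2 * Real.pi * I * z) (by
        simp only [mul_re, mul_im, re_ofNat, im_ofNat, ofReal_re, ofReal_im, I_re, I_im]
        nlinarith [Real.pi_pos]) 0]
    simp [side, h.not_gt]
  · rw [halfLine_of_pos h, integral_exp_mul_complex_Ioi (a := 2 * Real.pi * I * z) (by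
        simp only [mul_re, mul_im, re_ofNat, im_ofNat, ofReal_re, ofReal_im, I_re, I_im]
        nlinarith [Real.pi_pos]) 0]
    simp [side, h]

/-- Points of one half-plane, and their sum, have the same half-line of decay, so only the
exponentials multiply. -/
lemma symbol_mul_symbol {z w : ℂ} (h : 0 < z.im * w.im) (ξ : ℝ) :
    symbol z ξ * symbol w ξ = symbol (z + w) ξ := by
  have h0 : z.im ≠ 0 := fun h' => by simp [h'] at h
  have h1 : {ξ : ℝ | 0 < z.im * ξ} = {ξ : ℝ | 0 < (z + w).im * ξ} ∧
      {ξ : ℝ | 0 < w.im * ξ} = {ξ : ℝ | 0 < (z + w).im * ξ} := by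
    rcases h0.lt_or_gt with hz | hz
    · have hw : w.im < 0 := by nlinarith
      rw [halfLine_of_neg hz, halfLine_of_neg hw, halfLine_of_neg (by simp; linarith)]
      simp
    · have hw : 0 < w.im := by nlinarith
      rw [halfLine_of_pos hz, halfLine_of_pos hw, halfLine_of_pos (by simp; linarith)]
      simp
  rw [symbol, symbol, symbol, h1.1, h1.2]
  simp only [Set.indicator_apply]
  split_ifs
  · rw [← Complex.exp_add]
    congr 1
    ring
  · simp

lemma exp_mul_symbol (x : ℝ) (z : ℂ) (ξ : ℝ) :
    exp (2 * Real.pi * I * x * ξ) * symbol z ξ = symbol (x + z) ξ := by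
  simp only [symbol, Set.indicator_apply, add_im, ofReal_im, zero_add, Set.mem_ofPred_eq]
  split_ifs
  · rw [← Complex.exp_add]
    congr 1
    ring
  · simp

lemma conj_symbol (z : ℂ) (ξ : ℝ) : conj (symbol z ξ) = symbol (-conj z) ξ := by
  simp only [symbol, Set.indicator_apply, neg_im, conj_im, neg_neg, Set.mem_ofPred_eq]
  split_ifs
  · rw [← Complex.exp_conj]
    congr 1
    simp [map_ofNat]
  · simp

lemma memLp_symbol {z : ℂ} (hz : z.im ≠ 0) : MemLp (symbol z) 2 (volume : Measure ℝ) := by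
  rw [memLp_two_iff_integrable_sq_norm (measurable_symbol z).aestronglyMeasurable]
  -- The square of `|symbol z|` is `|symbol (2z)|`, so square integrability reduces to
  -- integrability.
  have h : Integrable (symbol (z + z)) := integrable_symbol (by simpa using hz)
  refine h.norm.congr (Eventually.of_forall fun ξ => ?_)
  simp only
  rw [← symbol_mul_symbol (mul_self_pos.2 hz), norm_mul, sq]

/-! ### Multiplication operators and Fourier cutoffs -/

lemma coeFn_mulOp (m : ℕ) {φ : ℝ → ℂ} (h : MemLp φ ∞ volume) (f : L2 (Col m)) :
    mulOp m h.toLp f =ᵐ[volume] fun x => φ x • f x := by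
  filter_upwards [(ContinuousLinearMap.lsmul ℂ ℂ).coeFn_holder (r := 2) h.toLp f, h.coeFn_toLp]
    with x h1 h2
  change ((ContinuousLinearMap.lsmul ℂ ℂ).holder 2 h.toLp f : L2 (Col m)) x = _
  rw [h1, h2]
  simp

lemma coeFn_mulFun (m : ℕ) {φ : ℝ → ℂ} (h : MemLp φ ∞ volume) (f : L2 (Col m)) :
    mulFun m φ f =ᵐ[volume] fun x => φ x • f x := by
  rw [mulFun, dif_pos h]
  exact coeFn_mulOp m h f

lemma norm_mulFun_le (m : ℕ) {φ : ℝ → ℂ} (h : MemLp φ ∞ volume) :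
    ‖mulFun m φ‖ ≤ (eLpNorm φ ∞ volume).toReal := by
  rw [mulFun, dif_pos h, ← Lp.norm_toLp φ h]
  refine ContinuousLinearMap.opNorm_le_bound _ (norm_nonneg _) fun f => ?_
  refine ((ContinuousLinearMap.lsmul ℂ ℂ).norm_holder_apply_apply_le (r := 2) h.toLp f).trans ?_
  gcongr
  have := ContinuousLinearMap.opNorm_lsmul_le (𝕜 := ℂ) (R := ℂ) (E := Col m)
  nlinarith [norm_nonneg h.toLp]

/-- The Fourier transform on `L²(ℝ; ℂᵐ)`. -/
abbrev fourierL2 (m : ℕ) : L2 (Col m) ≃ₗᵢ[ℂ] L2 (Col m) := Lp.fourierTransformₗᵢ ℝ (Col m)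

open Classical in
lemma fourierL2_fourierCutoff (m : ℕ) {s : Set ℝ} (hs : MeasurableSet s) (f : L2 (Col m)) :
    fourierL2 m (fourierCutoff m s hs f) =ᵐ[volume] s.indicator (fourierL2 m f) := by
  have h : fourierL2 m (fourierCutoff m s hs f) =
      mulOp m (memLp_indicator s hs).toLp (fourierL2 m f) :=
    (fourierL2 m).apply_symm_apply _
  rw [h]
  filter_upwards [coeFn_mulOp m (memLp_indicator s hs) (fourierL2 m f)] with ξ hξ
  rw [hξ]
  simp only [Set.indicator_apply]
  split_ifs <;> simp

open Classical in
lemma fourierCutoff_eq_self (m : ℕ) {s : Set ℝ} (hs : MeasurableSet s) {f : L2 (Col m)}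
    (h : ∀ᵐ ξ, ξ ∉ s → (fourierL2 m f) ξ = 0) : fourierCutoff m s hs f = f := by
  apply (fourierL2 m).injective
  apply Lp.ext
  filter_upwards [fourierL2_fourierCutoff m hs f, h] with ξ h1 h2
  rw [h1, Set.indicator_apply]
  split_ifs with h3
  · rfl
  · exact (h2 h3).symm

lemma fourierCutoff_idem (m : ℕ) {s : Set ℝ} (hs : MeasurableSet s) (f : L2 (Col m)) :
    fourierCutoff m s hs (fourierCutoff m s hs f) = fourierCutoff m s hs f := by
  apply fourierCutoff_eq_self
  filter_upwards [fourierL2_fourierCutoff m hs f] with ξ h1 h2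
  rw [h1, Set.indicator_of_notMem h2]

open Classical in
lemma fourierCutoff_disjoint (m : ℕ) {s t : Set ℝ} (hs : MeasurableSet s) (ht : MeasurableSet t)
    (hst : Disjoint s t) (f : L2 (Col m)) :
    fourierCutoff m s hs (fourierCutoff m t ht f) = 0 := by
  apply (fourierL2 m).injective
  apply Lp.ext
  rw [map_zero]
  filter_upwards [fourierL2_fourierCutoff m hs (fourierCutoff m t ht f),
    fourierL2_fourierCutoff m ht f, Lp.coeFn_zero (Col m) 2 (volume : Measure ℝ)] with ξ h1 h2 h3
  rw [h1, h3, Set.indicator_apply]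
  split_ifs with h
  · rw [h2, Set.indicator_of_notMem (Set.disjoint_left.1 hst h)]
    rfl
  · rfl

lemma fourierCutoff_Ioi_add_Iio (m : ℕ) (f : L2 (Col m)) :
    fourierCutoff m (Set.Ioi 0) measurableSet_Ioi f +
      fourierCutoff m (Set.Iio 0) measurableSet_Iio f = f := by
  apply (fourierL2 m).injective
  rw [map_add]
  apply Lp.ext
  have h0 : ∀ᵐ ξ : ℝ, ξ ≠ 0 := by simp [ae_iff]
  filter_upwards [fourierL2_fourierCutoff m measurableSet_Ioi f,
    fourierL2_fourierCutoff m measurableSet_Iio f, h0,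
    Lp.coeFn_add (fourierL2 m (fourierCutoff m (Set.Ioi 0) measurableSet_Ioi f))
      (fourierL2 m (fourierCutoff m (Set.Iio 0) measurableSet_Iio f))] with ξ h1 h2 h3 h4
  rw [h4, Pi.add_apply, h1, h2]
  rcases h3.lt_or_gt with h | h
  · simp [h, h.le]
  · simp [h, h.le]

open Classical in
lemma inner_fourierCutoff_left (m : ℕ) {s : Set ℝ} (hs : MeasurableSet s) (f g : L2 (Col m)) :
    inner ℂ (fourierCutoff m s hs f) g = inner ℂ f (fourierCutoff m s hs g) := by
  rw [← (fourierL2 m).inner_map_map, ← (fourierL2 m).inner_map_map f, L2.inner_def, L2.inner_def]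
  refine integral_congr_ae ?_
  filter_upwards [fourierL2_fourierCutoff m hs f, fourierL2_fourierCutoff m hs g] with ξ h1 h2
  rw [h1, h2]
  simp only [Set.indicator_apply]
  split_ifs <;> simp

lemma norm_fourierCutoff_le (m : ℕ) {s : Set ℝ} (hs : MeasurableSet s) (f : L2 (Col m)) :
    ‖fourierCutoff m s hs f‖ ≤ ‖f‖ := by
  rw [← (fourierL2 m).norm_map, ← (fourierL2 m).norm_map f]
  refine Lp.norm_le_norm_of_ae_le ?_
  filter_upwards [fourierL2_fourierCutoff m hs f] with ξ h1
  rw [h1]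
  exact norm_indicator_le_norm_self _ _

lemma disjoint_Ioi_Iio : Disjoint (Set.Ioi (0 : ℝ)) (Set.Iio 0) :=
  Set.disjoint_left.2 fun _ h1 h2 => lt_asymm (Set.mem_Ioi.1 h1) (Set.mem_Iio.1 h2)

/-! ### Simple fractions and Cauchy functionals on the Fourier side -/

/-- `ξ ↦ symbol z ξ • v` as an element of `L²`. -/
def symbolFun (m : ℕ) {z : ℂ} (hz : z.im ≠ 0) (v : Col m) : L2 (Col m) :=
  (ContinuousLinearMap.toSpanSingleton ℂ v).compLp (memLp_symbol hz).toLp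

lemma coeFn_symbolFun (m : ℕ) {z : ℂ} (hz : z.im ≠ 0) (v : Col m) :
    symbolFun m hz v =ᵐ[volume] fun ξ => symbol z ξ • v := by
  filter_upwards [(ContinuousLinearMap.toSpanSingleton ℂ v).coeFn_compLp
    (memLp_symbol hz).toLp, (memLp_symbol hz).coeFn_toLp] with ξ h1 h2
  rw [symbolFun, h1, h2]
  simp

lemma fourierL2_symm_symbolFun (m : ℕ) {z : ℂ} (hz : z.im ≠ 0) (v : Col m) :
    (fourierL2 m).symm (symbolFun m hz v) =ᵐ[volume]
      fun x => (-side z / (2 * Real.pi * I * (x + z))) • v := by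
  have hi : Integrable (symbolFun m hz v) :=
    ((integrable_symbol hz).smul_const v).congr (coeFn_symbolFun m hz v).symm
  refine (coeFn_fourierTransform_symm _ hi).trans (Eventually.of_forall fun x => ?_)
  have hx : ((x : ℂ) + z).im ≠ 0 := by simpa using hz
  have h1 : ∀ᵐ ξ : ℝ, exp (2 * Real.pi * I * x * ξ) • symbolFun m hz v ξ =
      symbol (x + z) ξ • v := by
    filter_upwards [coeFn_symbolFun m hz v] with ξ hξ
    rw [hξ, smul_smul, exp_mul_symbol]
  have h2 : side (x + z) = side z := by simp [side]
  simp only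
  rw [integral_congr_ae h1, integral_smul_const, integral_symbol hx, h2]

/-- Inverting the transform of a half-line exponential gives a simple fraction. In particular `(x -
z)⁻¹` has frequencies of one sign only: it belongs to the Hardy space of the half-plane that does
not contain its pole. -/
lemma fourierL2_poleFun (m : ℕ) {z : ℂ} (hz : z.im ≠ 0) (v : Col m) :
    fourierL2 m (poleFun m z hz v) =
      (2 * Real.pi * I * side z) • symbolFun m (z := -z) (by simpa using hz) v := by
  rw [← LinearIsometryEquiv.eq_symm_apply, map_smul]
  apply Lp.ext
  refine (coeFn_poleFun m z hz v).trans (EventuallyEq.symm ?_)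
  refine (Lp.coeFn_smul _ _).trans ?_
  filter_upwards [fourierL2_symm_symbolFun m (z := -z) (by simpa using hz) v] with x hx
  rw [Pi.smul_apply, hx, smul_smul, side_neg hz, ← sub_eq_add_neg]
  congr 1
  have h : (x : ℂ) - z ≠ 0 := fun h => hz (by simpa using congrArg im h)
  have h' : (Real.pi : ℂ) ≠ 0 := by simp [Real.pi_ne_zero]
  have h'' := side_mul_self z
  field_simp
  linear_combination h''

lemma fourierL2_poleFun_ae (m : ℕ) {z : ℂ} (hz : z.im ≠ 0) (v : Col m) :
    fourierL2 m (poleFun m z hz v) =ᵐ[volume]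
      fun ξ => (2 * Real.pi * I * side z * symbol (-z) ξ) • v := by
  rw [fourierL2_poleFun]
  filter_upwards [Lp.coeFn_smul (2 * Real.pi * I * side z)
    (symbolFun m (z := -z) (by simpa using hz) v),
    coeFn_symbolFun m (z := -z) (by simpa using hz) v] with ξ h1 h2
  rw [h1, Pi.smul_apply, h2, smul_smul]

lemma fourierCutoff_Iio_poleFun (m : ℕ) {z : ℂ} (hz : z.im ≠ 0) (hz' : 0 < z.im) (v : Col m) :
    fourierCutoff m (Set.Iio 0) measurableSet_Iio (poleFun m z hz v) = poleFun m z hz v := by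
  apply fourierCutoff_eq_self
  filter_upwards [fourierL2_poleFun_ae m hz v] with ξ h1 h2
  rw [h1, symbol, halfLine_of_neg (by simpa using hz'), Set.indicator_of_notMem h2]
  simp

lemma fourierCutoff_Ioi_poleFun (m : ℕ) {z : ℂ} (hz : z.im ≠ 0) (hz' : z.im < 0) (v : Col m) :
    fourierCutoff m (Set.Ioi 0) measurableSet_Ioi (poleFun m z hz v) = poleFun m z hz v := by
  apply fourierCutoff_eq_self
  filter_upwards [fourierL2_poleFun_ae m hz v] with ξ h1 h2
  rw [h1, symbol, halfLine_of_pos (by simpa using hz'), Set.indicator_of_notMem h2]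
  simp

/-- The Cauchy integral at a point is adjoint to the embedding of simple fractions. -/
lemma inner_poleFun_left (m : ℕ) {z : ℂ} (hz : z.im ≠ 0) (hz' : (conj z).im ≠ 0) (v : Col m)
    (f : L2 (Col m)) :
    inner ℂ (poleFun m (conj z) hz' v) f = 2 * Real.pi * I * inner ℂ v (cauchyAt m z hz f) := by
  rw [cauchyAt_apply, inner_smul_right, L2.inner_def]
  have hI : Integrable fun s : ℝ => ((s : ℂ) - z)⁻¹ • f s := by
    exact (memLp_one_iff_integrable.1 ((Lp.memLp f).smul (memLp_kernel z hz)))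
  rw [← integral_inner hI, ← mul_assoc, mul_inv_cancel₀ (by simp [Real.pi_ne_zero]), one_mul]
  refine integral_congr_ae ?_
  filter_upwards [coeFn_poleFun m (conj z) hz' v] with x hx
  rw [hx, inner_smul_left, inner_smul_right]
  simp

/-- The Cauchy integral in terms of the Fourier transform. -/
lemma cauchyAt_eq_integral_fourier (m : ℕ) {z : ℂ} (hz : z.im ≠ 0) (f : L2 (Col m)) :
    cauchyAt m z hz f = side z • ∫ ξ, symbol z ξ • fourierL2 m f ξ := by
  refine ext_inner_left ℂ fun v => ?_
  have hz' : (conj z).im ≠ 0 := by simpa using hz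
  have hpi : (2 * Real.pi * I : ℂ) ≠ 0 := by simp [Real.pi_ne_zero]
  refine mul_left_cancel₀ hpi ?_
  rw [← inner_poleFun_left m hz hz', ← (fourierL2 m).inner_map_map, L2.inner_def,
    inner_smul_right]
  have hI : Integrable fun ξ : ℝ => symbol z ξ • fourierL2 m f ξ :=
    memLp_one_iff_integrable.1 ((Lp.memLp (fourierL2 m f)).smul (memLp_symbol hz))
  rw [← integral_inner hI, ← mul_assoc, ← integral_const_mul]
  refine integral_congr_ae ?_
  filter_upwards [fourierL2_poleFun_ae m hz' v] with ξ hξ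
  rw [hξ, inner_smul_left, inner_smul_right, side_conj hz, ← conj_conj (symbol (-conj z) ξ),
    ← conj_symbol]
  simp [conj_side, map_ofNat]
  ring

/-- Since `-w` lies in the half-plane of `z`, the half-line exponentials of `z` and `-w` multiply to
that of `z - w`, whose integral is explicit. The factor `side z` is the orientation of the line as a
boundary. -/
lemma cauchyAt_poleFun (m : ℕ) {z w : ℂ} (hz : z.im ≠ 0) (hw : w.im ≠ 0) (h : z.im * w.im < 0)
    (v : Col m) : cauchyAt m z hz (poleFun m w hw v) = (side z * (z - w)⁻¹) • v := by
  have h' : 0 < z.im * (-w).im := by simpa using h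
  rw [cauchyAt_eq_integral_fourier]
  have h1 : ∀ᵐ ξ : ℝ, symbol z ξ • fourierL2 m (poleFun m w hw v) ξ =
      (2 * Real.pi * I * side w * symbol (z - w) ξ) • v := by
    filter_upwards [fourierL2_poleFun_ae m hw v] with ξ hξ
    rw [hξ, smul_smul, sub_eq_add_neg, ← symbol_mul_symbol h']
    congr 1
    ring
  have h2 : (z - w).im ≠ 0 := by
    simp only [sub_im]
    intro h3
    rw [sub_eq_zero.1 h3] at h
    nlinarith [mul_self_nonneg w.im]
  have h3 : z - w ≠ 0 := fun h4 => h2 (by simp [h4])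
  rw [integral_congr_ae h1, integral_smul_const, integral_const_mul, integral_symbol h2, smul_smul]
  congr 1
  have h4 : side (z - w) = side z ∧ side w = -side z := by
    unfold side
    rcases hz.lt_or_gt with h5 | h5
    · have : 0 < w.im := by nlinarith
      simp [h5.not_gt, this, sub_im, (h5.trans this).le]
    · have : w.im < 0 := by nlinarith
      simp [h5, this.not_gt, sub_im, this.trans h5]
  have hpi : (Real.pi : ℂ) ≠ 0 := by simp [Real.pi_ne_zero]
  rw [h4.1, h4.2]
  have h5 := side_mul_self z
  field_simp
  linear_combination (side z) * h5

/-- The functional at `z` is represented by the fraction with pole `conj z`, which has positive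
frequencies only; moving the cutoff onto that fraction changes nothing. -/
lemma cauchyAt_fourierCutoff_Ioi (m : ℕ) {z : ℂ} (hz : z.im ≠ 0) (hz' : 0 < z.im)
    (f : L2 (Col m)) :
    cauchyAt m z hz (fourierCutoff m (Set.Ioi 0) measurableSet_Ioi f) = cauchyAt m z hz f := by
  refine ext_inner_left ℂ fun v => ?_
  have hpi : (2 * Real.pi * I : ℂ) ≠ 0 := by simp [Real.pi_ne_zero]
  have hc : (conj z).im ≠ 0 := by simpa using hz
  refine mul_left_cancel₀ hpi ?_
  rw [← inner_poleFun_left m hz hc, ← inner_poleFun_left m hz hc, ← inner_fourierCutoff_left,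
    fourierCutoff_Ioi_poleFun m hc (by simpa using hz')]

lemma cauchyAt_fourierCutoff_Iio (m : ℕ) {z : ℂ} (hz : z.im ≠ 0) (hz' : z.im < 0)
    (f : L2 (Col m)) :
    cauchyAt m z hz (fourierCutoff m (Set.Iio 0) measurableSet_Iio f) = cauchyAt m z hz f := by
  refine ext_inner_left ℂ fun v => ?_
  have hpi : (2 * Real.pi * I : ℂ) ≠ 0 := by simp [Real.pi_ne_zero]
  have hc : (conj z).im ≠ 0 := by simpa using hz
  refine mul_left_cancel₀ hpi ?_
  rw [← inner_poleFun_left m hz hc, ← inner_poleFun_left m hz hc, ← inner_fourierCutoff_left,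
    fourierCutoff_Iio_poleFun m hc (by simpa using hz')]

lemma cauchyAt_fourierCutoff_Iio_eq_zero (m : ℕ) {z : ℂ} (hz : z.im ≠ 0) (hz' : 0 < z.im)
    (f : L2 (Col m)) :
    cauchyAt m z hz (fourierCutoff m (Set.Iio 0) measurableSet_Iio f) = 0 := by
  rw [← cauchyAt_fourierCutoff_Ioi m hz hz', fourierCutoff_disjoint m _ _
    disjoint_Ioi_Iio, map_zero]

lemma cauchyAt_fourierCutoff_Ioi_eq_zero (m : ℕ) {z : ℂ} (hz : z.im ≠ 0) (hz' : z.im < 0)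
    (f : L2 (Col m)) :
    cauchyAt m z hz (fourierCutoff m (Set.Ioi 0) measurableSet_Ioi f) = 0 := by
  rw [← cauchyAt_fourierCutoff_Iio m hz hz', fourierCutoff_disjoint m _ _
    disjoint_Ioi_Iio.symm, map_zero]

/-! ### Abstract inversion -/

/-- Inversion of `1 - K` when the range of `K` lies in that of an orthogonal projection `Q`, on
which `K` is skew-adjoint. -/
theorem exists_inverse_one_sub {E : Type*} [NormedAddCommGroup E] [InnerProductSpace ℂ E]
    [CompleteSpace E] (K Q : E →L[ℂ] E) (hQK : Q * K = K)
    (hskew : ∀ f, inner ℂ (K (Q f)) (Q f) = -inner ℂ (Q f) (K (Q f)))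
    (hself : ∀ f g, inner ℂ (Q f) g = inner ℂ f (Q g)) {ρ : ℝ} (hρ0 : 0 ≤ ρ)
    (hρ : ∀ f, ‖K (f - Q f)‖ ≤ ρ * ‖f‖) :
    ∃ T : E →L[ℂ] E, T * (1 - K) = 1 ∧ (1 - K) * T = 1 ∧ ‖T‖ ≤ 1 + ρ := by
  -- Since `K (Q f)` already lies in the range of `Q`, the skewness of `K` on that range extends to
  -- `K Q` on the whole space.
  have hre : ∀ f, inner ℂ (K (Q f)) f = -inner ℂ f (K (Q f)) := by
    intro f
    have h1 : K (Q f) = Q (K (Q f)) := (congrArg (fun A : E →L[ℂ] E => A (Q f)) hQK).symm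
    have h2 := hskew f
    rwa [← hself, ← h1, hself, ← h1] at h2
  have hnorm : ∀ f, ‖f‖ ^ 2 ≤ ‖inner ℂ ((1 - K * Q) f) f‖ := by
    intro f
    have h1 : (inner ℂ (K (Q f)) f).re = 0 := by
      have h2 := congrArg re (hre f)
      have h3 : (inner ℂ f (K (Q f))).re = (inner ℂ (K (Q f)) f).re := inner_re_symm (𝕜 := ℂ) _ _
      rw [neg_re, h3] at h2
      linarith
    have h4 : (inner ℂ ((1 - K * Q) f) f).re = ‖f‖ ^ 2 := by
      have : (1 - K * Q) f = f - K (Q f) := rfl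
      rw [this, inner_sub_left, sub_re, h1, sub_zero]
      exact inner_self_eq_norm_sq (𝕜 := ℂ) f
    rw [← h4]
    exact re_le_norm _
  -- Lax–Milgram: the real part of the quadratic form of `1 - K Q` is exactly `‖f‖²`, which also
  -- gives `‖R‖ ≤ 1` below.
  have hunit : IsUnit (1 - K * Q) :=
    ContinuousLinearMap.isUnit_of_forall_le_norm_inner_map _ (c := 1) one_pos
      (fun f => by rw [NNReal.coe_one, mul_one]; exact hnorm f)
  obtain ⟨u, hu⟩ := hunit
  set R : E →L[ℂ] E := ↑u⁻¹ with hR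
  have hRl : R * (1 - K * Q) = 1 := by rw [← hu]; exact u.inv_mul
  have hRr : (1 - K * Q) * R = 1 := by rw [← hu]; exact u.mul_inv
  have hRn : ‖R‖ ≤ 1 := by
    refine ContinuousLinearMap.opNorm_le_bound _ zero_le_one fun g => ?_
    have h1 : (1 - K * Q) (R g) = g := congrArg (fun A : E →L[ℂ] E => A g) hRr
    have h2 := hnorm (R g)
    rw [h1] at h2
    have h3 := h2.trans (norm_inner_le_norm _ _)
    rcases (norm_nonneg (R g)).eq_or_lt with h | h
    · rw [← h]
      positivity
    · nlinarith
  -- The part of `K` living on the complement of `Q`; it annihilates the range of `K`, so it is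
  -- nilpotent of order two.
  set L : E →L[ℂ] E := K * (1 - Q) with hL
  have hz : (1 - Q) * K = 0 := by rw [sub_mul, one_mul, hQK, sub_self]
  have hLn : ‖L‖ ≤ ρ := ContinuousLinearMap.opNorm_le_bound _ hρ0 hρ
  have hLL : L * L = 0 := by
    rw [hL, mul_assoc, ← mul_assoc (1 - Q), hz, zero_mul, mul_zero]
  have hLS : L * (K * Q) = 0 := by
    rw [hL, mul_assoc, ← mul_assoc (1 - Q), hz, zero_mul, mul_zero]
  have hK : 1 - K = (1 - K * Q) - L := by
    rw [hL, mul_sub, mul_one]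
    abel
  have hLR : L * R = L := by
    have h1 : R = 1 + K * Q * R := by
      have := hRr
      rw [sub_mul, one_mul] at this
      exact sub_eq_iff_eq_add.1 this
    rw [h1, mul_add, mul_one, ← mul_assoc, hLS, zero_mul, add_zero]
  -- Because `L K Q = 0`, the operator factors as `1 - K = (1 - L)(1 - K Q)`; with `L² = 0` its
  -- inverse is `R (1 + L)`.
  refine ⟨R + R * L, ?_, ?_, ?_⟩
  · have h1 : L * (1 - K * Q) = L := by rw [mul_sub, mul_one, hLS, sub_zero]
    rw [hK, mul_sub, add_mul, add_mul, hRl, mul_assoc, h1, mul_assoc, hLL, mul_zero]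
    abel
  · rw [hK, sub_mul, mul_add, mul_add, ← mul_assoc _ R L, hRr, ← mul_assoc L R L, hLR, hLL]
    rw [one_mul]
    abel
  · calc ‖R + R * L‖ ≤ ‖R‖ + ‖R‖ * ‖L‖ := (norm_add_le _ _).trans (by gcongr; exact norm_mul_le _ _)
      _ ≤ 1 + 1 * ρ := by gcongr
      _ = 1 + ρ := by ring

lemma isFredholm_index_of_inverse {E : Type*} [NormedAddCommGroup E] [NormedSpace ℂ E]
    (A T : E →L[ℂ] E) (h1 : T * A = 1) (h2 : A * T = 1) :
    A.IsFredholm ∧ A.toLinearMap.index = 0 := by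
  let e : E ≃ₗ[ℂ] E := LinearEquiv.ofLinearMap A.toLinearMap T.toLinearMap
      (by ext x; exact congrArg (fun B : E →L[ℂ] E => B x) h2)
      (by ext x; exact congrArg (fun B : E →L[ℂ] E => B x) h1)
  exact ⟨ContinuousLinearMap.isFredholm_iff_exists_isQuasiInverse.2 ⟨T, e.isQuasiInverse⟩,
    e.index_eq_zero⟩

/-! ### The weight on the real line -/

section Weight

variable {r : ℝ → ℂ} (y : ℝ)

lemma norm_exp_theta (x y : ℝ) : ‖exp (-2 * I * theta x y)‖ = 1 := by
  -- The phase is real for every real `x`; at `x = 0` the convention `1 / 0 = 0` keeps this true.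
  have : (-2 * I * theta x y : ℂ) = ((1 / 2 * (x - 1 / x) * y : ℝ) : ℂ) * I := by
    simp only [theta]
    push_cast
    ring
  rw [this, norm_exp_ofReal_mul_I]

lemma norm_weight (r : ℝ → ℂ) (y x : ℝ) : ‖weight r y x‖ = ‖r x‖ := by
  rw [weight, norm_mul, norm_exp_theta, mul_one]

lemma aestronglyMeasurable_weight (hr : AEStronglyMeasurable r volume) :
    AEStronglyMeasurable (weight r y) volume := by
  refine hr.mul (Measurable.aestronglyMeasurable ?_)
  unfold theta
  fun_prop

lemma memLp_weight {p : ℝ≥0∞} (hr : MemLp r p volume) : MemLp (weight r y) p volume :=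
  hr.of_le (aestronglyMeasurable_weight y hr.1) (Eventually.of_forall fun x =>
    (norm_weight r y x).le)

lemma memLp_conj_weight {p : ℝ≥0∞} (hr : MemLp r p volume) :
    MemLp (fun x => conj (weight r y x)) p volume :=
  hr.of_le (continuous_conj.comp_aestronglyMeasurable (aestronglyMeasurable_weight y hr.1))
    (Eventually.of_forall fun x => by rw [RCLike.norm_conj, norm_weight])

lemma norm_mulFun_weight_le (m : ℕ) (hr : MemLp r ∞ volume) (f : L2 (Col m)) :
    ‖mulFun m (weight r y) f‖ ≤ (eLpNorm r ∞ volume).toReal * ‖f‖ := by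
  refine (ContinuousLinearMap.le_opNorm _ f).trans ?_
  gcongr
  refine (norm_mulFun_le m (memLp_weight y hr)).trans_eq ?_
  rw [eLpNorm_congr_norm_ae (Eventually.of_forall fun x => norm_weight r y x)]

lemma norm_mulFun_conj_weight_le (m : ℕ) (hr : MemLp r ∞ volume) (f : L2 (Col m)) :
    ‖mulFun m (fun x => conj (weight r y x)) f‖ ≤ (eLpNorm r ∞ volume).toReal * ‖f‖ := by
  refine (ContinuousLinearMap.le_opNorm _ f).trans ?_
  gcongr
  refine (norm_mulFun_le m (memLp_conj_weight y hr)).trans_eq ?_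
  rw [eLpNorm_congr_norm_ae (g := r) (Eventually.of_forall fun x => by
    rw [RCLike.norm_conj, norm_weight])]

lemma inner_mulFun_weight_left (m : ℕ) (hr : MemLp r ∞ volume) (f g : L2 (Col m)) :
    inner ℂ (mulFun m (weight r y) f) g =
      inner ℂ f (mulFun m (fun x => conj (weight r y x)) g) := by
  rw [L2.inner_def, L2.inner_def]
  refine integral_congr_ae ?_
  filter_upwards [coeFn_mulFun m (memLp_weight y hr) f,
    coeFn_mulFun m (memLp_conj_weight y hr) g] with x h1 h2
  rw [h1, h2, inner_smul_left, inner_smul_right]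

end Weight

/-! ### Skew-adjointness and invertibility for the operator `𝒦` -/

section Operator

variable (m : ℕ) {N : ℕ} {r : ℝ → ℂ} (D : DiscreteData N) (y : ℝ)

/-- The orthogonal projection of `L²` onto the Hardy space of the upper half-plane. -/
abbrev projPlus : L2 (Col m) →L[ℂ] L2 (Col m) := fourierCutoff m (Set.Ioi 0) measurableSet_Ioi

/-- The orthogonal projection of `L²` onto the Hardy space of the lower half-plane. -/
abbrev projMinus : L2 (Col m) →L[ℂ] L2 (Col m) := fourierCutoff m (Set.Iio 0) measurableSet_Iio

lemma opA1_apply (f : L2 (Col m)) : opA1 m r y f = -projMinus m (mulFun m (weight r y) f) := rfl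

lemma opB1_apply (f : L2 (Col m)) :
    opB1 m r y f = projPlus m (mulFun m (fun x => conj (weight r y x)) f) := rfl

lemma opA2_apply (f : L2 (Col m)) : opA2 m D y f =
    ∑ j, D.coeff y j • poleFun m (D.pole j) (D.im_ne j)
      (cauchyAt m (D.pole j) (D.im_ne j) f) := by
  simp [opA2]

lemma opB2_apply (f : L2 (Col m)) : opB2 m D y f =
    ∑ j, conj (D.coeff y j) • poleFun m (conj (D.pole j)) (D.conj_im_ne j)
      (cauchyAt m (conj (D.pole j)) (D.conj_im_ne j) f) := by
  simp [opB2]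

lemma opK_apply (r : ℝ → ℂ) (f : MatL2 m) : opK m r D y f =
    WithLp.toLp 2 (opA1 m r y f.snd + opA2 m D y f.snd,
      opB1 m r y f.fst + opB2 m D y f.fst) := rfl

lemma projMinus_opA2 (f : L2 (Col m)) : projMinus m (opA2 m D y f) = opA2 m D y f := by
  rw [opA2_apply, map_sum]
  refine Finset.sum_congr rfl fun j _ => ?_
  rw [map_smul, fourierCutoff_Iio_poleFun m _ (D.pole_im_pos j)]

lemma projPlus_opB2 (f : L2 (Col m)) : projPlus m (opB2 m D y f) = opB2 m D y f := by
  rw [opB2_apply, map_sum]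
  refine Finset.sum_congr rfl fun j _ => ?_
  rw [map_smul, fourierCutoff_Ioi_poleFun m _ (by simpa using D.pole_im_pos j)]

/-- Evaluation at a point of the upper half-plane kills the lower Hardy space. This and its mirror
image `opB2_projPlus` keep the discrete data out of the norm bound. -/
lemma opA2_projMinus (f : L2 (Col m)) : opA2 m D y (projMinus m f) = 0 := by
  rw [opA2_apply]
  refine Finset.sum_eq_zero fun j _ => ?_
  rw [cauchyAt_fourierCutoff_Iio_eq_zero m _ (D.pole_im_pos j), map_zero, smul_zero]

lemma opB2_projPlus (f : L2 (Col m)) : opB2 m D y (projPlus m f) = 0 := by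
  rw [opB2_apply]
  refine Finset.sum_eq_zero fun j _ => ?_
  rw [cauchyAt_fourierCutoff_Ioi_eq_zero m _ (by simpa using D.pole_im_pos j), map_zero, smul_zero]

/-- The simple fraction with pole `z_j` represents the Cauchy integral at `conj z_j`, and
conversely. The minus sign is that of `conj (2πi) = -2πi`. No Hardy projection is needed here,
unlike for the continuous part. -/
lemma inner_opA2_left (f g : L2 (Col m)) :
    inner ℂ (opA2 m D y g) f = -inner ℂ g (opB2 m D y f) := by
  rw [opA2_apply, opB2_apply, sum_inner, inner_sum, ← Finset.sum_neg_distrib]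
  refine Finset.sum_congr rfl fun j _ => ?_
  have h1 : ∀ v, inner ℂ (poleFun m (D.pole j) (D.im_ne j) v) f =
      2 * Real.pi * I * inner ℂ v (cauchyAt m (conj (D.pole j)) (D.conj_im_ne j) f) := by
    intro v
    have := inner_poleFun_left m (D.conj_im_ne j) (by simpa using D.im_ne j) v f
    simpa only [conj_conj] using this
  rw [inner_smul_left, inner_smul_right, h1,
    ← inner_conj_symm g, inner_poleFun_left m (D.im_ne j) (D.conj_im_ne j), map_mul,
    inner_conj_symm]
  simp [map_ofNat]

/-- Between the Hardy spaces the projections are absorbed by the arguments; what remains is the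
adjointness of multiplication by `w` and by `conj w`, and the minus sign of `𝒞₋`. -/
lemma inner_opA1_left (hr : MemLp r ∞ volume) (f g : L2 (Col m)) :
    inner ℂ (opA1 m r y (projPlus m g)) (projMinus m f) =
      -inner ℂ (projPlus m g) (opB1 m r y (projMinus m f)) := by
  rw [opA1_apply, opB1_apply, inner_neg_left, inner_fourierCutoff_left, fourierCutoff_idem,
    inner_mulFun_weight_left y m hr, ← inner_fourierCutoff_left, fourierCutoff_idem]

/-- The orthogonal projection `(f₁, f₂) ↦ (P₋ f₁, P₊ f₂)`. -/
def hardyProj : MatL2 m →L[ℂ] MatL2 m :=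
  let e := WithLp.prodContinuousLinearEquiv 2 ℂ (L2 (Col m)) (L2 (Col m))
  (e.symm : _ →L[ℂ] MatL2 m) ∘L
    ((projMinus m ∘L ContinuousLinearMap.fst ℂ _ _).prod
      (projPlus m ∘L ContinuousLinearMap.snd ℂ _ _)) ∘L
    (e : MatL2 m →L[ℂ] _)

lemma hardyProj_apply (f : MatL2 m) :
    hardyProj m f = WithLp.toLp 2 (projMinus m f.fst, projPlus m f.snd) := rfl

theorem exists_inverse_one_sub_opK (hr : MemLp r ∞ volume) :
    ∃ T : MatL2 m →L[ℂ] MatL2 m, T * (1 - opK m r D y) = 1 ∧ (1 - opK m r D y) * T = 1 ∧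
      ‖T‖ ≤ 1 + (eLpNorm r ∞ volume).toReal := by
  refine exists_inverse_one_sub (opK m r D y) (hardyProj m) ?_ ?_ ?_ ENNReal.toReal_nonneg ?_
  · ext1 f
    change hardyProj m (opK m r D y f) = opK m r D y f
    simp only [hardyProj_apply, opK_apply, WithLp.toLp_fst, WithLp.toLp_snd, map_add,
      projMinus_opA2, projPlus_opB2, opA1_apply, opB1_apply, map_neg, fourierCutoff_idem]
  · rintro ⟨f, g⟩
    change inner ℂ (opA1 m r y (projPlus m g) + opA2 m D y (projPlus m g)) (projMinus m f) +
        inner ℂ (opB1 m r y (projMinus m f) + opB2 m D y (projMinus m f)) (projPlus m g) =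
      -(inner ℂ (projMinus m f) (opA1 m r y (projPlus m g) + opA2 m D y (projPlus m g)) +
        inner ℂ (projPlus m g) (opB1 m r y (projMinus m f) + opB2 m D y (projMinus m f)))
    have h : inner ℂ (opA1 m r y (projPlus m g) + opA2 m D y (projPlus m g)) (projMinus m f) =
        -inner ℂ (projPlus m g) (opB1 m r y (projMinus m f) + opB2 m D y (projMinus m f)) := by
      rw [inner_add_left, inner_add_right, inner_opA1_left m y hr, inner_opA2_left]
      ring
    -- The other off-diagonal block is the complex conjugate of the identity `h`.
    rw [← inner_conj_symm (_ + _) (projPlus m g), ← inner_conj_symm (projMinus m f), h, map_neg]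
    ring
  · rintro ⟨f, f'⟩ ⟨g, g'⟩
    change inner ℂ (projMinus m f) g + inner ℂ (projPlus m f') g' =
      inner ℂ f (projMinus m g) + inner ℂ f' (projPlus m g')
    rw [inner_fourierCutoff_left, inner_fourierCutoff_left]
  · rintro ⟨f, g⟩
    have h1 : f - projMinus m f = projPlus m f :=
      sub_eq_iff_eq_add.2 (fourierCutoff_Ioi_add_Iio m f).symm
    have h2 : g - projPlus m g = projMinus m g :=
      sub_eq_iff_eq_add'.2 (fourierCutoff_Ioi_add_Iio m g).symm
    -- On the complement of `Q` only the continuous parts survive, and each costs at most a factor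
    -- `‖r‖_∞`.
    have h3 : opK m r D y (WithLp.toLp 2 (f, g) - hardyProj m (WithLp.toLp 2 (f, g))) =
        WithLp.toLp 2 (opA1 m r y (projMinus m g), opB1 m r y (projPlus m f)) := by
      change WithLp.toLp 2
        (opA1 m r y (g - projPlus m g) + opA2 m D y (g - projPlus m g),
          opB1 m r y (f - projMinus m f) + opB2 m D y (f - projMinus m f)) = _
      rw [h1, h2, opA2_projMinus, opB2_projPlus, add_zero, add_zero]
    set ρ := (eLpNorm r ∞ volume).toReal
    have hρ : 0 ≤ ρ := ENNReal.toReal_nonneg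
    have h4 : ‖opA1 m r y (projMinus m g)‖ ≤ ρ * ‖g‖ := by
      rw [opA1_apply, norm_neg]
      refine (norm_fourierCutoff_le m _ _).trans ((norm_mulFun_weight_le y m hr _).trans ?_)
      gcongr
      exact norm_fourierCutoff_le m _ _
    have h5 : ‖opB1 m r y (projPlus m f)‖ ≤ ρ * ‖f‖ := by
      rw [opB1_apply]
      refine (norm_fourierCutoff_le m _ _).trans ((norm_mulFun_conj_weight_le y m hr _).trans ?_)
      gcongr
      exact norm_fourierCutoff_le m _ _
    refine (congrArg norm h3).trans_le ?_
    refine (sq_le_sq₀ (norm_nonneg _) (by positivity)).1 ?_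
    rw [mul_pow, WithLp.prod_norm_sq_eq_of_L2, WithLp.prod_norm_sq_eq_of_L2]
    change ‖opA1 m r y (projMinus m g)‖ ^ 2 + ‖opB1 m r y (projPlus m f)‖ ^ 2 ≤
      ρ ^ 2 * (‖f‖ ^ 2 + ‖g‖ ^ 2)
    calc _ ≤ (ρ * ‖g‖) ^ 2 + (ρ * ‖f‖) ^ 2 := by gcongr
      _ = _ := by ring

end Operator

/-! ### Dominated convergence in `L²` -/

lemma eLpNorm_two_sq {α E : Type*} [MeasurableSpace α] [NormedAddCommGroup E] (μ : Measure α)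
    (f : α → E) : eLpNorm f 2 μ ^ 2 = ∫⁻ x, ‖f x‖ₑ ^ 2 ∂μ := by
  have := eLpNorm_nnreal_pow_eq_lintegral (f := f) (μ := μ) (p := 2) (by norm_num)
  simpa using this

/-- Dominated convergence in `L²`. -/
lemma tendsto_eLpNorm_two_of_dominated {α ι E : Type*} [MeasurableSpace α] [NormedAddCommGroup E]
    {μ : Measure α} {l : Filter ι} [l.IsCountablyGenerated] {F : ι → α → E} {g : α → ℝ}
    (hF : ∀ᶠ n in l, AEStronglyMeasurable (F n) μ) (hg : MemLp g 2 μ)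
    (hle : ∀ᶠ n in l, ∀ᵐ x ∂μ, ‖F n x‖ ≤ g x)
    (hlim : ∀ᵐ x ∂μ, Tendsto (fun n => F n x) l (𝓝 0)) :
    Tendsto (fun n => eLpNorm (F n) 2 μ) l (𝓝 0) := by
  have h1 : Tendsto (fun n => ∫⁻ x, ‖F n x‖ₑ ^ 2 ∂μ) l (𝓝 (∫⁻ _, 0 ∂μ)) := by
    refine tendsto_lintegral_filter_of_dominated_convergence' (fun x => ‖g x‖ₑ ^ 2) ?_ ?_ ?_ ?_
    · filter_upwards [hF] with n hn using hn.enorm.pow_const 2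
    · filter_upwards [hle] with n hn
      filter_upwards [hn] with x hx
      gcongr
      exact enorm_le_iff_norm_le.2 (hx.trans (le_abs_self _))
    · rw [← eLpNorm_two_sq]
      exact (ENNReal.pow_lt_top hg.2).ne
    · filter_upwards [hlim] with x hx
      have := (ENNReal.continuous_pow 2).tendsto 0 |>.comp
        (tendsto_zero_iff_enorm_tendsto_zero.1 hx)
      simpa [Function.comp_def] using this
  simp only [← eLpNorm_two_sq, lintegral_zero] at h1
  have h2 := (ENNReal.continuous_rpow_const (y := (2 : ℝ)⁻¹)).tendsto 0 |>.comp h1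
  have h3 : ∀ a : ℝ≥0∞, (a ^ 2) ^ (2 : ℝ)⁻¹ = a := fun a => by
    rw [← ENNReal.rpow_natCast, ← ENNReal.rpow_mul]
    simp
  simpa [Function.comp_def, h3] using h2

/-! ### The Cauchy integral as an analytic function -/

section CauchyIntegral

variable (m : ℕ)

/-- The Cauchy integral of a function on the line. -/
def cauchyInt {m : ℕ} (f : ℝ → Col m) (z : ℂ) : Col m :=
  (2 * Real.pi * I)⁻¹ • ∫ s : ℝ, ((s : ℂ) - z)⁻¹ • f s

/-- `cauchyInt` carries no proof that `z` is off the line, so that it can be differentiated in `z`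
and restricted to lines, while `cauchyAt` is the bounded functional of the density. -/
lemma cauchyAt_eq_cauchyInt (z : ℂ) (hz : z.im ≠ 0) (f : L2 (Col m)) :
    cauchyAt m z hz f = cauchyInt f z := cauchyAt_apply m z hz f

lemma integrable_kernel_smul {z : ℂ} (hz : z.im ≠ 0) (f : L2 (Col m)) :
    Integrable fun s : ℝ => ((s : ℂ) - z)⁻¹ • f s :=
  memLp_one_iff_integrable.1 ((Lp.memLp f).smul (memLp_kernel z hz))

lemma ofReal_sub_ne_zero {z : ℂ} (hz : z.im ≠ 0) (s : ℝ) : (s : ℂ) - z ≠ 0 := fun h =>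
  hz (by simpa using congrArg im h)

lemma abs_im_le_norm_ofReal_sub (z : ℂ) (s : ℝ) : |z.im| ≤ ‖(s : ℂ) - z‖ := by
  simpa using abs_im_le_norm ((s : ℂ) - z)

lemma norm_inv_ofReal_sub_le {z w : ℂ} (hz : z.im ≠ 0) (hw : ‖w - z‖ ≤ |z.im| / 2) (s : ℝ) :
    ‖((s : ℂ) - w)⁻¹‖ ≤ 2 * ‖((s : ℂ) - z)⁻¹‖ := by
  have h1 := abs_im_le_norm_ofReal_sub z s
  have h2 : 0 < |z.im| := abs_pos.2 hz
  have h3 : ‖(s : ℂ) - z‖ ≤ ‖(s : ℂ) - w‖ + ‖w - z‖ := by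
    simpa using norm_add_le ((s : ℂ) - w) (w - z)
  rw [norm_inv, norm_inv, ← div_eq_mul_inv, inv_eq_one_div, div_le_div_iff₀ (by linarith)
    (by linarith)]
  linarith

lemma differentiableAt_cauchyInt (f : L2 (Col m)) {z : ℂ} (hz : z.im ≠ 0) :
    DifferentiableAt ℂ (cauchyInt f) z := by
  have hpos : 0 < |z.im| := abs_pos.2 hz
  have hne : ∀ w ∈ Metric.ball z (|z.im| / 2), w.im ≠ 0 := by
    intro w hw h0
    rw [mem_ball_iff_norm] at hw
    have h1 := abs_im_le_norm (w - z)
    rw [sub_im, h0, zero_sub, abs_neg] at h1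
    linarith
  have hmeas : ∀ w : ℂ, w.im ≠ 0 → AEStronglyMeasurable
      (fun s : ℝ => ((s : ℂ) - w)⁻¹ • f s) volume :=
    fun w hw => (integrable_kernel_smul m hw f).1
  have h := hasDerivAt_integral_of_dominated_loc_of_deriv_le (μ := volume)
    (F := fun (w : ℂ) (s : ℝ) => ((s : ℂ) - w)⁻¹ • f s)
    (F' := fun (w : ℂ) (s : ℝ) => (((s : ℂ) - w) ^ 2)⁻¹ • f s) (x₀ := z)
    (s := Metric.ball z (|z.im| / 2))
    -- On the disc of radius `|Im z| / 2` the kernel at most doubles, so its square is at most `4 |s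
    -- - z|⁻²`; one of the two factors is then bounded by `|Im z|⁻¹`.
    (bound := fun s : ℝ => 4 * |z.im|⁻¹ * ‖((s : ℂ) - z)⁻¹ • f s‖)
    (Metric.ball_mem_nhds z (by positivity)) ?_ (integrable_kernel_smul m hz f) ?_ ?_ ?_ ?_
  · exact (h.2.differentiableAt).const_smul (2 * Real.pi * I : ℂ)⁻¹
  · filter_upwards [Metric.ball_mem_nhds z (half_pos hpos)] with w hw using hmeas w (hne w hw)
  · refine AEStronglyMeasurable.smul (Measurable.aestronglyMeasurable
      (f := fun s : ℝ => (((s : ℂ) - z) ^ 2)⁻¹) (by fun_prop))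
      (Lp.memLp f).1
  · refine Eventually.of_forall fun s w hw => ?_
    have h1 := norm_inv_ofReal_sub_le hz (mem_ball_iff_norm.1 hw).le s
    have h2 : ‖((s : ℂ) - z)⁻¹‖ ≤ |z.im|⁻¹ := by
      rw [norm_inv]
      exact inv_anti₀ hpos (abs_im_le_norm_ofReal_sub z s)
    rw [norm_smul, norm_smul, inv_pow .. |>.symm, norm_pow, ← mul_assoc]
    gcongr
    calc ‖((s : ℂ) - w)⁻¹‖ ^ 2 ≤ (2 * ‖((s : ℂ) - z)⁻¹‖) ^ 2 := by gcongr
      _ = 4 * ‖((s : ℂ) - z)⁻¹‖ * ‖((s : ℂ) - z)⁻¹‖ := by ring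
      _ ≤ 4 * |z.im|⁻¹ * ‖((s : ℂ) - z)⁻¹‖ := by gcongr
  · exact (integrable_kernel_smul m hz f).norm.const_mul _
  · refine Eventually.of_forall fun s w hw => ?_
    have h0 : (s : ℂ) - w ≠ 0 := ofReal_sub_ne_zero (hne w hw) s
    have h1 := (((hasDerivAt_id w).const_sub (s : ℂ)).fun_inv h0).smul_const (f s)
    simpa using h1

end CauchyIntegral

/-! ### Boundary values of the Cauchy integral -/

section BoundaryValues

variable (m : ℕ)

lemma norm_symbol_le (z : ℂ) (ξ : ℝ) : ‖symbol z ξ‖ ≤ 1 := by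
  unfold symbol
  by_cases h : 0 < z.im * ξ
  · rw [Set.indicator_of_mem (s := {ξ : ℝ | 0 < z.im * ξ}) h, norm_exp]
    have : (2 * Real.pi * I * z * ξ : ℂ).re = -(2 * Real.pi * (z.im * ξ)) := by
      simp [mul_re, mul_im]
      ring
    rw [this, Real.exp_le_one_iff, neg_nonpos]
    positivity
  · rw [Set.indicator_of_notMem (s := {ξ : ℝ | 0 < z.im * ξ}) h]
    simp

lemma memLp_top_symbol (z : ℂ) : MemLp (symbol z) ∞ (volume : Measure ℝ) :=
  memLp_top_of_bound (measurable_symbol z).aestronglyMeasurable 1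
    (Eventually.of_forall (norm_symbol_le z))

/-- The Fourier multiplier with symbol `1_{γξ>0} e^{-2πγξ}`: a Hardy projection followed by a shift
into the half-plane. -/
def dampedProj (γ : ℝ) (f : L2 (Col m)) : L2 (Col m) :=
  (fourierL2 m).symm (mulOp m (memLp_top_symbol (γ * I)).toLp (fourierL2 m f))

lemma im_add_mul_I (x γ : ℝ) : ((x : ℂ) + γ * I).im = γ := by simp

/-- Moving the evaluation point along the line modulates the symbol, so a horizontal slice of the
Cauchy integral is an inverse Fourier integral. Uniform `L²` bounds and convergence at the boundary
thereby become statements about multipliers. -/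
lemma coeFn_dampedProj {γ : ℝ} (hγ : γ ≠ 0) (f : L2 (Col m)) :
    dampedProj m γ f =ᵐ[volume] fun x => side (γ * I) • cauchyInt f (x + γ * I) := by
  have hz : (γ * I : ℂ).im ≠ 0 := by simpa using hγ
  have h1 := coeFn_mulOp m (memLp_top_symbol (γ * I)) (fourierL2 m f)
  have hi : Integrable (mulOp m (memLp_top_symbol (γ * I)).toLp (fourierL2 m f)) :=
    (memLp_one_iff_integrable.1 ((Lp.memLp (fourierL2 m f)).smul (memLp_symbol hz))).congr h1.symm
  refine (coeFn_fourierTransform_symm _ hi).trans (Eventually.of_forall fun x => ?_)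
  have hx : ((x : ℂ) + γ * I).im ≠ 0 := by rwa [im_add_mul_I]
  have hs : side (x + γ * I) = side (γ * I) := by simp [side]
  simp only
  rw [← cauchyAt_eq_cauchyInt m _ hx, cauchyAt_eq_integral_fourier, hs, smul_smul, side_mul_self,
    one_smul]
  refine integral_congr_ae ?_
  filter_upwards [h1] with ξ hξ
  rw [hξ, smul_smul, exp_mul_symbol]

lemma norm_dampedProj_le (γ : ℝ) (f : L2 (Col m)) : ‖dampedProj m γ f‖ ≤ ‖f‖ := by
  rw [dampedProj, LinearIsometryEquiv.norm_map, ← (fourierL2 m).norm_map f]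
  refine Lp.norm_le_norm_of_ae_le ?_
  filter_upwards [coeFn_mulOp m (memLp_top_symbol (γ * I)) (fourierL2 m f)] with ξ h1
  rw [h1, norm_smul]
  exact mul_le_of_le_one_left (norm_nonneg _) (norm_symbol_le _ _)

/-- By Plancherel and dominated convergence: the damped symbol is bounded by one and tends to the
indicator of the half-line. The filter is left general to cover the approach from either side. -/
lemma tendsto_dampedProj {l : Filter ℝ} [l.IsCountablyGenerated] {s : Set ℝ}
    (hs : MeasurableSet s) (hl : Tendsto id l (𝓝 0))
    (h : ∀ᶠ γ in l, {ξ : ℝ | 0 < γ * ξ} = s) (f : L2 (Col m)) :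
    Tendsto (fun γ => dampedProj m γ f) l (𝓝 (fourierCutoff m s hs f)) := by
  refine ((fourierL2 m).symm.continuous.tendsto _).comp ?_
  rw [Lp.tendsto_Lp_iff_tendsto_eLpNorm']
  have key : Tendsto (fun γ : ℝ => eLpNorm
      (fun ξ => (symbol (γ * I) ξ - s.indicator (fun _ => (1 : ℂ)) ξ) • fourierL2 m f ξ) 2 volume)
      l (𝓝 0) := by
    refine tendsto_eLpNorm_two_of_dominated (g := fun ξ => 2 * ‖fourierL2 m f ξ‖)
      (Eventually.of_forall fun γ => ?_) ((Lp.memLp (fourierL2 m f)).norm.const_mul 2)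
      (Eventually.of_forall fun γ => Eventually.of_forall fun ξ => ?_)
      (Eventually.of_forall fun ξ => ?_)
    · exact ((measurable_symbol _).sub (measurable_const.indicator hs)).aestronglyMeasurable.smul
        (Lp.aestronglyMeasurable (fourierL2 m f))
    · rw [norm_smul]
      gcongr
      have h2 : ‖s.indicator (fun _ => (1 : ℂ)) ξ‖ ≤ 1 :=
        (norm_indicator_le_norm_self (fun _ => (1 : ℂ)) ξ).trans (by simp)
      linarith [norm_sub_le (symbol (γ * I) ξ) (s.indicator (fun _ => (1 : ℂ)) ξ),
        norm_symbol_le (γ * I) ξ]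
    · have h3 : Tendsto (fun γ : ℝ => symbol (γ * I) ξ) l
          (𝓝 (s.indicator (fun _ => (1 : ℂ)) ξ)) := by
        -- Along `l` the cutoff is the fixed set `s`, so only the exponential depends on `γ`.
        have h4 : ∀ᶠ γ : ℝ in l, s.indicator
            (fun ξ : ℝ => exp (2 * Real.pi * I * ((γ : ℂ) * I) * ξ)) ξ = symbol (γ * I) ξ := by
          filter_upwards [h] with γ hγ
          rw [symbol, ← hγ]
          simp
        refine Tendsto.congr' h4 ?_
        by_cases hξ : ξ ∈ s
        · simp only [Set.indicator_of_mem hξ]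
          have : Continuous fun γ : ℝ => exp (2 * Real.pi * I * ((γ : ℂ) * I) * ξ) := by fun_prop
          simpa using (this.tendsto 0).comp hl
        · simp only [Set.indicator_of_notMem hξ]
          exact tendsto_const_nhds
      simpa using (h3.sub_const (s.indicator (fun _ => (1 : ℂ)) ξ)).smul_const
        (fourierL2 m f ξ)
  refine key.congr fun γ => eLpNorm_congr_ae ?_
  filter_upwards [coeFn_mulOp m (memLp_top_symbol (γ * I)) (fourierL2 m f),
    coeFn_mulOp m (memLp_indicator s hs) (fourierL2 m f)] with ξ h1 h2
  rw [sub_smul, ← h2, ← h1]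
  rfl

lemma eLpNorm_cauchyInt_le {γ : ℝ} (hγ : γ ≠ 0) (f : L2 (Col m)) :
    eLpNorm (fun x : ℝ => cauchyInt f (x + γ * I)) 2 volume ≤ ‖f‖ₑ := by
  have h1 : eLpNorm (fun x : ℝ => cauchyInt f (x + γ * I)) 2 volume =
      eLpNorm (dampedProj m γ f) 2 volume := by
    refine eLpNorm_congr_norm_ae ?_
    filter_upwards [coeFn_dampedProj m hγ f] with x hx
    have : ‖side (γ * I)‖ = 1 := by
      unfold side
      split_ifs <;> simp
    rw [hx, norm_smul, this, one_mul]
  rw [h1, ← Lp.enorm_def]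
  exact enorm_le_iff_norm_le.2 (norm_dampedProj_le m γ f)

lemma tendsto_cauchyInt_plus (f : L2 (Col m)) :
    Tendsto (fun γ : ℝ => eLpNorm (fun x : ℝ => cauchyInt f (x + γ * I) - cauchyPlus m f x) 2
      volume) (𝓝[>] 0) (𝓝 0) := by
  have h := tendsto_dampedProj m (l := 𝓝[>] 0) measurableSet_Ioi
    (tendsto_id.mono_left nhdsWithin_le_nhds) (by
      filter_upwards [self_mem_nhdsWithin] with γ hγ
      simpa using halfLine_of_pos (z := γ * I) (by simpa using hγ)) f
  rw [Lp.tendsto_Lp_iff_tendsto_eLpNorm'] at h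
  refine h.congr' ?_
  filter_upwards [self_mem_nhdsWithin] with γ hγ
  refine eLpNorm_congr_ae ?_
  filter_upwards [coeFn_dampedProj m (ne_of_gt hγ) f] with x hx
  have : side (γ * I) = 1 := by
    rw [side, if_pos]
    simpa using hγ
  rw [Pi.sub_apply, hx, this, one_smul]
  rfl

lemma tendsto_cauchyInt_minus (f : L2 (Col m)) :
    Tendsto (fun γ : ℝ => eLpNorm (fun x : ℝ => cauchyInt f (x - γ * I) - cauchyMinus m f x) 2
      volume) (𝓝[>] 0) (𝓝 0) := by
  have h := tendsto_dampedProj m (l := 𝓝[<] 0) measurableSet_Iio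
    (tendsto_id.mono_left nhdsWithin_le_nhds) (by
      filter_upwards [self_mem_nhdsWithin] with γ hγ
      simpa using halfLine_of_neg (z := γ * I) (by simpa using hγ)) f
  rw [Lp.tendsto_Lp_iff_tendsto_eLpNorm'] at h
  have hneg : Tendsto (fun γ : ℝ => -γ) (𝓝[>] 0) (𝓝[<] 0) := by
    simpa using tendsto_neg_nhdsGT (a := (0 : ℝ))
  refine (h.comp hneg).congr' ?_
  filter_upwards [self_mem_nhdsWithin] with γ hγ
  have hγ' : (0 : ℝ) < γ := hγ
  refine eLpNorm_congr_norm_ae ?_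
  filter_upwards [coeFn_dampedProj m (neg_ne_zero.2 hγ'.ne') f,
    Lp.coeFn_neg (projMinus m f)] with x hx h2
  -- This sign cancels the one in the definition of `cauchyMinus`.
  have : side (((-γ : ℝ) : ℂ) * I) = -1 := by
    rw [side, if_neg]
    simpa using hγ'.le
  have h3 : cauchyMinus m f = -projMinus m f := rfl
  rw [Pi.sub_apply, hx, this, h3, h2, neg_one_smul, ← norm_neg]
  congr 1
  push_cast
  simp only [Pi.neg_apply, neg_mul, sub_eq_add_neg, neg_add, neg_neg]

end BoundaryValues

/-! ### Shifting horizontal contours -/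

section Contour

/-- A function with finite integral is small far out, on both sides simultaneously. -/
lemma frequently_add_neg_lt {φ : ℝ → ℝ≥0∞} (hφ : ∫⁻ x, φ x ≠ ∞) (hm : Measurable φ) {ε : ℝ≥0∞}
    (hε : ε ≠ 0) : ∃ᶠ X in atTop, φ X + φ (-X) ≤ ε := by
  rw [frequently_atTop]
  intro R
  by_contra! h
  have h1 : ∫⁻ x, φ x + φ (-x) ≠ ∞ := by
    rw [lintegral_add_left hm, lintegral_neg_eq_self φ]
    exact ENNReal.add_ne_top.2 ⟨hφ, hφ⟩
  -- If the sum exceeded `ε` from `R` on, its integral over that half-line would be infinite.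
  refine h1 (top_unique ?_)
  calc ∞ = ∫⁻ _ in Set.Ici R, ε := by simp [ENNReal.mul_top hε]
    _ ≤ ∫⁻ x in Set.Ici R, φ x + φ (-x) :=
      setLIntegral_mono' measurableSet_Ici fun x hx => (h x hx).le
    _ ≤ _ := setLIntegral_le_lintegral _ _

/-- Vanishing of a horizontal contour integral: if `G` is analytic in a half-plane and its `L¹`
norms on the lines above height `γ` are bounded and tend to zero, then its integral over the line at
height `γ` is zero. -/
theorem integral_horizontal_eq_zero {G : ℂ → ℂ} {γ α : ℝ} (hα : α < γ)
    (hG : DifferentiableOn ℂ G {z | α < z.im}) {B : ℝ≥0}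
    (hB : ∀ t, γ ≤ t → ∫⁻ x : ℝ, ‖G (x + t * I)‖ₑ ≤ B)
    (hlim : Tendsto (fun t : ℝ => ∫⁻ x : ℝ, ‖G (x + t * I)‖ₑ) atTop (𝓝 0)) :
    ∫ x : ℝ, G (x + γ * I) = 0 := by
  have hcont : ∀ t, α < t → Continuous fun x : ℝ => G (x + t * I) := fun t ht =>
    hG.continuousOn.comp_continuous (by fun_prop) fun x => by simpa using ht
  have hint : ∀ t, γ ≤ t → Integrable fun x : ℝ => G (x + t * I) := fun t ht =>
    ⟨(hcont t (hα.trans_le ht)).aestronglyMeasurable, (hB t ht).trans_lt ENNReal.coe_lt_top⟩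
  have hshift : ∀ T, γ ≤ T → ∫ x : ℝ, G (x + γ * I) = ∫ x : ℝ, G (x + T * I) := by
    intro T hT
    -- The mass of `G` on the vertical segment above `x`, integrable in `x` by Tonelli. Replacing
    -- `t` by `max t γ` keeps the integrand in the domain of analyticity for all `t`, hence jointly
    -- continuous.
    set φ : ℝ → ℝ≥0∞ := fun x => ∫⁻ t in Set.Ioc γ T, ‖G (x + (max t γ : ℝ) * I)‖ₑ with hφ
    have hH : Continuous fun p : ℝ × ℝ => G (p.1 + (max p.2 γ : ℝ) * I) :=
      hG.continuousOn.comp_continuous (by fun_prop) fun p => by simp [hα]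
    have hHm : Measurable fun p : ℝ × ℝ => ‖G (p.1 + (max p.2 γ : ℝ) * I)‖ₑ :=
      hH.enorm.measurable
    have hφm : Measurable φ := hHm.lintegral_prod_right'
    have hφi : ∫⁻ x, φ x ≠ ∞ := by
      rw [hφ, lintegral_lintegral_swap hHm.aemeasurable]
      refine ne_top_of_le_ne_top (b := ∫⁻ _ in Set.Ioc γ T, (B : ℝ≥0∞)) ?_
        (setLIntegral_mono' measurableSet_Ioc fun t ht => ?_)
      · simp [ENNReal.mul_eq_top]
      · rw [max_eq_left ht.1.le]
        exact hB t ht.1.le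
    have hside : ∀ x : ℝ, ‖∫ t in γ..T, G (x + t * I)‖ₑ ≤ φ x := by
      intro x
      rw [intervalIntegral.integral_of_le hT]
      refine (enorm_integral_le_lintegral_enorm _).trans_eq ?_
      refine setLIntegral_congr_fun measurableSet_Ioc fun t ht => ?_
      simp only [max_eq_left ht.1.le]
    -- Cauchy's theorem on a rectangle: the horizontal sides differ by the vertical ones.
    have hrect : ∀ X : ℝ, 0 ≤ X → ‖(∫ x in (-X)..X, G (x + γ * I)) -
        ∫ x in (-X)..X, G (x + T * I)‖ₑ ≤ φ X + φ (-X) := by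
      intro X hX
      have h := integral_boundary_rect_eq_zero_of_differentiableOn G (⟨-X, γ⟩ : ℂ) (⟨X, T⟩ : ℂ)
        (hG.mono fun z hz => by
          have h1 := hz.2
          simp only [Set.mem_preimage, Set.uIcc_of_le hT] at h1
          exact hα.trans_le h1.1)
      simp only at h
      have h2 : (∫ x in (-X)..X, G (x + γ * I)) - ∫ x in (-X)..X, G (x + T * I) =
          I • (∫ t in γ..T, G ((-X : ℝ) + t * I)) - I • ∫ t in γ..T, G (X + t * I) := by
        linear_combination h
      rw [h2]
      refine (enorm_sub_le).trans ?_
      rw [enorm_smul, enorm_smul, add_comm]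
      have hI : ‖I‖ₑ = 1 := by simp [enorm_eq_nnnorm]
      rw [hI, one_mul, one_mul]
      exact add_le_add (hside X) (hside (-X))
    have hD : Tendsto (fun X : ℝ => ‖(∫ x in (-X)..X, G (x + γ * I)) -
        ∫ x in (-X)..X, G (x + T * I)‖ₑ) atTop
        (𝓝 ‖(∫ x : ℝ, G (x + γ * I)) - ∫ x : ℝ, G (x + T * I)‖ₑ) :=
      ((intervalIntegral_tendsto_integral (hint γ le_rfl) tendsto_neg_atTop_atBot tendsto_id).sub
        (intervalIntegral_tendsto_integral (hint T hT) tendsto_neg_atTop_atBot tendsto_id)).enorm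
    -- The vertical sides are small only for arbitrarily large `X`, not for all; this suffices
    -- because the limit `hD` is known to exist.
    have hz : ∀ ε : ℝ≥0∞, 0 < ε →
        ‖(∫ x : ℝ, G (x + γ * I)) - ∫ x : ℝ, G (x + T * I)‖ₑ ≤ ε := fun ε hε =>
      le_of_tendsto_of_frequently hD (((frequently_add_neg_lt hφi hφm hε.ne').and_eventually
        (eventually_ge_atTop 0)).mono fun X hX => (hrect X hX.2).trans hX.1)
    have := nonpos_iff_eq_zero.1 (le_of_forall_gt_imp_ge_of_dense hz)
    rwa [enorm_eq_zero, sub_eq_zero] at this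
  -- The integral does not depend on the height, and at great height it is small.
  have h0 : Tendsto (fun _ : ℝ => ‖∫ x : ℝ, G (x + γ * I)‖ₑ) atTop (𝓝 0) := by
    refine tendsto_of_tendsto_of_tendsto_of_le_of_le' tendsto_const_nhds hlim
      (Eventually.of_forall fun _ => zero_le) ?_
    filter_upwards [eventually_ge_atTop γ] with T hT
    rw [hshift T hT]
    exact enorm_integral_le_lintegral_enorm _
  simpa using tendsto_nhds_unique tendsto_const_nhds h0

end Contour

/-! ### The Cauchy kernel on a line -/

section Kernel

lemma continuous_kernel {z : ℂ} (hz : z.im ≠ 0) : Continuous fun s : ℝ => ((s : ℂ) - z)⁻¹ :=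
  (continuous_ofReal.sub continuous_const).inv₀ (ofReal_sub_ne_zero hz)

lemma norm_ofReal_sub_sq (z : ℂ) (s : ℝ) : ‖(s : ℂ) - z‖ ^ 2 = (s - z.re) ^ 2 + z.im ^ 2 := by
  rw [← Complex.normSq_eq_norm_sq, Complex.normSq_apply]
  simp
  ring

/-- An arctangent integral after translation and scaling. The exact value shows that the `L²` norm
decreases with the distance of the pole from the line, and how fast. -/
lemma lintegral_kernel_sq {z : ℂ} (hz : z.im ≠ 0) :
    ∫⁻ s : ℝ, ‖((s : ℂ) - z)⁻¹‖ₑ ^ 2 = ENNReal.ofReal (Real.pi / |z.im|) := by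
  have h0 : ∀ s : ℝ, ‖((s : ℂ) - z)⁻¹‖ ^ 2 =
      (z.im ^ 2)⁻¹ * (1 + ((s - z.re) / z.im) ^ 2)⁻¹ := by
    intro s
    rw [norm_inv, inv_pow, norm_ofReal_sub_sq, ← mul_inv]
    congr 1
    field_simp
    ring
  have h1 : ∀ s : ℝ, ‖((s : ℂ) - z)⁻¹‖ₑ ^ 2 =
      ENNReal.ofReal ((z.im ^ 2)⁻¹ * (1 + ((s - z.re) / z.im) ^ 2)⁻¹) := by
    intro s
    rw [← h0, ENNReal.ofReal_pow (norm_nonneg _), ofReal_norm]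
  simp_rw [h1]
  have hi : Integrable fun s : ℝ => (z.im ^ 2)⁻¹ * (1 + ((s - z.re) / z.im) ^ 2)⁻¹ :=
    ((integrable_inv_one_add_sq.comp_div hz).comp_sub_right z.re).const_mul _
  rw [← ofReal_integral_eq_lintegral_ofReal hi (Eventually.of_forall fun s => by positivity),
    integral_const_mul]
  congr 1
  rw [integral_sub_right_eq_self (fun s : ℝ => (1 + (s / z.im) ^ 2)⁻¹),
    Measure.integral_comp_div (fun s : ℝ => (1 + s ^ 2)⁻¹), integral_univ_inv_one_add_sq,
    ← sq_abs, smul_eq_mul]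
  have := abs_pos.2 hz
  field_simp

lemma eLpNorm_kernel_sq {z : ℂ} (hz : z.im ≠ 0) :
    eLpNorm (fun s : ℝ => ((s : ℂ) - z)⁻¹) 2 volume ^ 2 = ENNReal.ofReal (Real.pi / |z.im|) := by
  rw [eLpNorm_two_sq, lintegral_kernel_sq hz]

/-- Away from a pole, a simple fraction on a horizontal line is dominated by a fixed square
integrable function. -/
lemma norm_inv_sub_le_kernel {z p : ℂ} {δ : ℝ} (hδ : 0 < δ) (h : δ ≤ ‖z - p‖) :
    ‖(z - p)⁻¹‖ ≤ 2 * ‖((z.re : ℂ) - (p.re + δ * I))⁻¹‖ := by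
  have h1 : ‖(z.re : ℂ) - (p.re + δ * I)‖ ≤ 2 * ‖z - p‖ := by
    calc ‖(z.re : ℂ) - (p.re + δ * I)‖ = ‖(((z - p).re : ℝ) : ℂ) - δ * I‖ := by
          congr 1
          push_cast [sub_re]
          ring
      _ ≤ |(z - p).re| + δ := by
          refine (norm_sub_le _ _).trans ?_
          rw [norm_real, norm_mul, norm_I, mul_one, norm_real, Real.norm_of_nonneg hδ.le,
            Real.norm_eq_abs]
      _ ≤ 2 * ‖z - p‖ := by linarith [abs_re_le_norm (z - p)]
  have h2 : 0 < ‖(z.re : ℂ) - (p.re + δ * I)‖ := by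
    refine norm_pos_iff.2 fun h0 => hδ.ne' ?_
    simpa using congrArg im h0
  have h3 : 0 < ‖z - p‖ := hδ.trans_le h
  rw [norm_inv, norm_inv, ← div_eq_mul_inv, inv_eq_one_div, div_le_div_iff₀ h3 h2]
  linarith

lemma lintegral_enorm_mul_le {f g : ℝ → ℂ} (hf : AEStronglyMeasurable f volume)
    (hg : AEStronglyMeasurable g volume) :
    ∫⁻ x, ‖f x * g x‖ₑ ≤ eLpNorm f 2 volume * eLpNorm g 2 volume := by
  have := eLpNorm_smul_le_mul_eLpNorm (p := 2) (q := 2) (r := 1) hg hf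
  rwa [eLpNorm_one_eq_lintegral_enorm] at this

/-- The Fourier computation `cauchyAt_poleFun` for height one, read as a scalar identity, takes the
place of the residue theorem. -/
lemma integral_kernel_mul_kernel {z w : ℂ} (hz : 0 < z.im) (hw : w.im < 0) :
    ∫ s : ℝ, ((s : ℂ) - z)⁻¹ * ((s : ℂ) - w)⁻¹ = 2 * Real.pi * I * (z - w)⁻¹ := by
  have h := cauchyAt_poleFun 1 hz.ne' hw.ne (mul_neg_of_pos_of_neg hz hw)
    (EuclideanSpace.single 0 1)
  have hside : side z = 1 := if_pos hz
  have h1 : ∀ᵐ s : ℝ, ((s : ℂ) - z)⁻¹ • poleFun 1 w hw.ne (EuclideanSpace.single 0 1) s =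
      (((s : ℂ) - z)⁻¹ * ((s : ℂ) - w)⁻¹) • (EuclideanSpace.single 0 1 : Col 1) := by
    filter_upwards [coeFn_poleFun 1 w hw.ne (EuclideanSpace.single 0 1)] with s hs
    rw [hs, smul_smul]
  rw [cauchyAt_apply, integral_congr_ae h1, integral_smul_const, hside, one_mul, smul_smul] at h
  have h2 := congrArg (fun v : Col 1 => v 0) h
  simp only [PiLp.smul_apply, PiLp.single_apply, if_true, smul_eq_mul, mul_one] at h2
  rw [← h2, mul_inv_cancel_left₀]
  simp [Real.pi_ne_zero]

end Kernel

/-! ### Cauchy's formula for Hardy functions -/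

section Hardy

lemma exists_coe_eq {x : ℝ≥0∞} (h : x ≠ ∞) : ∃ B : ℝ≥0, (B : ℝ≥0∞) = x :=
  ⟨x.toNNReal, ENNReal.coe_toNNReal h⟩

variable {F : ℂ → ℂ} {C : ℝ≥0}

lemma continuous_line (hF : DifferentiableOn ℂ F {z | 0 < z.im}) {t : ℝ} (ht : 0 < t) :
    Continuous fun x : ℝ => F (x + t * I) :=
  hF.continuousOn.comp_continuous (by fun_prop) fun x => by simpa using ht

lemma tendsto_eLpNorm_kernel_atTop (b : ℂ) :
    Tendsto (fun t : ℝ => eLpNorm (fun s : ℝ => ((s : ℂ) - (b - t * I))⁻¹) 2 volume) atTop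
      (𝓝 0) := by
  have h1 : Tendsto (fun t : ℝ => ENNReal.ofReal (Real.pi / |(b - t * I).im|)) atTop (𝓝 0) := by
    rw [← ENNReal.ofReal_zero]
    refine ENNReal.tendsto_ofReal (Tendsto.const_div_atTop ?_ _)
    refine tendsto_abs_atBot_atTop.comp ?_
    have : (fun t : ℝ => (b - t * I).im) = fun t : ℝ => b.im + -t := by
      ext t
      simp [sub_eq_add_neg]
    rw [this]
    exact tendsto_atBot_add_const_left _ _ tendsto_neg_atTop_atBot
  have h2 : Tendsto (fun t : ℝ => eLpNorm (fun s : ℝ => ((s : ℂ) - (b - t * I))⁻¹) 2 volume ^ 2)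
      atTop (𝓝 0) := by
    refine h1.congr' ?_
    filter_upwards [eventually_gt_atTop b.im] with t ht
    rw [eLpNorm_kernel_sq]
    simp only [sub_im, mul_im, ofReal_re, I_im, mul_one, ofReal_im, I_re, mul_zero, add_zero]
    linarith
  have h3 := (ENNReal.continuous_rpow_const (y := (2 : ℝ)⁻¹)).tendsto 0 |>.comp h2
  have h4 : ∀ a : ℝ≥0∞, (a ^ 2) ^ (2 : ℝ)⁻¹ = a := fun a => by
    rw [← ENNReal.rpow_natCast, ← ENNReal.rpow_mul]
    simp
  simpa [Function.comp_def, h4] using h3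

lemma lintegral_line_mul_kernel_le (hF : DifferentiableOn ℂ F {z | 0 < z.im})
    (hC : ∀ t : ℝ, 0 < t → eLpNorm (fun x : ℝ => F (x + t * I)) 2 volume ≤ C) {t : ℝ} (ht : 0 < t)
    {w : ℂ} (hw : w.im ≠ 0) :
    ∫⁻ x : ℝ, ‖F (x + t * I) * ((x : ℂ) - w)⁻¹‖ₑ ≤
      C * eLpNorm (fun s : ℝ => ((s : ℂ) - w)⁻¹) 2 volume := by
  refine (lintegral_enorm_mul_le (continuous_line hF ht).aestronglyMeasurable
    (continuous_kernel hw).aestronglyMeasurable).trans ?_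
  gcongr
  exact hC t ht

/-- Cauchy–Schwarz: the norm of `F` on lines is bounded, and that of the kernel at height `t` decays
like `t^{-1/2}`. This is the decay needed in `integral_horizontal_eq_zero`. -/
lemma tendsto_lintegral_line_mul_kernel (hF : DifferentiableOn ℂ F {z | 0 < z.im})
    (hC : ∀ t : ℝ, 0 < t → eLpNorm (fun x : ℝ => F (x + t * I)) 2 volume ≤ C) (b : ℂ) :
    Tendsto (fun t : ℝ => ∫⁻ x : ℝ, ‖F (x + t * I) * (x + t * I - b)⁻¹‖ₑ) atTop (𝓝 0) := by
  have h : Tendsto (fun t : ℝ => (C : ℝ≥0∞) *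
      eLpNorm (fun s : ℝ => ((s : ℂ) - (b - t * I))⁻¹) 2 volume) atTop (𝓝 0) := by
    simpa using ENNReal.Tendsto.const_mul (tendsto_eLpNorm_kernel_atTop b)
      (Or.inr (ENNReal.coe_ne_top (r := C)))
  refine tendsto_of_tendsto_of_tendsto_of_le_of_le' tendsto_const_nhds h
    (Eventually.of_forall fun _ => zero_le) ?_
  filter_upwards [eventually_gt_atTop b.im, eventually_gt_atTop 0] with t ht ht0
  have h1 := lintegral_line_mul_kernel_le hF hC ht0 (w := b - t * I) (by
    simp only [sub_im, mul_im, ofReal_re, I_im, mul_one, ofReal_im, I_re, mul_zero, add_zero]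
    linarith)
  refine le_trans (le_of_eq ?_) h1
  congr 1
  ext x
  congr 3
  ring

lemma eLpNorm_kernel_anti {z w : ℂ} (hz : z.im ≠ 0) (h : |z.im| ≤ |w.im|) :
    eLpNorm (fun s : ℝ => ((s : ℂ) - w)⁻¹) 2 volume ≤
      eLpNorm (fun s : ℝ => ((s : ℂ) - z)⁻¹) 2 volume := by
  have hz' := abs_pos.2 hz
  have hw : w.im ≠ 0 := abs_pos.1 (hz'.trans_le h)
  refine (ENNReal.pow_le_pow_left_iff two_ne_zero).1 ?_
  rw [eLpNorm_kernel_sq hz, eLpNorm_kernel_sq hw]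
  gcongr

/-- For a Hardy function of the upper half-plane, the Cauchy integral over a line vanishes below
the line. -/
theorem integral_line_mul_kernel_eq_zero (hF : DifferentiableOn ℂ F {z | 0 < z.im})
    (hC : ∀ t : ℝ, 0 < t → eLpNorm (fun x : ℝ => F (x + t * I)) 2 volume ≤ C) {γ : ℝ} (hγ : 0 < γ)
    {b : ℂ} (hb : b.im < γ) : ∫ x : ℝ, F (x + γ * I) * (x + γ * I - b)⁻¹ = 0 := by
  have him : ∀ t : ℝ, (b - t * I).im = b.im - t := fun t => by simp
  obtain ⟨B, hB⟩ : ∃ B : ℝ≥0, (B : ℝ≥0∞) =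
      C * eLpNorm (fun s : ℝ => ((s : ℂ) - (b - γ * I))⁻¹) 2 volume := by
    refine exists_coe_eq (ENNReal.mul_ne_top ENNReal.coe_ne_top ?_)
    exact (memLp_kernel _ (by rw [him]; linarith)).2.ne
  refine integral_horizontal_eq_zero (G := fun z => F z * (z - b)⁻¹) (max_lt hγ hb) ?_ (B := B) ?_
    (tendsto_lintegral_line_mul_kernel hF hC b)
  · intro z hz
    have hz' : 0 < z.im ∧ b.im < z.im := max_lt_iff.1 hz
    refine DifferentiableWithinAt.mul
      ((hF z hz'.1).mono fun w (hw : max 0 b.im < w.im) => (max_lt_iff.1 hw).1)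
      (DifferentiableAt.differentiableWithinAt (DifferentiableAt.inv (by fun_prop) ?_))
    exact fun h0 => hz'.2.ne' (by rw [sub_eq_zero.1 h0])
  · intro t ht
    rw [hB]
    calc ∫⁻ x : ℝ, ‖F (x + t * I) * (x + t * I - b)⁻¹‖ₑ
        = ∫⁻ x : ℝ, ‖F (x + t * I) * ((x : ℂ) - (b - t * I))⁻¹‖ₑ := by
          congr 1
          ext x
          congr 3
          ring
      _ ≤ C * eLpNorm (fun s : ℝ => ((s : ℂ) - (b - t * I))⁻¹) 2 volume :=
          lintegral_line_mul_kernel_le hF hC (hγ.trans_le ht) (by rw [him]; linarith)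
      _ ≤ _ := by
          gcongr
          refine eLpNorm_kernel_anti (by rw [him]; linarith) ?_
          rw [him, him, abs_of_neg (by linarith), abs_of_neg (by linarith)]
          linarith

/-- Cauchy's formula for the quotient of a Hardy function by `z - z₀`, where the function
vanishes at `z₀`. -/
lemma integral_line_dslope_eq_zero (hF : DifferentiableOn ℂ F {z | 0 < z.im})
    (hC : ∀ t : ℝ, 0 < t → eLpNorm (fun x : ℝ => F (x + t * I)) 2 volume ≤ C) {γ : ℝ} (hγ : 0 < γ)
    {z₀ : ℂ} (hz₀ : γ < z₀.im) (h0 : F z₀ = 0) :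
    ∫ x : ℝ, F (x + γ * I) * (x + γ * I - z₀)⁻¹ = 0 := by
  have hopen : IsOpen {z : ℂ | 0 < z.im} := isOpen_lt continuous_const continuous_im
  have hz₀' : 0 < z₀.im := hγ.trans hz₀
  -- The quotient `F z / (z - z₀)` with its removable singularity filled in, so that the contour may
  -- be moved past `z₀`.
  set G := dslope F z₀ with hGdef
  have hG : DifferentiableOn ℂ G {z | 0 < z.im} :=
    (differentiableOn_dslope (hopen.mem_nhds hz₀')).2 hF
  have hGne : ∀ z, z ≠ z₀ → G z = F z * (z - z₀)⁻¹ := by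
    intro z hz
    rw [hGdef, dslope_of_ne _ hz, slope_def_field, h0, sub_zero, div_eq_mul_inv]
  have hGline : ∀ t : ℝ, t ≠ z₀.im → ∀ x : ℝ,
      G (x + t * I) = F (x + t * I) * (x + t * I - z₀)⁻¹ := by
    intro t ht x
    refine hGne _ fun h => ht ?_
    simpa using congrArg im h
  have key : ∫ x : ℝ, G (x + γ * I) = 0 := by
    set δ := z₀.im / 2 with hδ
    have hδ0 : 0 < δ := by positivity
    obtain ⟨B₀, hB₀⟩ := (isCompact_closedBall z₀ δ).exists_bound_of_continuousOn
      (hG.continuousOn.mono fun z hz => by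
        have h1 := (abs_im_le_norm (z - z₀)).trans (mem_closedBall_iff_norm.1 hz)
        rw [sub_im, abs_le] at h1
        simp only [Set.mem_ofPred_eq]
        linarith [h1.1])
    set w : ℂ := z₀.re + δ * I with hw
    have hwim : w.im ≠ 0 := by simpa [hw] using hδ0.ne'
    -- Within `δ = Im z₀ / 2` of `z₀` the quotient is bounded by compactness; farther away `(z -
    -- z₀)⁻¹` is dominated by a kernel independent of the height `t`.
    have hbound : ∀ t : ℝ, 0 < t → ∀ x : ℝ, ‖G (x + t * I)‖ₑ ≤
        (Set.Icc (z₀.re - δ) (z₀.re + δ)).indicator (fun _ => ‖B₀‖ₑ) x +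
          2 * ‖F (x + t * I) * ((x : ℂ) - w)⁻¹‖ₑ := by
      intro t ht x
      by_cases hx : ‖(x + t * I : ℂ) - z₀‖ ≤ δ
      · have h1 : x ∈ Set.Icc (z₀.re - δ) (z₀.re + δ) := by
          have h2 := (abs_re_le_norm ((x + t * I : ℂ) - z₀)).trans hx
          simp only [sub_re, add_re, ofReal_re, mul_re, I_re, mul_zero, ofReal_im, I_im, zero_mul,
            sub_zero, add_zero, abs_le] at h2
          constructor <;> linarith [h2.1, h2.2]
        rw [Set.indicator_of_mem h1]
        refine le_add_right (enorm_le_iff_norm_le.2 ?_)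
        exact (hB₀ _ (mem_closedBall_iff_norm.2 hx)).trans (le_abs_self _)
      · push Not at hx
        refine le_add_left ?_
        rw [hGne _ (fun h => by rw [h, sub_self, norm_zero] at hx; linarith), enorm_mul, enorm_mul,
          mul_left_comm]
        gcongr
        have h3 := norm_inv_sub_le_kernel hδ0 hx.le
        have h4 : (2 : ℝ≥0∞) = ‖(2 : ℝ)‖ₑ := by simp [enorm_eq_nnnorm]
        have h5 : (x + t * I : ℂ).re = x := by simp
        rw [h5] at h3
        rw [h4, ← enorm_norm ((x : ℂ) - w)⁻¹, ← enorm_mul]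
        exact enorm_le_iff_norm_le.2 (h3.trans (le_abs_self _))
    obtain ⟨B, hB⟩ : ∃ B : ℝ≥0, (B : ℝ≥0∞) = ‖B₀‖ₑ * ENNReal.ofReal (2 * δ) +
        2 * (C * eLpNorm (fun s : ℝ => ((s : ℂ) - w)⁻¹) 2 volume) := by
      refine exists_coe_eq (ENNReal.add_ne_top.2
        ⟨ENNReal.mul_ne_top enorm_ne_top ENNReal.ofReal_ne_top, ENNReal.mul_ne_top (by simp)
          (ENNReal.mul_ne_top ENNReal.coe_ne_top (memLp_kernel _ hwim).2.ne)⟩)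
    refine integral_horizontal_eq_zero hγ hG (B := B) (fun t ht => ?_) ?_
    · have ht0 := hγ.trans_le ht
      calc ∫⁻ x : ℝ, ‖G (x + t * I)‖ₑ ≤ _ := lintegral_mono (hbound t ht0)
        _ = _ := lintegral_add_left (measurable_const.indicator measurableSet_Icc) _
        _ ≤ B := by
          rw [hB, lintegral_indicator_const measurableSet_Icc, Real.volume_Icc,
            lintegral_const_mul' _ _ (by simp)]
          gcongr
          · linarith
          · exact lintegral_line_mul_kernel_le hF hC ht0 hwim
    · refine (tendsto_lintegral_line_mul_kernel hF hC z₀).congr' ?_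
      filter_upwards [eventually_ne_atTop z₀.im] with t ht
      simp_rw [hGline t ht]
  simp_rw [hGline γ hz₀.ne] at key
  exact key

/-- Cauchy's formula over a horizontal line for a Hardy function of the upper half-plane. -/
theorem integral_line_mul_kernel (hF : DifferentiableOn ℂ F {z | 0 < z.im})
    (hC : ∀ t : ℝ, 0 < t → eLpNorm (fun x : ℝ => F (x + t * I)) 2 volume ≤ C) {γ : ℝ} (hγ : 0 < γ)
    {z₀ : ℂ} (hz₀ : γ < z₀.im) :
    ∫ x : ℝ, F (x + γ * I) * (x + γ * I - z₀)⁻¹ = 2 * Real.pi * I * F z₀ := by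
  have hne : ∀ z : ℂ, 0 < z.im → z + I ≠ 0 := fun z hz h => by
    have := congrArg im h
    simp at this
    linarith
  -- Chosen so that `a (z + I)⁻¹` takes the value `F z₀` at `z₀`. This fraction is itself a Hardy
  -- function of the upper half-plane, and its Cauchy integral is explicit.
  set a : ℂ := F z₀ * (z₀ + I) with ha
  set F₁ : ℂ → ℂ := fun z => F z - a * (z + I)⁻¹ with hF₁
  have hF₁d : DifferentiableOn ℂ F₁ {z | 0 < z.im} := by
    intro z hz
    refine (hF z hz).sub (DifferentiableAt.differentiableWithinAt ?_)
    exact ((differentiableAt_id.add_const I).fun_inv (hne z hz)).const_mul _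
  have hFm : ∀ t : ℝ, 0 < t → AEStronglyMeasurable (fun x : ℝ => F (x + t * I)) volume :=
    fun t ht => (continuous_line hF ht).aestronglyMeasurable
  have hpole : ∀ t x : ℝ, ((x : ℂ) + t * I + I) = x - (-I - t * I) := fun t x => by ring
  have him : ∀ t : ℝ, (-I - t * I).im = -1 - t := fun t => by simp
  obtain ⟨C₁, hC₁⟩ : ∃ C₁ : ℝ≥0, (C₁ : ℝ≥0∞) = C +
      ‖a‖ₑ * eLpNorm (fun s : ℝ => ((s : ℂ) - (-I))⁻¹) 2 volume :=
    exists_coe_eq (ENNReal.add_ne_top.2 ⟨ENNReal.coe_ne_top,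
      ENNReal.mul_ne_top enorm_ne_top (memLp_kernel _ (by simp)).2.ne⟩)
  have hF₁C : ∀ t : ℝ, 0 < t → eLpNorm (fun x : ℝ => F₁ (x + t * I)) 2 volume ≤ C₁ := by
    intro t ht
    have hk : (-I - t * I).im ≠ 0 := by rw [him]; linarith
    have h1 : (fun x : ℝ => F₁ (x + t * I)) = (fun x : ℝ => F (x + t * I)) -
        a • fun x : ℝ => ((x : ℂ) - (-I - t * I))⁻¹ := by
      ext x
      simp [hF₁, hpole]
    rw [h1, hC₁]
    refine (eLpNorm_sub_le (hFm t ht)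
      ((continuous_kernel hk).aestronglyMeasurable.const_smul a) (by norm_num)).trans ?_
    rw [eLpNorm_const_smul]
    gcongr
    · exact hC t ht
    · refine eLpNorm_kernel_anti (by simp) ?_
      rw [him, abs_of_neg (a := -1 - t) (by linarith), neg_im, I_im, abs_neg, abs_one]
      linarith
  have h0 : F₁ z₀ = 0 := by
    simp only [hF₁, ha]
    rw [mul_assoc, mul_inv_cancel₀ (hne z₀ (hγ.trans hz₀)), mul_one, sub_self]
  have h1 := integral_line_dslope_eq_zero hF₁d hF₁C hγ hz₀ h0
  have hz : 0 < (z₀ - γ * I).im := by simpa using hz₀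
  have hw : (-I - γ * I).im < 0 := by rw [him]; linarith
  have h2 := integral_kernel_mul_kernel hz hw
  have h3 : ∀ x : ℝ, F₁ (x + γ * I) * (x + γ * I - z₀)⁻¹ = F (x + γ * I) * (x + γ * I - z₀)⁻¹ -
      a * (((x : ℂ) - (z₀ - γ * I))⁻¹ * ((x : ℂ) - (-I - γ * I))⁻¹) := by
    intro x
    have : ((x : ℂ) + γ * I - z₀) = x - (z₀ - γ * I) := by ring
    simp only [hF₁, hpole, this]
    ring
  have hi1 : Integrable fun x : ℝ => F (x + γ * I) * (x + γ * I - z₀)⁻¹ := by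
    have : ∀ x : ℝ, ((x : ℂ) + γ * I - z₀) = x - (z₀ - γ * I) := fun x => by ring
    simp_rw [this]
    refine ⟨(hFm γ hγ).mul (continuous_kernel hz.ne').aestronglyMeasurable, ?_⟩
    exact (lintegral_line_mul_kernel_le hF hC hγ hz.ne').trans_lt
      (ENNReal.mul_lt_top ENNReal.coe_lt_top (memLp_kernel _ hz.ne').2)
  have hi2 : Integrable fun x : ℝ => ((x : ℂ) - (z₀ - γ * I))⁻¹ * ((x : ℂ) - (-I - γ * I))⁻¹ :=
    (memLp_kernel _ hz.ne').integrable_mul (memLp_kernel _ hw.ne)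
  simp_rw [h3] at h1
  rw [integral_sub hi1 (hi2.const_mul a), integral_const_mul, h2, sub_eq_zero] at h1
  rw [h1, ha]
  have : z₀ - γ * I - (-I - γ * I) = z₀ + I := by ring
  rw [this]
  have h4 := hne z₀ (hγ.trans hz₀)
  field_simp

/-- The Cauchy kernel integrates continuously against `L²` boundary values. -/
lemma tendsto_integral_mul_kernel {f : ℝ → ℝ → ℂ} {g : ℝ → ℂ} (hg : MemLp g 2 volume)
    (hf : ∀ᶠ γ in 𝓝[>] 0, AEStronglyMeasurable (f γ) volume)
    (h : Tendsto (fun γ : ℝ => eLpNorm (fun x => f γ x - g x) 2 volume) (𝓝[>] 0) (𝓝 0)) {z : ℂ}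
    (hz : z.im ≠ 0) :
    Tendsto (fun γ : ℝ => ∫ x : ℝ, f γ x * ((x : ℂ) - z)⁻¹) (𝓝[>] 0)
      (𝓝 (∫ x : ℝ, g x * ((x : ℂ) - z)⁻¹)) := by
  have hk := memLp_kernel z hz
  have h0 : Tendsto (fun γ : ℝ => eLpNorm (fun x => f γ x - g x) 2 volume *
      eLpNorm (fun s : ℝ => ((s : ℂ) - z)⁻¹) 2 volume) (𝓝[>] 0) (𝓝 0) := by
    simpa using ENNReal.Tendsto.mul_const h (Or.inr hk.2.ne)
  rw [tendsto_iff_edist_tendsto_0]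
  refine tendsto_of_tendsto_of_tendsto_of_le_of_le' tendsto_const_nhds h0
    (Eventually.of_forall fun _ => zero_le) ?_
  filter_upwards [hf, h.eventually_lt_const (u := 1) one_pos] with γ hγ hγ1
  have hd : MemLp (fun x => f γ x - g x) 2 volume := ⟨hγ.sub hg.1, hγ1.trans ENNReal.one_lt_top⟩
  have hfm : MemLp (f γ) 2 volume := by
    have := hd.add hg
    simpa [Pi.add_def] using! this
  have hi1 : Integrable fun x : ℝ => f γ x * ((x : ℂ) - z)⁻¹ := hfm.integrable_mul hk
  have hi2 : Integrable fun x : ℝ => g x * ((x : ℂ) - z)⁻¹ := hg.integrable_mul hk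
  rw [edist_eq_enorm_sub, ← integral_sub hi1 hi2]
  refine (enorm_integral_le_lintegral_enorm _).trans ?_
  simp_rw [← sub_mul]
  exact lintegral_enorm_mul_le hd.1 hk.1

/-- A Hardy function of the upper half-plane is the Cauchy integral of its boundary values, and that
Cauchy integral vanishes in the lower half-plane. -/
theorem cauchy_formula_upper (hF : DifferentiableOn ℂ F {z | 0 < z.im})
    (hC : ∀ t : ℝ, 0 < t → eLpNorm (fun x : ℝ => F (x + t * I)) 2 volume ≤ C) {g : ℝ → ℂ}
    (hg : MemLp g 2 volume)
    (h : Tendsto (fun γ : ℝ => eLpNorm (fun x : ℝ => F (x + γ * I) - g x) 2 volume) (𝓝[>] 0) (𝓝 0))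
    {z : ℂ} (hz : z.im ≠ 0) :
    ∫ x : ℝ, g x * ((x : ℂ) - z)⁻¹ = if 0 < z.im then 2 * Real.pi * I * F z else 0 := by
  have hlim := tendsto_integral_mul_kernel hg (f := fun γ x => F (x + γ * I)) (by
    filter_upwards [self_mem_nhdsWithin] with γ hγ
    exact (continuous_line hF hγ).aestronglyMeasurable) h hz
  -- Seen from the line at height `γ`, the kernel has its pole at `z + iγ`: above that line if `z`
  -- is in the upper half-plane, below it otherwise.
  have hxz : ∀ γ x : ℝ, ((x : ℂ) - z) = x + γ * I - (z + γ * I) := fun γ x => by ring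
  have him : ∀ γ : ℝ, (z + γ * I).im = z.im + γ := fun γ => by simp
  refine tendsto_nhds_unique hlim ?_
  split_ifs with h0
  · have hcont : Tendsto (fun γ : ℝ => 2 * Real.pi * I * F (z + γ * I)) (𝓝[>] 0)
        (𝓝 (2 * Real.pi * I * F z)) := by
      have hopen : IsOpen {z : ℂ | 0 < z.im} := isOpen_lt continuous_const continuous_im
      have h1 : ContinuousAt F z := (hF.differentiableAt (hopen.mem_nhds h0)).continuousAt
      have h2 : Tendsto (fun γ : ℝ => z + γ * I) (𝓝[>] 0) (𝓝 z) := by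
        have : Continuous fun γ : ℝ => z + γ * I := by fun_prop
        simpa using (this.tendsto 0).mono_left nhdsWithin_le_nhds
      exact (h1.tendsto.comp h2).const_mul _
    refine hcont.congr' ?_
    filter_upwards [self_mem_nhdsWithin] with γ hγ
    simp_rw [hxz γ]
    rw [integral_line_mul_kernel hF hC hγ (by rw [him]; linarith)]
  · refine tendsto_const_nhds.congr' ?_
    filter_upwards [self_mem_nhdsWithin] with γ hγ
    simp_rw [hxz γ]
    rw [integral_line_mul_kernel_eq_zero hF hC hγ]
    rw [him]
    have : z.im < 0 := lt_of_le_of_ne (not_lt.1 h0) hz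
    linarith

/-- A Hardy function of the lower half-plane is minus the Cauchy integral of its boundary values,
and that Cauchy integral vanishes in the upper half-plane. -/
theorem cauchy_formula_lower (hF : DifferentiableOn ℂ F {z | z.im < 0})
    (hC : ∀ t : ℝ, 0 < t → eLpNorm (fun x : ℝ => F (x - t * I)) 2 volume ≤ C) {g : ℝ → ℂ}
    (hg : MemLp g 2 volume)
    (h : Tendsto (fun γ : ℝ => eLpNorm (fun x : ℝ => F (x - γ * I) - g x) 2 volume) (𝓝[>] 0) (𝓝 0))
    {z : ℂ} (hz : z.im ≠ 0) :
    ∫ x : ℝ, g x * ((x : ℂ) - z)⁻¹ = if z.im < 0 then -(2 * Real.pi * I * F z) else 0 := by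
  have hneg : MeasurePreserving (fun x : ℝ => -x) volume volume := Measure.measurePreserving_neg _
  have hemb : MeasurableEmbedding (fun x : ℝ => -x) := (Homeomorph.neg ℝ).measurableEmbedding
  have hE : ∀ u : ℝ → ℂ, eLpNorm (fun x => u (-x)) 2 volume = eLpNorm u 2 volume := fun u => by
    have := hemb.eLpNorm_map_measure (g := u) (p := 2) (μ := volume)
    rw [hneg.map_eq] at this
    exact this.symm
  have hxt : ∀ x t : ℝ, -((x : ℂ) + t * I) = ((-x : ℝ) : ℂ) - t * I := fun x t => by
    push_cast
    ring
  -- The reflection `w ↦ -w` exchanges the half-planes and preserves Lebesgue measure on the line.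
  have key := cauchy_formula_upper (F := fun w => F (-w)) (C := C) (g := fun x => g (-x))
    (fun w hw => by
      refine (hF (-w) (by simpa using hw)).comp w (by fun_prop) fun v hv => ?_
      simpa using hv)
    (fun t ht => by
      simp_rw [hxt]
      rw [hE fun x => F (x - t * I)]
      exact hC t ht)
    (hg.comp_measurePreserving hneg)
    (by
      simp_rw [hxt]
      refine h.congr fun γ => ?_
      rw [← hE fun x => F (x - γ * I) - g x])
    (z := -z) (by simpa using hz)
  have h1 : ∫ x : ℝ, g (-x) * ((x : ℂ) - -z)⁻¹ = -∫ x : ℝ, g x * ((x : ℂ) - z)⁻¹ := by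
    rw [← integral_neg_eq_self, ← integral_neg]
    congr 1
    ext x
    rw [neg_neg, ← mul_neg, ← inv_neg]
    congr 2
    push_cast
    ring
  rw [h1] at key
  simp only [neg_im, neg_neg, neg_pos] at key
  rw [← neg_inj, key]
  split_ifs <;> simp

end Hardy

/-! ### Vector functions with a jump and simple poles -/

section Column

variable {m N : ℕ}

/-- A vector function with constant `e` at infinity, jump `g` on the real line, and simple poles
at the points `p j` with residues `u j`. -/
def colFun (e : Col m) (g : ℝ → Col m) (p : Fin N → ℂ) (u : Fin N → Col m) (z : ℂ) : Col m :=
  e + cauchyInt g z + ∑ j, (z - p j)⁻¹ • u j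

variable (e : Col m) (g : L2 (Col m)) {p : Fin N → ℂ} (u : Fin N → Col m)

lemma tendsto_sub_smul_nhdsNE {E : Type*} [NormedAddCommGroup E] [NormedSpace ℂ E] {f : ℂ → E}
    {p : ℂ} (hf : ContinuousAt f p) : Tendsto (fun z => (z - p) • f z) (𝓝[≠] p) (𝓝 0) := by
  have h3 : ContinuousAt (fun z : ℂ => z - p) p := by fun_prop
  have h4 := h3.tendsto.smul hf.tendsto
  rw [sub_self, zero_smul] at h4
  exact h4.mono_left nhdsWithin_le_nhds

lemma differentiableAt_poles {E : Type*} [NormedAddCommGroup E] [NormedSpace ℂ E] {ι : Type*}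
    (s : Finset ι) {p : ι → ℂ} (u : ι → E) {z : ℂ} (hp : ∀ j ∈ s, z ≠ p j) :
    DifferentiableAt ℂ (fun z => ∑ j ∈ s, (z - p j)⁻¹ • u j) z := by
  refine DifferentiableAt.fun_sum fun j hj => DifferentiableAt.smul_const ?_ _
  exact (differentiableAt_id.sub_const _).fun_inv (sub_ne_zero.2 (hp j hj))

lemma tendsto_mul_poles {E : Type*} [NormedAddCommGroup E] [NormedSpace ℂ E] (u : Fin N → E)
    (hp : Function.Injective p) (k : Fin N) :
    Tendsto (fun z => (z - p k) • ∑ j, (z - p j)⁻¹ • u j) (𝓝[≠] p k) (𝓝 (u k)) := by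
  have h1 := (tendsto_sub_smul_nhdsNE (differentiableAt_poles (Finset.univ.erase k) u
    fun j hj => (hp.ne (Finset.ne_of_mem_erase hj).symm)).continuousAt).add_const (u k)
  rw [zero_add] at h1
  refine h1.congr' ?_
  filter_upwards [self_mem_nhdsWithin] with z hz
  have h4 : (z - p k) • (z - p k)⁻¹ • u k = u k := by
    rw [smul_smul, mul_inv_cancel₀ (sub_ne_zero.2 hz), one_smul]
  rw [← Finset.add_sum_erase _ _ (Finset.mem_univ k), smul_add, h4, add_comm]

lemma differentiableAt_colFun {z : ℂ} (hz : z.im ≠ 0) (hp : ∀ j, z ≠ p j) :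
    DifferentiableAt ℂ (colFun e g p u) z := by
  exact ((differentiableAt_const _).add (differentiableAt_cauchyInt m g hz)).add
    (differentiableAt_poles _ _ fun j _ => hp j)

lemma tendsto_mul_colFun (hp : Function.Injective p) {k : Fin N} (hk : (p k).im ≠ 0) :
    Tendsto (fun z => (z - p k) • colFun e g p u z) (𝓝[≠] p k) (𝓝 (u k)) := by
  have h1 := (tendsto_sub_smul_nhdsNE ((differentiableAt_const e).add
    (differentiableAt_cauchyInt m g hk)).continuousAt).add (tendsto_mul_poles u hp k)
  rw [zero_add] at h1
  exact h1.congr fun z => (smul_add _ _ _).symm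

/-- The dominating fraction depends only on `ε` and `Re q`, so the bound is uniform in `γ`, even for
lines through the pole. -/
lemma eLpNorm_pole_restrict_le {q : ℂ} {ε γ : ℝ} (hε : 0 < ε) {S : Set ℝ} (hS : MeasurableSet S)
    (h : ∀ x ∈ S, ε ≤ ‖(x + γ * I : ℂ) - q‖) :
    eLpNorm (fun x : ℝ => ((x : ℂ) + γ * I - q)⁻¹) 2 (volume.restrict S) ≤
      2 * eLpNorm (fun s : ℝ => ((s : ℂ) - (q.re + ε * I))⁻¹) 2 volume := by
  have h1 : eLpNorm (fun x : ℝ => ((x : ℂ) + γ * I - q)⁻¹) 2 (volume.restrict S) ≤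
      eLpNorm ((2 : ℂ) • fun s : ℝ => ((s : ℂ) - (q.re + ε * I))⁻¹) 2 (volume.restrict S) := by
    refine eLpNorm_mono_ae ?_
    filter_upwards [ae_restrict_mem hS] with x hx
    have h2 := norm_inv_sub_le_kernel hε (h x hx)
    have h3 : (x + γ * I : ℂ).re = x := by simp
    rw [h3] at h2
    simpa using h2
  refine h1.trans ((eLpNorm_mono_measure _ Measure.restrict_le_self).trans ?_)
  rw [eLpNorm_const_smul]
  gcongr
  simp [enorm_eq_nnnorm]

lemma eLpNorm_smul_const_le {E : Type*} [NormedAddCommGroup E] [NormedSpace ℂ E] (φ : ℝ → ℂ)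
    (v : E) (μ : Measure ℝ) :
    eLpNorm (fun x => φ x • v) 2 μ ≤ eLpNorm φ 2 μ * ‖v‖ₑ := by
  refine (eLpNorm_le_nnreal_smul_eLpNorm_of_ae_le_mul (c := ‖v‖₊) (g := φ)
    (Eventually.of_forall fun x => ?_) 2).trans_eq ?_
  · rw [nnnorm_smul, mul_comm]
  · rw [mul_comm]
    rfl

lemma measurableSet_off_discs (q : Fin N → ℂ) (ε γ : ℝ) :
    MeasurableSet {x : ℝ | ∀ j, ε ≤ ‖(x + γ * I : ℂ) - q j‖} := by
  rw [Set.ofPred_forall]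
  refine MeasurableSet.iInter fun j => (isClosed_le continuous_const ?_).measurableSet
  fun_prop

lemma continuous_cauchyInt_line {γ : ℝ} (hγ : γ ≠ 0) :
    Continuous fun x : ℝ => cauchyInt g (x + γ * I) := by
  refine continuous_iff_continuousAt.2 fun x => ?_
  have h : ContinuousAt (cauchyInt g) (x + γ * I) :=
    (differentiableAt_cauchyInt m g (by simpa using hγ)).continuousAt
  exact h.comp (f := fun x : ℝ => (x : ℂ) + γ * I) (by fun_prop)

lemma aestronglyMeasurable_pole_smul {E : Type*} [NormedAddCommGroup E] [NormedSpace ℂ E] 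
    (q : ℂ) (γ : ℝ) (v : E) (μ : Measure ℝ) :
    AEStronglyMeasurable (fun x : ℝ => ((x : ℂ) + γ * I - q)⁻¹ • v) μ :=
  (Measurable.aestronglyMeasurable (f := fun x : ℝ => ((x : ℂ) + γ * I - q)⁻¹)
    (by fun_prop)).smul_const v

/-- Uniform square integrability of simple fractions on horizontal lines, away from the poles. -/
lemma exists_eLpNorm_poles_le {E : Type*} [NormedAddCommGroup E] [NormedSpace ℂ E] (u : Fin N → E)
    (p : Fin N → ℂ) {ε : ℝ} (hε : 0 < ε) : ∃ C : ℝ≥0,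
    ∀ γ : ℝ, ∀ S : Set ℝ, MeasurableSet S → (∀ x ∈ S, ∀ j, ε ≤ ‖(x + γ * I : ℂ) - p j‖) →
      eLpNorm (fun x : ℝ => ∑ j, ((x : ℂ) + γ * I - p j)⁻¹ • u j) 2 (volume.restrict S) ≤ C := by
  obtain ⟨C, hC⟩ : ∃ C : ℝ≥0, (C : ℝ≥0∞) = ∑ j, 2 * eLpNorm (fun s : ℝ =>
      ((s : ℂ) - ((p j).re + ε * I))⁻¹) 2 volume * ‖u j‖ₑ := by
    refine exists_coe_eq (ENNReal.sum_ne_top.2 fun j _ => ENNReal.mul_ne_top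
      (ENNReal.mul_ne_top (by simp) (memLp_kernel _ ?_).2.ne) enorm_ne_top)
    simpa using hε.ne'
  refine ⟨C, fun γ S hS h => ?_⟩
  rw [hC]
  have h1 : (fun x : ℝ => ∑ j, ((x : ℂ) + γ * I - p j)⁻¹ • u j) =
      ∑ j, fun x : ℝ => ((x : ℂ) + γ * I - p j)⁻¹ • u j := by
    ext1 x
    simp
  rw [h1]
  refine (eLpNorm_sum_le (fun j _ => aestronglyMeasurable_pole_smul (p j) γ (u j) _)
    (by norm_num)).trans (Finset.sum_le_sum fun j _ => ?_)
  refine le_trans ?_ (mul_le_mul_left (eLpNorm_pole_restrict_le (q := p j) (γ := γ) hε hS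
    fun x hx => h x hx j) _)
  exact eLpNorm_smul_const_le _ _ _

/-- The set `S` is arbitrary because the normalization removes discs around all the `z_j` and `conj
z_j`, while a single column has poles at only half of them. -/
lemma exists_eLpNorm_colFun_le (p : Fin N → ℂ) {ε : ℝ} (hε : 0 < ε) : ∃ C : ℝ≥0,
    ∀ γ : ℝ, γ ≠ 0 → ∀ S : Set ℝ, MeasurableSet S →
      (∀ x ∈ S, ∀ j, ε ≤ ‖(x + γ * I : ℂ) - p j‖) →
      eLpNorm (fun x : ℝ => colFun e g p u (x + γ * I) - e) 2 (volume.restrict S) ≤ C := by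
  obtain ⟨C, hC⟩ := exists_eLpNorm_poles_le u p hε
  refine ⟨‖g‖₊ + C, fun γ hγ S hS h => ?_⟩
  have h1 : (fun x : ℝ => colFun e g p u (x + γ * I) - e) =
      (fun x : ℝ => cauchyInt g (x + γ * I)) +
        fun x : ℝ => ∑ j, ((x : ℂ) + γ * I - p j)⁻¹ • u j := by
    ext1 x
    simp only [colFun, Pi.add_apply]
    abel
  rw [h1, ENNReal.coe_add]
  refine (eLpNorm_add_le (continuous_cauchyInt_line g hγ).aestronglyMeasurable ?_
    (by norm_num)).trans ?_
  · exact Finset.aestronglyMeasurable_fun_sum _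
      fun j _ => aestronglyMeasurable_pole_smul (p j) γ (u j) _
  · gcongr
    · exact (eLpNorm_mono_measure _ Measure.restrict_le_self).trans
        (eLpNorm_cauchyInt_le m hγ g)
    · exact hC γ S hS h

lemma tendsto_eLpNorm_pole_sub {q : ℂ} (hq : q.im ≠ 0) :
    Tendsto (fun γ : ℝ => eLpNorm (fun x : ℝ => ((x : ℂ) + γ * I - q)⁻¹ - ((x : ℂ) - q)⁻¹) 2 volume)
      (𝓝 0) (𝓝 0) := by
  have hpos : 0 < |q.im| := abs_pos.2 hq
  -- For small `γ` the shifted fraction is at most twice the original one, hence the difference at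
  -- most three times.
  refine tendsto_eLpNorm_two_of_dominated (g := fun x : ℝ => 3 * ‖((x : ℂ) - q)⁻¹‖)
    (Eventually.of_forall fun γ => Measurable.aestronglyMeasurable (by fun_prop))
    ((memLp_kernel q hq).norm.const_mul 3) ?_ (Eventually.of_forall fun x => ?_)
  · filter_upwards [Metric.closedBall_mem_nhds (0 : ℝ) (half_pos hpos)] with γ hγ
    refine Eventually.of_forall fun x => ?_
    have h1 : ‖(q - γ * I) - q‖ ≤ |q.im| / 2 := by
      rw [sub_sub_cancel_left, norm_neg, norm_mul, norm_I, mul_one, norm_real]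
      simpa using hγ
    have h2 := norm_inv_ofReal_sub_le hq h1 x
    have h3 : (x : ℂ) - (q - γ * I) = x + γ * I - q := by ring
    rw [h3] at h2
    linarith [norm_sub_le ((x : ℂ) + γ * I - q)⁻¹ ((x : ℂ) - q)⁻¹]
  · have h1 : ContinuousAt (fun γ : ℝ => ((x : ℂ) + γ * I - q)⁻¹ - ((x : ℂ) - q)⁻¹) 0 := by
      refine ContinuousAt.sub (ContinuousAt.inv₀ (by fun_prop) ?_) continuousAt_const
      simpa using ofReal_sub_ne_zero hq x
    have := h1.tendsto
    simpa using this

lemma tendsto_eLpNorm_poles_sub {E : Type*} [NormedAddCommGroup E] [NormedSpace ℂ E] (u : Fin N → E)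
    (hp : ∀ j, (p j).im ≠ 0) :
    Tendsto (fun γ : ℝ => eLpNorm (fun x : ℝ => ∑ j, ((x : ℂ) + γ * I - p j)⁻¹ • u j -
      ∑ j, ((x : ℂ) - p j)⁻¹ • u j) 2 volume) (𝓝 0) (𝓝 0) := by
  have h1 : Tendsto (fun γ : ℝ => ∑ j, eLpNorm (fun x : ℝ =>
      ((x : ℂ) + γ * I - p j)⁻¹ - ((x : ℂ) - p j)⁻¹) 2 volume * ‖u j‖ₑ) (𝓝 0) (𝓝 0) := by
    have : ∀ j ∈ Finset.univ, Tendsto (fun γ : ℝ => eLpNorm (fun x : ℝ =>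
        ((x : ℂ) + γ * I - p j)⁻¹ - ((x : ℂ) - p j)⁻¹) 2 volume * ‖u j‖ₑ) (𝓝 0) (𝓝 0) := by
      intro j _
      simpa using ENNReal.Tendsto.mul_const (tendsto_eLpNorm_pole_sub (hp j))
        (Or.inr (enorm_ne_top (x := u j)))
    simpa using tendsto_finsetSum _ this
  refine tendsto_of_tendsto_of_tendsto_of_le_of_le tendsto_const_nhds h1 (fun _ => zero_le)
    fun γ => ?_
  have h2 : (fun x : ℝ => ∑ j, ((x : ℂ) + γ * I - p j)⁻¹ • u j - ∑ j, ((x : ℂ) - p j)⁻¹ • u j) =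
      ∑ j, fun x : ℝ => (((x : ℂ) + γ * I - p j)⁻¹ - ((x : ℂ) - p j)⁻¹) • u j := by
    ext1 x
    simp [sub_smul, Finset.sum_sub_distrib]
  simp only
  rw [h2]
  refine (eLpNorm_sum_le (fun j _ => ?_) (by norm_num)).trans (Finset.sum_le_sum fun j _ => ?_)
  · exact (Measurable.aestronglyMeasurable (f := fun x : ℝ =>
      ((x : ℂ) + γ * I - p j)⁻¹ - ((x : ℂ) - p j)⁻¹) (by fun_prop)).smul_const (u j)
  · exact eLpNorm_smul_const_le _ _ _

/-- Boundary values of a column function, given those of the Cauchy integral. -/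
lemma tendsto_colFun_of_tendsto_cauchyInt (hp : ∀ j, (p j).im ≠ 0) {τ : ℝ → ℝ} {l : Filter ℝ}
    (hτ : Tendsto τ l (𝓝 0)) (hτ0 : ∀ᶠ γ in l, τ γ ≠ 0) {T : L2 (Col m)}
    (hT : Tendsto (fun γ : ℝ => eLpNorm (fun x : ℝ => cauchyInt g (x + τ γ * I) - T x) 2 volume)
      l (𝓝 0)) :
    Tendsto (fun γ : ℝ => eLpNorm (fun x : ℝ => colFun e g p u (x + τ γ * I) -
      (e + T x + ∑ j, ((x : ℂ) - p j)⁻¹ • u j)) 2 volume) l (𝓝 0) := by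
  have h1 := hT.add ((tendsto_eLpNorm_poles_sub u hp).comp hτ)
  rw [add_zero] at h1
  refine tendsto_of_tendsto_of_tendsto_of_le_of_le' tendsto_const_nhds h1
    (Eventually.of_forall fun _ => zero_le) ?_
  filter_upwards [hτ0] with γ hγ
  have h2 : (fun x : ℝ => colFun e g p u (x + τ γ * I) -
      (e + T x + ∑ j, ((x : ℂ) - p j)⁻¹ • u j)) =
      (fun x : ℝ => cauchyInt g (x + τ γ * I) - T x) +
      fun x : ℝ => ∑ j, ((x : ℂ) + τ γ * I - p j)⁻¹ • u j - ∑ j, ((x : ℂ) - p j)⁻¹ • u j := by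
    ext1 x
    simp only [colFun, Pi.add_apply]
    abel
  rw [h2]
  refine eLpNorm_add_le ((continuous_cauchyInt_line g hγ).aestronglyMeasurable.sub
    (Lp.aestronglyMeasurable T)) ?_ (by norm_num)
  refine (Finset.aestronglyMeasurable_fun_sum _
    fun j _ => aestronglyMeasurable_pole_smul (p j) _ (u j) _).sub
    (Finset.aestronglyMeasurable_fun_sum _ fun j _ => ?_)
  exact (continuous_kernel (hp j)).aestronglyMeasurable.smul_const _

lemma tendsto_colFun_plus (hp : ∀ j, (p j).im ≠ 0) :
    Tendsto (fun γ : ℝ => eLpNorm (fun x : ℝ => colFun e g p u (x + γ * I) -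
      (e + cauchyPlus m g x + ∑ j, ((x : ℂ) - p j)⁻¹ • u j)) 2 volume) (𝓝[>] 0) (𝓝 0) :=
  tendsto_colFun_of_tendsto_cauchyInt e g u hp (tendsto_id.mono_left nhdsWithin_le_nhds)
    (by filter_upwards [self_mem_nhdsWithin] with γ hγ using ne_of_gt hγ)
    (tendsto_cauchyInt_plus m g)

lemma tendsto_colFun_minus (hp : ∀ j, (p j).im ≠ 0) :
    Tendsto (fun γ : ℝ => eLpNorm (fun x : ℝ => colFun e g p u (x - γ * I) -
      (e + cauchyMinus m g x + ∑ j, ((x : ℂ) - p j)⁻¹ • u j)) 2 volume) (𝓝[>] 0) (𝓝 0) := by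
  have hx : ∀ x γ : ℝ, (x : ℂ) - γ * I = x + ((-γ : ℝ) : ℂ) * I := fun x γ => by
    push_cast
    ring
  have h := tendsto_cauchyInt_minus m g
  simp_rw [hx] at h ⊢
  have h0 : Tendsto (fun γ : ℝ => -γ) (𝓝[>] 0) (𝓝 0) := by
    have := (continuous_neg (G := ℝ)).tendsto 0
    rw [neg_zero] at this
    exact this.mono_left nhdsWithin_le_nhds
  exact tendsto_colFun_of_tendsto_cauchyInt e g u hp (τ := fun γ => -γ) h0
    (by filter_upwards [self_mem_nhdsWithin] with γ hγ using neg_ne_zero.2 (ne_of_gt hγ)) h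

/-- In the upper half-plane, a column function with poles in the lower half-plane is the Cauchy
integral of its boundary value. -/
lemma cauchyAt_eq_colFun_upper (hp : ∀ j, (p j).im < 0) {f : L2 (Col m)}
    (hf : f = cauchyPlus m g + ∑ j, poleFun m (p j) (hp j).ne (u j)) {z : ℂ} (hz : 0 < z.im) :
    e + cauchyAt m z hz.ne' f = colFun e g p u z := by
  have hside : side z = 1 := if_pos hz
  rw [colFun, hf, map_add, map_sum, add_assoc, ← cauchyAt_eq_cauchyInt m z hz.ne' g]
  congr 2
  · exact cauchyAt_fourierCutoff_Ioi m hz.ne' hz g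
  · refine Finset.sum_congr rfl fun j _ => ?_
    rw [cauchyAt_poleFun m hz.ne' (hp j).ne (mul_neg_of_pos_of_neg hz (hp j)), hside, one_mul]

/-- In the lower half-plane, a column function with poles in the upper half-plane is minus the
Cauchy integral of its boundary value. -/
lemma cauchyAt_eq_colFun_lower (hp : ∀ j, 0 < (p j).im) {f : L2 (Col m)}
    (hf : f = cauchyMinus m g + ∑ j, poleFun m (p j) (hp j).ne' (u j)) {z : ℂ} (hz : z.im < 0) :
    e - cauchyAt m z hz.ne f = colFun e g p u z := by
  have hside : side z = -1 := if_neg hz.not_gt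
  have hc : cauchyMinus m g = -projMinus m g := rfl
  rw [colFun, hf, map_add, map_sum, add_assoc, ← cauchyAt_eq_cauchyInt m z hz.ne g, sub_eq_add_neg,
    neg_add, hc, map_neg, neg_neg, ← Finset.sum_neg_distrib]
  congr 2
  · exact cauchyAt_fourierCutoff_Iio m hz.ne hz g
  · refine Finset.sum_congr rfl fun j _ => ?_
    rw [cauchyAt_poleFun m hz.ne (hp j).ne' (mul_neg_of_neg_of_pos hz (hp j)), hside, neg_one_mul,
      neg_smul, neg_neg]

lemma coeFn_sum {ι : Type*} (s : Finset ι) (f : ι → L2 (Col m)) :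
    (∑ j ∈ s, f j : L2 (Col m)) =ᵐ[volume] fun x => ∑ j ∈ s, f j x := by
  classical
  induction s using Finset.induction_on with
  | empty =>
    simp only [Finset.sum_empty]
    exact Lp.coeFn_zero (Col m) 2 (volume : Measure ℝ)
  | insert a s ha ih =>
    rw [Finset.sum_insert ha]
    filter_upwards [Lp.coeFn_add (f a) (∑ j ∈ s, f j), ih] with x h1 h2
    rw [h1, Pi.add_apply, h2, Finset.sum_insert ha]

lemma coeFn_sum_poleFun (hp : ∀ j, (p j).im ≠ 0) :
    (∑ j, poleFun m (p j) (hp j) (u j) : L2 (Col m)) =ᵐ[volume]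
      fun x : ℝ => ∑ j, ((x : ℂ) - p j)⁻¹ • u j := by
  refine (coeFn_sum Finset.univ fun j => poleFun m (p j) (hp j) (u j)).trans ?_
  have h : ∀ᵐ x : ℝ, ∀ j, poleFun m (p j) (hp j) (u j) x = ((x : ℂ) - p j)⁻¹ • u j :=
    ae_all_iff.2 fun j => coeFn_poleFun m (p j) (hp j) (u j)
  filter_upwards [h] with x hx
  exact Finset.sum_congr rfl fun j _ => hx j

/-- Plemelj's jump formula: with the sign in `cauchyMinus`, the difference is the sum of the two
Hardy projections. -/
lemma cauchyPlus_sub_cauchyMinus : cauchyPlus m g - cauchyMinus m g = g := by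
  have hc : cauchyMinus m g = -projMinus m g := rfl
  rw [hc, sub_neg_eq_add]
  exact fourierCutoff_Ioi_add_Iio m g

end Column

/-! ### From the singular integral equation to a solution -/

/-- The columns of the identity matrix. -/
abbrev stdCol (b : Fin 2) : Col 2 := EuclideanSpace.single b 1

lemma stdCol_apply (a b : Fin 2) : stdCol b a = (1 : Matrix (Fin 2) (Fin 2) ℂ) a b := by
  rw [PiLp.single_apply, Matrix.one_apply]

/-- `x ↦ φ x • v` as an element of `L²`. -/
def smulVec {m : ℕ} {φ : ℝ → ℂ} (h : MemLp φ 2 volume) (v : Col m) : L2 (Col m) :=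
  (ContinuousLinearMap.toSpanSingleton ℂ v).compLp h.toLp

lemma coeFn_smulVec {m : ℕ} {φ : ℝ → ℂ} (h : MemLp φ 2 volume) (v : Col m) :
    smulVec h v =ᵐ[volume] fun x => φ x • v := by
  filter_upwards [(ContinuousLinearMap.toSpanSingleton ℂ v).coeFn_compLp h.toLp, h.coeFn_toLp]
    with x h1 h2
  rw [smulVec, h1, h2]
  simp

section Density

variable {N : ℕ} {r : ℝ → ℂ} (hr : MemLp r 2 volume) (D : DiscreteData N) (y : ℝ)

/-- The jump of the first column, `r e^{-2iθ} (e₂ + f₂)`. -/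
def firstJump (f₂ : L2 (Col 2)) : L2 (Col 2) :=
  mulFun 2 (weight r y) f₂ + smulVec (memLp_weight y hr) (stdCol 1)

/-- The jump of the second column, `conj r e^{2iθ} (e₁ + f₁)`. -/
def secondJump (f₁ : L2 (Col 2)) : L2 (Col 2) :=
  mulFun 2 (fun x => conj (weight r y x)) f₁ + smulVec (memLp_conj_weight y hr) (stdCol 0)

/-- The residues of the first column at the points `z_j`. -/
def firstResidue (f₂ : L2 (Col 2)) (j : Fin N) : Col 2 :=
  D.coeff y j • (stdCol 1 + cauchyAt 2 (D.pole j) (D.im_ne j) f₂)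

/-- The residues of the second column at the points `conj z_j`. -/
def secondResidue (f₁ : L2 (Col 2)) (j : Fin N) : Col 2 :=
  (-conj (D.coeff y j)) • (stdCol 0 - cauchyAt 2 (conj (D.pole j)) (D.conj_im_ne j) f₁)

/-- The singular integral equation `f = 𝒦(I + f)`. -/
structure IsDensity (f₁ f₂ : L2 (Col 2)) : Prop where
  first : f₁ = cauchyMinus 2 (firstJump hr y f₂) +
    ∑ j, poleFun 2 (D.pole j) (D.im_ne j) (firstResidue D y f₂ j)
  second : f₂ = cauchyPlus 2 (secondJump hr y f₁) +
    ∑ j, poleFun 2 (conj (D.pole j)) (D.conj_im_ne j) (secondResidue D y f₁ j)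

/-- The inhomogeneity `𝒦 I` of the singular integral equation. -/
def densitySource : MatL2 2 :=
  WithLp.toLp 2
    (cauchyMinus 2 (smulVec (memLp_weight y hr) (stdCol 1)) +
      ∑ j, D.coeff y j • poleFun 2 (D.pole j) (D.im_ne j) (stdCol 1),
    cauchyPlus 2 (smulVec (memLp_conj_weight y hr) (stdCol 0)) +
      ∑ j, (-conj (D.coeff y j)) • poleFun 2 (conj (D.pole j)) (D.conj_im_ne j) (stdCol 0))

/-- The constant `I` is not square integrable, so `opK` cannot be applied to it. Its image is
written out in `densitySource`, each constant column counting as its own analytic extension. -/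
lemma isDensity_iff (f₁ f₂ : L2 (Col 2)) : IsDensity hr D y f₁ f₂ ↔
    (1 - opK 2 r D y) (WithLp.toLp 2 (f₁, f₂)) = densitySource hr D y := by
  have h1 : (1 - opK 2 r D y) (WithLp.toLp 2 (f₁, f₂)) =
      WithLp.toLp 2 (f₁ - (opA1 2 r y f₂ + opA2 2 D y f₂),
        f₂ - (opB1 2 r y f₁ + opB2 2 D y f₁)) := rfl
  have h2 : cauchyMinus 2 (firstJump hr y f₂) +
      ∑ j, poleFun 2 (D.pole j) (D.im_ne j) (firstResidue D y f₂ j) =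
      (densitySource hr D y).fst + (opA1 2 r y f₂ + opA2 2 D y f₂) := by
    have hA : opA1 2 r y f₂ = cauchyMinus 2 (mulFun 2 (weight r y) f₂) := rfl
    simp only [densitySource, firstJump, firstResidue, map_add, map_smul, smul_add,
      Finset.sum_add_distrib, opA2_apply, WithLp.toLp_fst, hA]
    abel
  have h3 : cauchyPlus 2 (secondJump hr y f₁) +
      ∑ j, poleFun 2 (conj (D.pole j)) (D.conj_im_ne j) (secondResidue D y f₁ j) =
      (densitySource hr D y).snd + (opB1 2 r y f₁ + opB2 2 D y f₁) := by
    have hB : opB1 2 r y f₁ = cauchyPlus 2 (mulFun 2 (fun x => conj (weight r y x)) f₁) := rfl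
    simp only [densitySource, secondJump, secondResidue, map_add, map_smul, map_neg, smul_sub,
      neg_smul, sub_neg_eq_add, Finset.sum_add_distrib, Finset.sum_neg_distrib, opB2_apply,
      WithLp.toLp_snd, hB]
    abel
  rw [h1]
  constructor
  · rintro ⟨e1, e2⟩
    rw [h2] at e1
    rw [h3] at e2
    rw [WithLp.ext_iff]
    exact Prod.ext (sub_eq_iff_eq_add.2 e1) (sub_eq_iff_eq_add.2 e2)
  · intro h
    refine ⟨?_, ?_⟩
    · rw [h2, ← h, WithLp.toLp_fst]
      exact (sub_add_cancel _ _).symm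
    · rw [h3, ← h, WithLp.toLp_snd]
      exact (sub_add_cancel _ _).symm

lemma existsUnique_density (hr' : MemLp r ∞ volume) :
    ∃ f₁ f₂, IsDensity hr D y f₁ f₂ ∧
      ∀ g₁ g₂, IsDensity hr D y g₁ g₂ → g₁ = f₁ ∧ g₂ = f₂ := by
  obtain ⟨T, hT1, hT2, -⟩ := exists_inverse_one_sub_opK 2 D y hr'
  set f := T (densitySource hr D y) with hf
  refine ⟨f.fst, f.snd, (isDensity_iff hr D y _ _).2 ?_, fun g₁ g₂ hg => ?_⟩
  · exact congrArg (fun A : MatL2 2 →L[ℂ] MatL2 2 => A (densitySource hr D y)) hT2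
  · have h1 : WithLp.toLp 2 (g₁, g₂) = f := by
      rw [hf, ← (isDensity_iff hr D y g₁ g₂).1 hg]
      exact (congrArg (fun A : MatL2 2 →L[ℂ] MatL2 2 => A (WithLp.toLp 2 (g₁, g₂))) hT1).symm
    rw [← h1]
    exact ⟨rfl, rfl⟩

lemma firstJump_ae (hr' : MemLp r ∞ volume) (f₂ : L2 (Col 2)) :
    firstJump hr y f₂ =ᵐ[volume] fun x => weight r y x • (stdCol 1 + f₂ x) := by
  filter_upwards [Lp.coeFn_add (mulFun 2 (weight r y) f₂)
    (smulVec (memLp_weight y hr) (stdCol 1)), coeFn_mulFun 2 (memLp_weight y hr') f₂,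
    coeFn_smulVec (memLp_weight y hr) (stdCol 1)] with x h1 h2 h3
  rw [firstJump, h1, Pi.add_apply, h2, h3, smul_add, add_comm]

lemma secondJump_ae (hr' : MemLp r ∞ volume) (f₁ : L2 (Col 2)) :
    secondJump hr y f₁ =ᵐ[volume] fun x => conj (weight r y x) • (stdCol 0 + f₁ x) := by
  filter_upwards [Lp.coeFn_add (mulFun 2 (fun x => conj (weight r y x)) f₁)
    (smulVec (memLp_conj_weight y hr) (stdCol 0)), coeFn_mulFun 2 (memLp_conj_weight y hr') f₁,
    coeFn_smulVec (memLp_conj_weight y hr) (stdCol 0)] with x h1 h2 h3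
  rw [secondJump, h1, Pi.add_apply, h2, h3, smul_add, add_comm]

/-- The first column of the solution. -/
def firstCol (f₂ : L2 (Col 2)) : ℂ → Col 2 :=
  colFun (stdCol 0) (firstJump hr y f₂) D.pole (firstResidue D y f₂)

/-- The second column of the solution. -/
def secondCol (f₁ : L2 (Col 2)) : ℂ → Col 2 :=
  colFun (stdCol 1) (secondJump hr y f₁) (fun j => conj (D.pole j)) (secondResidue D y f₁)

/-- The matrix with given columns. -/
def ofCols (v w : Col 2) : Matrix (Fin 2) (Fin 2) ℂ := Matrix.of fun a b => (![v, w] b : Col 2) a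

@[simp] lemma ofCols_zero (v w : Col 2) (a : Fin 2) : ofCols v w a 0 = v a := rfl

@[simp] lemma ofCols_one (v w : Col 2) (a : Fin 2) : ofCols v w a 1 = w a := rfl

/-- The solution of the Riemann–Hilbert problem built from a solution of the singular integral
equation. -/
def rhMatrix (f₁ f₂ : L2 (Col 2)) (z : ℂ) : Matrix (Fin 2) (Fin 2) ℂ :=
  ofCols (firstCol hr D y f₂ z) (secondCol hr D y f₁ z)

lemma DiscreteData.pole_ne_conj (D : DiscreteData N) (j k : Fin N) :
    D.pole j ≠ conj (D.pole k) := by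
  intro h
  have h1 := congrArg im h
  rw [conj_im] at h1
  linarith [D.pole_im_pos j, D.pole_im_pos k]

lemma DiscreteData.conj_pole_injective (D : DiscreteData N) :
    Function.Injective fun j => conj (D.pole j) :=
  (starRingEnd ℂ).injective.comp D.pole_injective

lemma DiscreteData.conj_pole_im_neg (D : DiscreteData N) (j : Fin N) :
    (conj (D.pole j)).im < 0 := by
  simpa using D.pole_im_pos j

variable {D y hr} {f₁ f₂ : L2 (Col 2)}

/-- By the second equation `e₂ + f₂` is the boundary value, from above, of the second column, which
has no poles there; so the point evaluation in `firstResidue` returns that column at `z_j`. -/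
lemma IsDensity.firstResidue_eq (h : IsDensity hr D y f₁ f₂) (j : Fin N) :
    firstResidue D y f₂ j = D.coeff y j • secondCol hr D y f₁ (D.pole j) := by
  rw [firstResidue, secondCol, ← cauchyAt_eq_colFun_upper (stdCol 1) (secondJump hr y f₁)
    (secondResidue D y f₁) D.conj_pole_im_neg h.second (D.pole_im_pos j)]

lemma IsDensity.secondResidue_eq (h : IsDensity hr D y f₁ f₂) (j : Fin N) :
    secondResidue D y f₁ j = (-conj (D.coeff y j)) • firstCol hr D y f₂ (conj (D.pole j)) := by
  rw [secondResidue, firstCol, ← cauchyAt_eq_colFun_lower (stdCol 0) (firstJump hr y f₂)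
    (firstResidue D y f₂) D.pole_im_pos h.first (D.conj_pole_im_neg j)]

lemma tendsto_col_apply {ι : Type*} {l : Filter ι} {f : ι → Col 2} {v : Col 2}
    (h : Tendsto f l (𝓝 v)) (a : Fin 2) : Tendsto (fun i => f i a) l (𝓝 (v a)) :=
  ((EuclideanSpace.proj a : Col 2 →L[ℂ] ℂ).continuous.tendsto v).comp h

lemma differentiableAt_firstCol {z : ℂ} (hz : z.im ≠ 0) (hp : ∀ j, z ≠ D.pole j) :
    DifferentiableAt ℂ (firstCol hr D y f₂) z :=
  differentiableAt_colFun _ _ _ hz hp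

lemma differentiableAt_secondCol {z : ℂ} (hz : z.im ≠ 0) (hp : ∀ j, z ≠ conj (D.pole j)) :
    DifferentiableAt ℂ (secondCol hr D y f₁) z :=
  differentiableAt_colFun _ _ _ hz hp

lemma IsDensity.residue (h : IsDensity hr D y f₁ f₂) (j : Fin N) :
    HasResidueCondition (rhMatrix hr D y f₁ f₂) (D.pole j) !![0, 0; D.coeff y j, 0] := by
  have hc : ContinuousAt (secondCol hr D y f₁) (D.pole j) :=
    (differentiableAt_secondCol (D.im_ne j) (D.pole_ne_conj j)).continuousAt
  -- The second column is continuous at `z_j`, so its residue is zero.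
  refine ⟨ofCols (firstResidue D y f₂ j) 0, ?_, ?_⟩
  · refine tendsto_pi_nhds.2 fun a => tendsto_pi_nhds.2 (Fin.forall_fin_two.2 ⟨?_, ?_⟩)
    · exact tendsto_col_apply (tendsto_mul_colFun (stdCol 0) (firstJump hr y f₂) _
        D.pole_injective (D.im_ne j)) a
    · exact tendsto_col_apply (tendsto_sub_smul_nhdsNE hc) a
  · refine tendsto_pi_nhds.2 fun a => tendsto_pi_nhds.2 (Fin.forall_fin_two.2 ⟨?_, ?_⟩)
    · have h1 : ∀ z, (rhMatrix hr D y f₁ f₂ z * !![0, 0; D.coeff y j, 0]) a 0 =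
          (D.coeff y j • secondCol hr D y f₁ z) a := fun z => by
        simp [Matrix.mul_apply, rhMatrix, mul_comm]
      simp_rw [h1, ofCols_zero, h.firstResidue_eq]
      exact tendsto_col_apply ((hc.tendsto.const_smul _).mono_left nhdsWithin_le_nhds) a
    · have h1 : ∀ z, (rhMatrix hr D y f₁ f₂ z * !![0, 0; D.coeff y j, 0]) a 1 = 0 := fun z => by
        simp [Matrix.mul_apply]
      simp_rw [h1]
      exact tendsto_const_nhds

lemma IsDensity.residue_conj (h : IsDensity hr D y f₁ f₂) (j : Fin N) :
    HasResidueCondition (rhMatrix hr D y f₁ f₂) (conj (D.pole j))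
      !![0, -conj (D.coeff y j); 0, 0] := by
  have hc : ContinuousAt (firstCol hr D y f₂) (conj (D.pole j)) :=
    (differentiableAt_firstCol (D.conj_im_ne j) fun k => (D.pole_ne_conj k j).symm).continuousAt
  refine ⟨ofCols 0 (secondResidue D y f₁ j), ?_, ?_⟩
  · refine tendsto_pi_nhds.2 fun a => tendsto_pi_nhds.2 (Fin.forall_fin_two.2 ⟨?_, ?_⟩)
    · exact tendsto_col_apply (tendsto_sub_smul_nhdsNE hc) a
    · exact tendsto_col_apply (tendsto_mul_colFun (stdCol 1) (secondJump hr y f₁) _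
        D.conj_pole_injective (D.conj_im_ne j)) a
  · refine tendsto_pi_nhds.2 fun a => tendsto_pi_nhds.2 (Fin.forall_fin_two.2 ⟨?_, ?_⟩)
    · have h1 : ∀ z, (rhMatrix hr D y f₁ f₂ z * !![0, -conj (D.coeff y j); 0, 0]) a 0 = 0 :=
        fun z => by simp [Matrix.mul_apply]
      simp_rw [h1]
      exact tendsto_const_nhds
    · have h1 : ∀ z, (rhMatrix hr D y f₁ f₂ z * !![0, -conj (D.coeff y j); 0, 0]) a 1 =
          ((-conj (D.coeff y j)) • firstCol hr D y f₂ z) a := fun z => by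
        simp [Matrix.mul_apply, rhMatrix, mul_comm]
      simp_rw [h1, ofCols_one, h.secondResidue_eq]
      exact tendsto_col_apply ((hc.tendsto.const_smul _).mono_left nhdsWithin_le_nhds) a

lemma enorm_apply_le (v : Col 2) (a : Fin 2) : ‖v a‖ₑ ≤ ‖v‖ₑ :=
  enorm_le_iff_norm_le.2 (PiLp.norm_apply_le v a)

lemma lintegral_colFun_sq_le (e : Col 2) (g : L2 (Col 2)) (p : Fin N → ℂ) (u : Fin N → Col 2)
    (a : Fin 2) {ε : ℝ} (hε : 0 < ε) : ∃ C : ℝ≥0, ∀ γ : ℝ, γ ≠ 0 → ∀ S : Set ℝ, MeasurableSet S →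
      (∀ x ∈ S, ∀ j, ε ≤ ‖(x + γ * I : ℂ) - p j‖) →
      ∫⁻ x in S, ‖colFun e g p u (x + γ * I) a - e a‖ₑ ^ 2 ≤ C := by
  obtain ⟨C, hC⟩ := exists_eLpNorm_colFun_le e g u p hε
  refine ⟨C ^ 2, fun γ hγ S hS h => ?_⟩
  rw [ENNReal.coe_pow]
  calc ∫⁻ x in S, ‖colFun e g p u (x + γ * I) a - e a‖ₑ ^ 2
      ≤ ∫⁻ x in S, ‖colFun e g p u (x + γ * I) - e‖ₑ ^ 2 := by
        refine lintegral_mono fun x => ?_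
        simp only
        gcongr
        exact enorm_apply_le (colFun e g p u (x + γ * I) - e) a
    _ = eLpNorm (fun x : ℝ => colFun e g p u (x + γ * I) - e) 2 (volume.restrict S) ^ 2 :=
        (eLpNorm_two_sq _ _).symm
    _ ≤ _ := by
        gcongr
        exact hC γ hγ S hS h

lemma tendsto_eLpNorm_apply {f : ℝ → ℝ → Col 2} {g : ℝ → Col 2} {l : Filter ℝ}
    (h : Tendsto (fun γ => eLpNorm (fun x => f γ x - g x) 2 volume) l (𝓝 0)) (a : Fin 2) :
    Tendsto (fun γ => eLpNorm (fun x => f γ x a - g x a) 2 volume) l (𝓝 0) :=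
  tendsto_of_tendsto_of_tendsto_of_le_of_le tendsto_const_nhds h (fun _ => zero_le) fun γ =>
    eLpNorm_mono fun x => PiLp.norm_apply_le (f γ x - g x) a

lemma memLp_boundary (e : Col 2) (T : L2 (Col 2)) {p : Fin N → ℂ} (hp : ∀ j, (p j).im ≠ 0)
    (u : Fin N → Col 2) (a : Fin 2) :
    MemLp (fun x : ℝ => (e + T x + ∑ j, ((x : ℂ) - p j)⁻¹ • u j) a - e a) 2 volume := by
  have h1 : MemLp (fun x : ℝ => T x + ∑ j, ((x : ℂ) - p j)⁻¹ • u j) 2 volume :=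
    (Lp.memLp T).add ((memLp_congr_ae (coeFn_sum_poleFun u hp)).1 (Lp.memLp _))
  refine ((EuclideanSpace.proj a : Col 2 →L[ℂ] ℂ).comp_memLp' h1).ae_eq
    (Eventually.of_forall fun x => ?_)
  change (T x + ∑ j, ((x : ℂ) - p j)⁻¹ • u j : Col 2) a = _
  simp only [PiLp.add_apply]
  ring

/-- The density equations identify `e₁ + f₁` with the first column of `M₋` and `e₂ + f₂` with the
second column of `M₊`. Plemelj's formula then yields the two jump relations whose combination is `M₊
= M₋ V_l`. -/
theorem IsDensity.isRHSolution (h : IsDensity hr D y f₁ f₂) (hr' : MemLp r ∞ volume) :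
    IsRHSolution r D y (rhMatrix hr D y f₁ f₂) where
  analytic a := Fin.forall_fin_two.2
    ⟨fun z hz => DifferentiableAt.differentiableWithinAt
      (differentiableAt_euclidean.1 (differentiableAt_firstCol hz.1 fun j => (hz.2 j).1) a),
    fun z hz => DifferentiableAt.differentiableWithinAt
      (differentiableAt_euclidean.1 (differentiableAt_secondCol hz.1 fun j => (hz.2 j).2) a)⟩
  residue := h.residue
  residue_conj := h.residue_conj
  normalized a b ε hε := by
    have hS : ∀ γ : ℝ, MeasurableSet {x : ℝ | ∀ j, ε ≤ ‖(x + γ * I : ℂ) - D.pole j‖ ∧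
        ε ≤ ‖(x + γ * I : ℂ) - conj (D.pole j)‖} := by
      intro γ
      simp_rw [forall_and]
      exact (measurableSet_off_discs D.pole ε γ).inter
        (measurableSet_off_discs (fun j => conj (D.pole j)) ε γ)
    revert b
    refine Fin.forall_fin_two.2 ⟨?_, ?_⟩
    · obtain ⟨C, hC⟩ := lintegral_colFun_sq_le (stdCol 0) (firstJump hr y f₂) D.pole
        (firstResidue D y f₂) a hε
      refine ⟨C, fun γ hγ => ?_⟩
      rw [← stdCol_apply]
      exact hC γ hγ _ (hS γ) fun x hx j => (hx j).1
    · obtain ⟨C, hC⟩ := lintegral_colFun_sq_le (stdCol 1) (secondJump hr y f₁)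
        (fun j => conj (D.pole j)) (secondResidue D y f₁) a hε
      refine ⟨C, fun γ hγ => ?_⟩
      rw [← stdCol_apply]
      exact hC γ hγ _ (hS γ) fun x hx j => (hx j).2
  jump := by
    set g₁ := firstJump hr y f₂ with hg₁
    set g₂ := secondJump hr y f₁ with hg₂
    set P₁ : ℝ → Col 2 := fun x => ∑ j, ((x : ℂ) - D.pole j)⁻¹ • firstResidue D y f₂ j with hP₁
    set P₂ : ℝ → Col 2 :=
      fun x => ∑ j, ((x : ℂ) - conj (D.pole j))⁻¹ • secondResidue D y f₁ j with hP₂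
    refine ⟨fun x => ofCols (stdCol 0 + cauchyPlus 2 g₁ x + P₁ x)
        (stdCol 1 + cauchyPlus 2 g₂ x + P₂ x),
      fun x => ofCols (stdCol 0 + cauchyMinus 2 g₁ x + P₁ x)
        (stdCol 1 + cauchyMinus 2 g₂ x + P₂ x), ?_, ?_, ?_, ?_, ?_⟩
    · refine fun a => Fin.forall_fin_two.2 ⟨?_, ?_⟩
      · rw [← stdCol_apply]
        exact memLp_boundary _ _ D.im_ne _ a
      · rw [← stdCol_apply]
        exact memLp_boundary _ _ D.conj_im_ne _ a
    · refine fun a => Fin.forall_fin_two.2 ⟨?_, ?_⟩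
      · rw [← stdCol_apply]
        exact memLp_boundary _ _ D.im_ne _ a
      · rw [← stdCol_apply]
        exact memLp_boundary _ _ D.conj_im_ne _ a
    · exact fun a => Fin.forall_fin_two.2
        ⟨tendsto_eLpNorm_apply (tendsto_colFun_plus _ _ _ D.im_ne) a,
          tendsto_eLpNorm_apply (tendsto_colFun_plus _ _ _ D.conj_im_ne) a⟩
    · exact fun a => Fin.forall_fin_two.2
        ⟨tendsto_eLpNorm_apply (tendsto_colFun_minus _ _ _ D.im_ne) a,
          tendsto_eLpNorm_apply (tendsto_colFun_minus _ _ _ D.conj_im_ne) a⟩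
    · have hsub : ∀ g : L2 (Col 2), ∀ᵐ x : ℝ, cauchyPlus 2 g x - cauchyMinus 2 g x = g x := by
        intro g
        have h1 := Lp.coeFn_sub (cauchyPlus 2 g) (cauchyMinus 2 g)
        rw [cauchyPlus_sub_cauchyMinus] at h1
        filter_upwards [h1] with x hx using hx.symm
      have hf₁ : ∀ᵐ x : ℝ, f₁ x = cauchyMinus 2 g₁ x + P₁ x := by
        have h1 := Lp.coeFn_add (cauchyMinus 2 g₁)
          (∑ j, poleFun 2 (D.pole j) (D.im_ne j) (firstResidue D y f₂ j))
        rw [hg₁, ← h.first] at h1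
        filter_upwards [h1, coeFn_sum_poleFun (firstResidue D y f₂) D.im_ne] with x h1 h2
        rw [h1, Pi.add_apply, h2]
      have hf₂ : ∀ᵐ x : ℝ, f₂ x = cauchyPlus 2 g₂ x + P₂ x := by
        have h1 := Lp.coeFn_add (cauchyPlus 2 g₂)
          (∑ j, poleFun 2 (conj (D.pole j)) (D.conj_im_ne j) (secondResidue D y f₁ j))
        rw [hg₂, ← h.second] at h1
        filter_upwards [h1, coeFn_sum_poleFun (secondResidue D y f₁) D.conj_im_ne] with x h1 h2
        rw [h1, Pi.add_apply, h2]
      filter_upwards [hsub g₁, hsub g₂, hf₁, hf₂, firstJump_ae hr y hr' f₂,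
        secondJump_ae hr y hr' f₁] with x h1 h2 h3 h4 h5 h6
      rw [h5, h4] at h1
      rw [h6, h3] at h2
      have hw : (‖r x‖ : ℂ) ^ 2 = conj (weight r y x) * weight r y x := by
        rw [← norm_weight r y x, conj_mul']
      ext a b
      have h1a := congrArg (fun v : Col 2 => v a) h1
      have h2a := congrArg (fun v : Col 2 => v a) h2
      simp only [PiLp.sub_apply, PiLp.add_apply, PiLp.smul_apply, smul_eq_mul] at h1a h2a
      revert b
      refine Fin.forall_fin_two.2 ⟨?_, ?_⟩
      · simp only [Matrix.mul_apply, Fin.sum_univ_two, ofCols_zero, ofCols_one, jumpMatrix,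
          Matrix.of_apply, Matrix.cons_val', Matrix.cons_val_zero, Matrix.cons_val_one,
          Matrix.cons_val_fin_one, PiLp.add_apply, hw]
        -- The second jump relation replaces the second column of `M₊` in the first; this produces
        -- the entry `1 + |r|²`.
        linear_combination h1a + weight r y x * h2a
      · simp only [Matrix.mul_apply, Fin.sum_univ_two, ofCols_zero, ofCols_one, jumpMatrix,
          Matrix.of_apply, Matrix.cons_val', Matrix.cons_val_zero, Matrix.cons_val_one,
          Matrix.cons_val_fin_one, PiLp.add_apply]
        linear_combination h2a

end Density

/-! ### Removable singularities and Cauchy representation with poles -/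

lemma isLittleO_inv_of_tendsto_mul {f : ℂ → ℂ} {c : ℂ}
    (h : Tendsto (fun z => (z - c) * f z) (𝓝[≠] c) (𝓝 0)) :
    (fun z => f z - f c) =o[𝓝[≠] c] fun z => (z - c)⁻¹ := by
  have hne : ∀ᶠ z in 𝓝[≠] c, (z - c)⁻¹ = 0 → f z - f c = 0 := by
    filter_upwards [self_mem_nhdsWithin] with z hz h0
    exact absurd (inv_eq_zero.1 h0) (sub_ne_zero.2 hz)
  rw [Asymptotics.isLittleO_iff_tendsto' hne]
  have h1 := h.sub (tendsto_sub_smul_nhdsNE (f := fun _ => f c) (p := c) continuousAt_const)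
  rw [sub_zero] at h1
  refine h1.congr fun z => ?_
  rw [div_inv_eq_mul, smul_eq_mul]
  ring

/-- A simultaneous form of the removable singularity theorem, for a finite set of points. -/
lemma exists_regularization {U E : Set ℂ} (hU : IsOpen U) (hE : E.Finite) {h : ℂ → ℂ}
    (hd : DifferentiableOn ℂ h (U \ E))
    (h0 : ∀ e ∈ E, Tendsto (fun z => (z - e) * h z) (𝓝[≠] e) (𝓝 0)) :
    ∃ H : ℂ → ℂ, DifferentiableOn ℂ H U ∧ ∀ z, z ∉ E → H z = h z := by
  classical
  refine ⟨fun z => if z ∈ E then limUnder (𝓝[≠] z) h else h z, fun z hz => ?_,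
    fun z hz => if_neg hz⟩
  -- A neighbourhood of `z` free of the other exceptional points, so that they can be treated one at
  -- a time.
  have hW : U \ (E \ {z}) ∈ 𝓝 z :=
    (hU.sdiff (hE.subset Set.sdiff_subset).isClosed).mem_nhds ⟨hz, fun h => h.2 rfl⟩
  refine DifferentiableAt.differentiableWithinAt ?_
  by_cases hzE : z ∈ E
  · have h1 : DifferentiableOn ℂ h ((U \ (E \ {z})) \ {z}) :=
      hd.mono fun w hw => ⟨hw.1.1, fun hwE => hw.1.2 ⟨hwE, hw.2⟩⟩
    have h2 := differentiableOn_update_limUnder_of_isLittleO hW h1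
      (isLittleO_inv_of_tendsto_mul (h0 z hzE))
    refine (h2.differentiableAt hW).congr_of_eventuallyEq ?_
    filter_upwards [hW] with w hw
    by_cases hwz : w = z
    · subst hwz
      simp [hzE]
    · have hwE : w ∉ E := fun hwE => hw.2 ⟨hwE, hwz⟩
      simp [hwE, hwz]
  · have hUE : U \ E ∈ 𝓝 z := (hU.sdiff hE.isClosed).mem_nhds ⟨hz, hzE⟩
    refine (hd.differentiableAt hUE).congr_of_eventuallyEq ?_
    filter_upwards [hUE] with w hw
    exact if_neg hw.2

lemma measurableSet_off_finite {E : Set ℂ} (hE : E.Finite) (ε γ : ℝ) :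
    MeasurableSet {x : ℝ | ∀ e ∈ E, ε ≤ ‖(x + γ * I : ℂ) - e‖} := by
  have h1 : {x : ℝ | ∀ e ∈ E, ε ≤ ‖(x + γ * I : ℂ) - e‖} =
      ⋂ e ∈ E, {x : ℝ | ε ≤ ‖(x + γ * I : ℂ) - e‖} := by
    ext x
    simp
  rw [h1]
  exact hE.measurableSet_biInter fun e _ =>
    (isClosed_le continuous_const (by fun_prop)).measurableSet

/-- A function which is analytic off the real line, and uniformly square integrable on horizontal
lines off small discs, is uniformly square integrable on horizontal lines. -/
lemma exists_eLpNorm_line_le {H : ℂ → ℂ} (hH : DifferentiableOn ℂ H {z | z.im ≠ 0}) {E : Set ℂ}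
    (hE : E.Finite) (hE0 : ∀ e ∈ E, e.im ≠ 0)
    (hb : ∀ ε : ℝ, 0 < ε → ∃ C : ℝ≥0, ∀ γ : ℝ, γ ≠ 0 →
      eLpNorm (fun x : ℝ => H (x + γ * I)) 2
        (volume.restrict {x : ℝ | ∀ e ∈ E, ε ≤ ‖(x + γ * I : ℂ) - e‖}) ≤ C) :
    ∃ C : ℝ≥0, ∀ γ : ℝ, γ ≠ 0 → eLpNorm (fun x : ℝ => H (x + γ * I)) 2 volume ≤ C := by
  -- Discs this small do not meet the real line, so `H` is bounded on them by compactness.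
  obtain ⟨ε, hε, hεE⟩ : ∃ ε : ℝ, 0 < ε ∧ ∀ e ∈ E, ε < |e.im| := by
    have h1 : ∀ᶠ ε : ℝ in 𝓝[>] 0, ∀ e ∈ E, ε < |e.im| := by
      rw [hE.eventually_all]
      exact fun e he => nhdsWithin_le_nhds (Iio_mem_nhds (abs_pos.2 (hE0 e he)))
    obtain ⟨ε, h2, h3⟩ :=
      ((eventually_mem_nhdsWithin (a := (0 : ℝ)) (s := Set.Ioi 0)).and h1).exists
    exact ⟨ε, h2, h3⟩
  set K : Set ℂ := ⋃ e ∈ E, Metric.closedBall e ε with hK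
  have hKc : IsCompact K := hE.isCompact_biUnion fun e _ => isCompact_closedBall e ε
  have hKsub : K ⊆ {z | z.im ≠ 0} := by
    intro z hz
    obtain ⟨e, he, hze⟩ := Set.mem_iUnion₂.1 hz
    intro h0
    rw [mem_closedBall_iff_norm] at hze
    have h1 := (abs_im_le_norm (z - e)).trans hze
    rw [sub_im, h0, zero_sub, abs_neg] at h1
    exact (hεE e he).not_ge h1
  obtain ⟨B, hB⟩ := hKc.exists_bound_of_continuousOn (hH.continuousOn.mono hKsub)
  obtain ⟨C, hC⟩ := hb ε hε
  -- The shadow of the discs on the real axis: the excluded part of every horizontal line lies over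
  -- it, so its length is bounded independently of `γ`.
  set V : Set ℝ := ⋃ e ∈ E, Metric.closedBall e.re ε with hV
  have hVc : IsCompact V := hE.isCompact_biUnion fun e _ => isCompact_closedBall e.re ε
  obtain ⟨A, hA⟩ := exists_coe_eq (x := volume V ^ (2 : ℝ≥0∞).toReal⁻¹ * ENNReal.ofReal B)
    (ENNReal.mul_ne_top (ENNReal.rpow_ne_top_of_nonneg (by norm_num) hVc.measure_lt_top.ne)
      ENNReal.ofReal_ne_top)
  refine ⟨C + A, fun γ hγ => ?_⟩
  set S : Set ℝ := {x : ℝ | ∀ e ∈ E, ε ≤ ‖(x + γ * I : ℂ) - e‖} with hS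
  have hSm : MeasurableSet S := measurableSet_off_finite hE ε γ
  have hSV : ∀ x ∈ Sᶜ, x ∈ V ∧ (x + γ * I : ℂ) ∈ K := by
    intro x hx
    simp only [hS, Set.mem_compl_iff, Set.mem_ofPred_eq, not_forall, not_le] at hx
    obtain ⟨e, he, hxe⟩ := hx
    refine ⟨Set.mem_iUnion₂.2 ⟨e, he, ?_⟩, Set.mem_iUnion₂.2 ⟨e, he, ?_⟩⟩
    · rw [mem_closedBall_iff_norm, Real.norm_eq_abs]
      have h1 := (abs_re_le_norm ((x + γ * I : ℂ) - e)).trans hxe.le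
      simpa using h1
    · rw [mem_closedBall_iff_norm]
      exact hxe.le
  have hle : eLpNorm (fun x : ℝ => H (x + γ * I)) 2 (volume.restrict Sᶜ) ≤ A := by
    rw [hA]
    refine (eLpNorm_le_of_ae_bound (C := B) ?_).trans ?_
    · filter_upwards [ae_restrict_mem hSm.compl] with x hx
      exact hB _ (hSV x hx).2
    · rw [Measure.restrict_apply_univ]
      gcongr
      exact fun x hx => (hSV x hx).1
  have hsum : (fun x : ℝ => H (x + γ * I)) = S.indicator (fun x : ℝ => H (x + γ * I)) +
      Sᶜ.indicator (fun x : ℝ => H (x + γ * I)) := (Set.indicator_self_add_compl _ _).symm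
  have hcont : Continuous fun x : ℝ => H (x + γ * I) :=
    hH.continuousOn.comp_continuous (by fun_prop) fun x => by simpa using hγ
  rw [hsum, ENNReal.coe_add]
  refine (eLpNorm_add_le (hcont.aestronglyMeasurable.indicator hSm)
    (hcont.aestronglyMeasurable.indicator hSm.compl) (by norm_num)).trans ?_
  rw [eLpNorm_indicator_eq_eLpNorm_restrict hSm, eLpNorm_indicator_eq_eLpNorm_restrict hSm.compl]
  exact add_le_add (hC γ hγ) hle

/-- Horizontal lines close to the real line avoid a finite set of points off the real line. -/
lemma eventually_line_notMem {E : Set ℂ} (hE : E.Finite) (hE0 : ∀ e ∈ E, e.im ≠ 0) {τ : ℝ → ℝ}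
    {l : Filter ℝ} (hτ : Tendsto τ l (𝓝 0)) : ∀ᶠ γ in l, ∀ x : ℝ, (x + τ γ * I : ℂ) ∉ E := by
  have h1 : ∀ᶠ γ in l, ∀ e ∈ E, τ γ ≠ e.im := by
    rw [hE.eventually_all]
    exact fun e he => hτ.eventually (isOpen_ne.mem_nhds (hE0 e he).symm)
  filter_upwards [h1] with γ hγ x hx
  exact hγ _ hx (by simp)

/-- Representation of a function that is analytic off the real line, except for finitely many
simple poles, by its jump, its residues, and its value at infinity. -/
theorem eq_cauchy_integral_add_poles {N : ℕ} {E : Set ℂ} (hE : E.Finite)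
    (hE0 : ∀ e ∈ E, e.im ≠ 0) {p : Fin N → ℂ} (hp : Function.Injective p) (hpE : ∀ j, p j ∈ E)
    {u : Fin N → ℂ} {f : ℂ → ℂ} {c : ℂ} (hd : DifferentiableOn ℂ f ({z | z.im ≠ 0} \ E))
    (hres : ∀ j, Tendsto (fun z => (z - p j) * f z) (𝓝[≠] p j) (𝓝 (u j)))
    (hreg : ∀ e ∈ E, (∀ j, e ≠ p j) → Tendsto (fun z => (z - e) * f z) (𝓝[≠] e) (𝓝 0))
    (hnorm : ∀ ε : ℝ, 0 < ε → ∃ C : ℝ≥0, ∀ γ : ℝ, γ ≠ 0 →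
      eLpNorm (fun x : ℝ => f (x + γ * I) - c) 2
        (volume.restrict {x : ℝ | ∀ e ∈ E, ε ≤ ‖(x + γ * I : ℂ) - e‖}) ≤ C)
    {fp fm : ℝ → ℂ} (hfp : MemLp (fun x => fp x - c) 2 volume)
    (hfm : MemLp (fun x => fm x - c) 2 volume)
    (htp : Tendsto (fun γ : ℝ => eLpNorm (fun x : ℝ => f (x + γ * I) - fp x) 2 volume)
      (𝓝[>] 0) (𝓝 0))
    (htm : Tendsto (fun γ : ℝ => eLpNorm (fun x : ℝ => f (x - γ * I) - fm x) 2 volume)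
      (𝓝[>] 0) (𝓝 0)) {z : ℂ} (hz : z.im ≠ 0) (hzE : z ∉ E) :
    f z = c + (2 * Real.pi * I)⁻¹ * (∫ x : ℝ, (fp x - fm x) * ((x : ℂ) - z)⁻¹) +
      ∑ j, (z - p j)⁻¹ * u j := by
  set P : ℂ → ℂ := fun z => ∑ j, (z - p j)⁻¹ • u j with hP
  have hU : IsOpen {z : ℂ | z.im ≠ 0} := isOpen_ne_fun continuous_im continuous_const
  have hp0 : ∀ j, (p j).im ≠ 0 := fun j => hE0 _ (hpE j)
  have hPd : ∀ z ∉ E, DifferentiableAt ℂ P z := fun z hz =>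
    differentiableAt_poles _ _ fun j _ h => hz (h ▸ hpE j)
  -- `H` is `f - c - P` with its singularities removed: the residues cancel at the `p j`, and at the
  -- other points of `E` there is no pole.
  obtain ⟨H, hHd, hHf⟩ := exists_regularization (h := fun z => f z - c - P z) hU hE
    (fun z hz => ((hd z hz).sub (differentiableWithinAt_const c)).sub
      (hPd z hz.2).differentiableWithinAt) (by
    intro e he
    by_cases hep : ∃ j, e = p j
    · obtain ⟨j, rfl⟩ := hep
      have h1 := ((hres j).sub (tendsto_sub_smul_nhdsNE (f := fun _ => c) (p := p j)
        continuousAt_const)).sub (tendsto_mul_poles u hp j)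
      rw [sub_zero, sub_self] at h1
      refine h1.congr fun z => ?_
      simp only [smul_eq_mul, hP]
      ring
    · push Not at hep
      have h1 := ((hreg e he hep).sub (tendsto_sub_smul_nhdsNE (f := fun _ => c) (p := e)
        continuousAt_const)).sub (tendsto_sub_smul_nhdsNE
          (differentiableAt_poles Finset.univ u fun j _ => hep j).continuousAt)
      rw [sub_zero, sub_zero] at h1
      refine h1.congr fun z => ?_
      simp only [smul_eq_mul, hP]
      ring)
  have hline : ∀ γ : ℝ, γ ≠ 0 → Continuous fun x : ℝ => H (x + γ * I) := fun γ hγ =>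
    hHd.continuousOn.comp_continuous (by fun_prop) fun x => by simpa using hγ
  have hPm : ∀ γ : ℝ, Measurable fun x : ℝ => P (x + γ * I) := fun γ => by
    simp only [hP]
    fun_prop
  obtain ⟨C, hC⟩ := exists_eLpNorm_line_le hHd hE hE0 (by
    intro ε hε
    obtain ⟨C₁, hC₁⟩ := hnorm ε hε
    obtain ⟨C₂, hC₂⟩ := exists_eLpNorm_poles_le u p hε
    refine ⟨C₁ + C₂, fun γ hγ => ?_⟩
    have hSm := measurableSet_off_finite hE ε γ
    set S : Set ℝ := {x : ℝ | ∀ e ∈ E, ε ≤ ‖(x + γ * I : ℂ) - e‖}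
    have h1 : ∀ x ∈ S, H (x + γ * I) = f (x + γ * I) - c - P (x + γ * I) := fun x hx =>
      hHf _ fun hxE => (hε.trans_le (hx _ hxE)).ne' (by simp)
    have h2 : (fun x : ℝ => H (x + γ * I)) =ᵐ[volume.restrict S]
        (fun x : ℝ => f (x + γ * I) - c) - fun x : ℝ => P (x + γ * I) := by
      filter_upwards [ae_restrict_mem hSm] with x hx using h1 x hx
    have h3 : AEStronglyMeasurable (fun x : ℝ => f (x + γ * I) - c) (volume.restrict S) := by
      refine ((hline γ hγ).aestronglyMeasurable.add
        (hPm γ).aestronglyMeasurable).congr ?_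
      filter_upwards [ae_restrict_mem hSm] with x hx
      simp only [Pi.add_apply, h1 x hx]
      ring
    rw [eLpNorm_congr_ae h2, ENNReal.coe_add]
    exact (eLpNorm_sub_le h3 (hPm γ).aestronglyMeasurable (by norm_num)).trans
      (add_le_add (hC₁ γ hγ) (hC₂ γ S hSm fun x hx j => hx _ (hpE j))))
  have hP2 : MemLp (fun x : ℝ => P x) 2 volume := by
    have h1 : MemLp (fun x : ℝ => ∑ j, ((x : ℂ) - p j)⁻¹ * u j) 2 volume :=
      memLp_finsetSum _ fun j _ => (memLp_kernel (p j) (hp0 j)).mul_const (u j)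
    exact h1
  have key : ∀ (τ : ℝ → ℝ), Tendsto τ (𝓝[>] 0) (𝓝 0) → (∀ᶠ γ in 𝓝[>] 0, τ γ ≠ 0) →
      ∀ g : ℝ → ℂ, MemLp (fun x => g x - c) 2 volume →
      Tendsto (fun γ : ℝ => eLpNorm (fun x : ℝ => f (x + τ γ * I) - g x) 2 volume)
        (𝓝[>] 0) (𝓝 0) →
      Tendsto (fun γ : ℝ => eLpNorm (fun x : ℝ => H (x + τ γ * I) - (g x - c - P x)) 2 volume)
        (𝓝[>] 0) (𝓝 0) := by
    intro τ hτ hτ0 g hg hfg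
    have h1 := hfg.add ((tendsto_eLpNorm_poles_sub u hp0).comp hτ)
    rw [add_zero] at h1
    refine tendsto_of_tendsto_of_tendsto_of_le_of_le' tendsto_const_nhds h1
      (Eventually.of_forall fun _ => zero_le) ?_
    filter_upwards [hτ0, eventually_line_notMem hE hE0 hτ] with γ hγ hγE
    have h2 : (fun x : ℝ => H (x + τ γ * I) - (g x - c - P x)) =
        (fun x : ℝ => f (x + τ γ * I) - g x) - fun x : ℝ => P (x + τ γ * I) - P x := by
      ext x
      simp only [Pi.sub_apply, hHf _ (hγE x)]
      ring
    have h3 : (fun x : ℝ => f (x + τ γ * I) - g x) =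
        (fun x : ℝ => H (x + τ γ * I)) + (fun x : ℝ => P (x + τ γ * I)) -
          fun x : ℝ => g x - c := by
      ext x
      simp only [Pi.sub_apply, Pi.add_apply, hHf _ (hγE x)]
      ring
    rw [h2]
    refine eLpNorm_sub_le ?_ ((hPm _).aestronglyMeasurable.sub hP2.1) (by norm_num)
    rw [h3]
    exact ((hline _ hγ).aestronglyMeasurable.add (hPm _).aestronglyMeasurable).sub hg.1
  have hsub : ∀ x γ : ℝ, (x : ℂ) - γ * I = x + ((-γ : ℝ) : ℂ) * I := fun x γ => by
    push_cast
    ring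
  have h0 : ∀ᶠ γ : ℝ in 𝓝[>] 0, γ ≠ 0 := by
    filter_upwards [self_mem_nhdsWithin] with γ hγ using ne_of_gt hγ
  have hu := cauchy_formula_upper (hHd.mono fun z hz => ne_of_gt hz)
    (fun t ht => hC t ht.ne') (hfp.sub hP2)
    (key id (tendsto_id.mono_left nhdsWithin_le_nhds) h0 fp hfp htp) hz
  have hl := cauchy_formula_lower (hHd.mono fun z hz => ne_of_lt hz) (C := C)
    (fun t ht => by
      simp_rw [hsub]
      exact hC _ (neg_ne_zero.2 ht.ne')) (hfm.sub hP2) (by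
    simp_rw [hsub] at htm ⊢
    refine key (fun γ => -γ) ?_ (h0.mono fun γ hγ => neg_ne_zero.2 hγ) fm hfm htm
    have := (continuous_neg (G := ℝ)).tendsto 0
    rw [neg_zero] at this
    exact this.mono_left nhdsWithin_le_nhds) hz
  have hint : ∀ g : ℝ → ℂ, MemLp g 2 volume → Integrable fun x : ℝ => g x * ((x : ℂ) - z)⁻¹ :=
    fun g hg => hg.integrable_mul (memLp_kernel z hz)
  -- The terms `c` and `P` drop out of the jump. Of the two Cauchy formulas exactly one contributes
  -- at `z`, and their difference is `2πi H z` in either half-plane.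
  have hI : ∫ x : ℝ, (fp x - fm x) * ((x : ℂ) - z)⁻¹ = 2 * Real.pi * I * H z := by
    have h1 : (fun x : ℝ => (fp x - fm x) * ((x : ℂ) - z)⁻¹) = fun x : ℝ =>
        (fp x - c - P x) * ((x : ℂ) - z)⁻¹ - (fm x - c - P x) * ((x : ℂ) - z)⁻¹ := by
      ext x
      ring
    have hgp : MemLp (fun x => fp x - c - P x) 2 volume := hfp.sub hP2
    have hgm : MemLp (fun x => fm x - c - P x) 2 volume := hfm.sub hP2
    rw [h1, integral_sub (hint _ hgp) (hint _ hgm)]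
    refine (congrArg₂ (· - ·) hu hl).trans ?_
    rcases lt_or_gt_of_ne hz with h | h
    · simp [h, h.not_gt]
    · simp [h, h.not_gt]
  rw [hI, hHf z hzE, inv_mul_cancel_left₀ two_pi_I_ne_zero]
  simp only [hP, smul_eq_mul]
  ring

lemma ae_eq_of_tendsto_eLpNorm_sub {ι : Type*} {l : Filter ι} [l.NeBot] {F : ι → ℝ → ℂ}
    {g h : ℝ → ℂ} (hF : ∀ᶠ i in l, AEStronglyMeasurable (F i) volume)
    (hg : AEStronglyMeasurable g volume) (hh : AEStronglyMeasurable h volume)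
    (h1 : Tendsto (fun i => eLpNorm (fun x => F i x - g x) 2 volume) l (𝓝 0))
    (h2 : Tendsto (fun i => eLpNorm (fun x => F i x - h x) 2 volume) l (𝓝 0)) :
    g =ᵐ[volume] h := by
  have h3 : eLpNorm (g - h) 2 volume ≤ 0 := by
    have h4 := h2.add h1
    rw [add_zero] at h4
    refine ge_of_tendsto h4 ?_
    filter_upwards [hF] with i hi
    have h5 : g - h = (fun x => F i x - h x) - fun x => F i x - g x := by
      ext x
      simp
    rw [h5]
    exact eLpNorm_sub_le (hi.sub hh) (hi.sub hg) (by norm_num)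
  have h6 := (eLpNorm_eq_zero_iff (hg.sub hh) (by norm_num)).1 (le_antisymm h3 zero_le)
  filter_upwards [h6] with x hx using sub_eq_zero.1 hx

lemma colFun_apply {m N : ℕ} (e : Col m) (g : L2 (Col m)) (p : Fin N → ℂ) (u : Fin N → Col m)
    {z : ℂ} (hz : z.im ≠ 0) (a : Fin m) : colFun e g p u z a =
      e a + (2 * Real.pi * I)⁻¹ * (∫ x : ℝ, g x a * ((x : ℂ) - z)⁻¹) +
        ∑ j, (z - p j)⁻¹ * u j a := by
  have h1 := (EuclideanSpace.proj a : Col m →L[ℂ] ℂ).integral_comp_comm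
    (integrable_kernel_smul m hz g)
  have h2 : (∫ x : ℝ, ((x : ℂ) - z)⁻¹ • g x : Col m) a = ∫ x : ℝ, g x a * ((x : ℂ) - z)⁻¹ := by
    refine Eq.trans h1.symm (integral_congr_ae (Eventually.of_forall fun x => ?_))
    exact mul_comm _ _
  have h3 : (∑ j, (z - p j)⁻¹ • u j : Col m) a = ∑ j, (z - p j)⁻¹ * u j a :=
    map_sum (EuclideanSpace.proj a : Col m →L[ℂ] ℂ) _ _
  rw [colFun, PiLp.add_apply, PiLp.add_apply, h3, cauchyInt, PiLp.smul_apply, h2, smul_eq_mul]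

/-! ### From a solution to the singular integral equation -/

section Uniqueness

variable {N : ℕ} {r : ℝ → ℂ} {D : DiscreteData N} {y : ℝ} {M : ℂ → Matrix (Fin 2) (Fin 2) ℂ}

/-- All the points `z_j` and `conj z_j`. -/
def DiscreteData.poles (D : DiscreteData N) : Set ℂ :=
  Set.range D.pole ∪ Set.range fun j => conj (D.pole j)

lemma DiscreteData.finite_poles (D : DiscreteData N) : D.poles.Finite :=
  (Set.finite_range _).union (Set.finite_range _)

lemma DiscreteData.im_ne_of_mem_poles (D : DiscreteData N) : ∀ e ∈ D.poles, e.im ≠ 0 := by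
  rintro _ (⟨j, rfl⟩ | ⟨j, rfl⟩)
  exacts [D.im_ne j, D.conj_im_ne j]

lemma DiscreteData.domain_eq (D : DiscreteData N) : D.domain = {z | z.im ≠ 0} \ D.poles := by
  ext z
  simp only [domain, poles, Set.mem_ofPred_eq, Set.mem_sdiff, Set.mem_union, Set.mem_range,
    not_or, not_exists, forall_and, ne_comm (a := z), ne_eq]

lemma DiscreteData.forall_mem_poles (D : DiscreteData N) {Q : ℂ → Prop} :
    (∀ e ∈ D.poles, Q e) ↔ ∀ j, Q (D.pole j) ∧ Q (conj (D.pole j)) := by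
  simp only [poles, Set.mem_union, or_imp, forall_and, Set.forall_mem_range]

/-- The second column of `M A` vanishes identically, which forces the residue of the second column
of `M` to be zero; the first column of the same limit ties the residue `u` to the second column of
`M`. -/
lemma HasResidueCondition.exists_residue {p c : ℂ}
    (h : HasResidueCondition M p !![0, 0; c, 0]) : ∃ u : Col 2, ∀ a,
      Tendsto (fun z => (z - p) * M z a 0) (𝓝[≠] p) (𝓝 (u a)) ∧
      Tendsto (fun z => (z - p) * M z a 1) (𝓝[≠] p) (𝓝 0) ∧
      Tendsto (fun z => c * M z a 1) (𝓝[≠] p) (𝓝 (u a)) := by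
  obtain ⟨L, h1, h2⟩ := h
  have h1' := fun a b => tendsto_pi_nhds.1 (tendsto_pi_nhds.1 h1 a) b
  have h2' := fun a b => tendsto_pi_nhds.1 (tendsto_pi_nhds.1 h2 a) b
  refine ⟨WithLp.toLp 2 fun a => L a 0, fun a => ⟨h1' a 0, ?_, ?_⟩⟩
  · have h3 := h2' a 1
    simp only [Matrix.mul_apply, Fin.sum_univ_two, Matrix.of_apply, Matrix.cons_val',
      Matrix.cons_val_zero, Matrix.cons_val_one, Matrix.cons_val_fin_one, mul_zero, add_zero] at h3
    rw [tendsto_nhds_unique tendsto_const_nhds h3]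
    exact h1' a 1
  · refine (h2' a 0).congr fun z => ?_
    simp [Matrix.mul_apply, mul_comm]

lemma HasResidueCondition.exists_residue_conj {p c : ℂ}
    (h : HasResidueCondition M p !![0, c; 0, 0]) : ∃ u : Col 2, ∀ a,
      Tendsto (fun z => (z - p) * M z a 1) (𝓝[≠] p) (𝓝 (u a)) ∧
      Tendsto (fun z => (z - p) * M z a 0) (𝓝[≠] p) (𝓝 0) ∧
      Tendsto (fun z => c * M z a 0) (𝓝[≠] p) (𝓝 (u a)) := by
  obtain ⟨L, h1, h2⟩ := h
  have h1' := fun a b => tendsto_pi_nhds.1 (tendsto_pi_nhds.1 h1 a) b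
  have h2' := fun a b => tendsto_pi_nhds.1 (tendsto_pi_nhds.1 h2 a) b
  refine ⟨WithLp.toLp 2 fun a => L a 1, fun a => ⟨h1' a 1, ?_, ?_⟩⟩
  · have h3 := h2' a 0
    simp only [Matrix.mul_apply, Fin.sum_univ_two, Matrix.of_apply, Matrix.cons_val',
      Matrix.cons_val_zero, Matrix.cons_val_one, Matrix.cons_val_fin_one, mul_zero, add_zero] at h3
    rw [tendsto_nhds_unique tendsto_const_nhds h3]
    exact h1' a 0
  · refine (h2' a 1).congr fun z => ?_
    simp [Matrix.mul_apply, mul_comm]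

lemma IsRHSolution.exists_eLpNorm_le (hM : IsRHSolution r D y M) (a b : Fin 2) (ε : ℝ)
    (hε : 0 < ε) : ∃ C : ℝ≥0, ∀ γ : ℝ, γ ≠ 0 →
      eLpNorm (fun x : ℝ => M (x + γ * I) a b - (1 : Matrix (Fin 2) (Fin 2) ℂ) a b) 2
        (volume.restrict {x : ℝ | ∀ e ∈ D.poles, ε ≤ ‖(x + γ * I : ℂ) - e‖}) ≤ C := by
  obtain ⟨C, hC⟩ := hM.normalized a b ε hε
  refine ⟨NNReal.sqrt C, fun γ hγ => ?_⟩
  rw [← ENNReal.pow_le_pow_left_iff two_ne_zero, eLpNorm_two_sq, ← ENNReal.coe_pow,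
    NNReal.sq_sqrt]
  simp_rw [D.forall_mem_poles]
  exact hC γ hγ

/-- A column of a solution is determined by its jump and its residues, and so are its boundary
values. -/
lemma IsRHSolution.col_eq_colFun (hM : IsRHSolution r D y M) (b : Fin 2) {p : Fin N → ℂ}
    (hp : Function.Injective p) (hpD : ∀ j, p j ∈ D.poles) {u : Fin N → Col 2}
    (hres : ∀ j a, Tendsto (fun z => (z - p j) * M z a b) (𝓝[≠] p j) (𝓝 (u j a)))
    (hreg : ∀ e ∈ D.poles, (∀ j, e ≠ p j) → ∀ a,
      Tendsto (fun z => (z - e) * M z a b) (𝓝[≠] e) (𝓝 0))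
    {Mp Mm : ℝ → Matrix (Fin 2) (Fin 2) ℂ} {g : L2 (Col 2)}
    (hMp : ∀ a, MemLp (fun x => Mp x a b - (1 : Matrix (Fin 2) (Fin 2) ℂ) a b) 2 volume)
    (hMm : ∀ a, MemLp (fun x => Mm x a b - (1 : Matrix (Fin 2) (Fin 2) ℂ) a b) 2 volume)
    (htp : ∀ a, Tendsto (fun γ : ℝ => eLpNorm (fun x : ℝ => M (x + γ * I) a b - Mp x a b) 2 volume)
      (𝓝[>] 0) (𝓝 0))
    (htm : ∀ a, Tendsto (fun γ : ℝ => eLpNorm (fun x : ℝ => M (x - γ * I) a b - Mm x a b) 2 volume)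
      (𝓝[>] 0) (𝓝 0))
    (hg : ∀ a, ∀ᵐ x : ℝ, Mp x a b - Mm x a b = g x a) :
    (∀ z ∈ D.domain, ∀ a, M z a b = colFun (stdCol b) g p u z a) ∧
    (∀ a, ∀ᵐ x : ℝ, Mp x a b =
      (stdCol b + cauchyPlus 2 g x + ∑ j, ((x : ℂ) - p j)⁻¹ • u j : Col 2) a) ∧
    (∀ a, ∀ᵐ x : ℝ, Mm x a b =
      (stdCol b + cauchyMinus 2 g x + ∑ j, ((x : ℂ) - p j)⁻¹ • u j : Col 2) a) := by
  have hE0 := D.im_ne_of_mem_poles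
  have hp0 : ∀ j, (p j).im ≠ 0 := fun j => hE0 _ (hpD j)
  have h1 : ∀ z ∈ D.domain, ∀ a, M z a b = colFun (stdCol b) g p u z a := by
    intro z hz a
    have hz' := hz
    rw [D.domain_eq] at hz'
    rw [colFun_apply (stdCol b) g p u hz'.1 a, stdCol_apply]
    rw [eq_cauchy_integral_add_poles D.finite_poles hE0 hp hpD (u := fun j => u j a)
      (f := fun z => M z a b) (D.domain_eq ▸ hM.analytic a b) (fun j => hres j a)
      (fun e he hep => hreg e he hep a) (hM.exists_eLpNorm_le a b) (hMp a) (hMm a) (htp a) (htm a)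
      hz'.1 hz'.2]
    congr 3
    refine integral_congr_ae ?_
    filter_upwards [hg a] with x hx
    rw [hx]
  have hmeas : ∀ (F : ℝ → Matrix (Fin 2) (Fin 2) ℂ) a,
      MemLp (fun x => F x a b - (1 : Matrix (Fin 2) (Fin 2) ℂ) a b) 2 volume →
      AEStronglyMeasurable (fun x => F x a b) volume := fun F a h => by
    simpa using h.1.add_const ((1 : Matrix (Fin 2) (Fin 2) ℂ) a b)
  have hline : ∀ τ : ℝ, τ ≠ 0 → (∀ x : ℝ, (x + τ * I : ℂ) ∉ D.poles) → ∀ a,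
      AEStronglyMeasurable (fun x : ℝ => M (x + τ * I) a b) volume := fun τ hτ hx a =>
    Continuous.aestronglyMeasurable ((hM.analytic a b).continuousOn.comp_continuous
      (by fun_prop) fun x => by
        rw [D.domain_eq]
        exact ⟨by simpa using hτ, hx x⟩)
  have hb : ∀ (T : L2 (Col 2)) a, AEStronglyMeasurable (fun x : ℝ =>
      (stdCol b + T x + ∑ j, ((x : ℂ) - p j)⁻¹ • u j : Col 2) a) volume := fun T a => by
    simpa using (memLp_boundary (stdCol b) T hp0 u a).1.add_const ((stdCol b : Col 2) a)
  have hlim : Tendsto (fun γ : ℝ => -γ) (𝓝[>] 0) (𝓝 0) := by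
    have := (continuous_neg (G := ℝ)).tendsto 0
    rw [neg_zero] at this
    exact this.mono_left nhdsWithin_le_nhds
  have hsub : ∀ x γ : ℝ, (x : ℂ) - γ * I = x + ((-γ : ℝ) : ℂ) * I := fun x γ => by
    push_cast
    ring
  have hpos : ∀ᶠ γ : ℝ in 𝓝[>] 0, γ ≠ 0 := by
    filter_upwards [self_mem_nhdsWithin] with γ hγ using ne_of_gt hγ
  have hup := eventually_line_notMem D.finite_poles hE0
    (tendsto_id.mono_left nhdsWithin_le_nhds : Tendsto id (𝓝[>] (0 : ℝ)) (𝓝 0))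
  have hdown := eventually_line_notMem D.finite_poles hE0 hlim
  refine ⟨h1, fun a => ?_, fun a => ?_⟩
  · refine ae_eq_of_tendsto_eLpNorm_sub ?_ (hmeas Mp a (hMp a)) (hb _ a) (htp a) ?_
    · filter_upwards [hpos, hup] with γ h h' using hline γ h h' a
    · refine (tendsto_eLpNorm_apply (tendsto_colFun_plus (stdCol b) g u hp0) a).congr' ?_
      filter_upwards [hpos, hup] with γ h h'
      congr 1
      ext x
      rw [h1 _ (D.domain_eq ▸ ⟨by simpa using h, h' x⟩)]
  · refine ae_eq_of_tendsto_eLpNorm_sub ?_ (hmeas Mm a (hMm a)) (hb _ a) (htm a) ?_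
    · filter_upwards [hpos, hdown] with γ h h'
      simp_rw [hsub]
      exact hline _ (neg_ne_zero.2 h) h' a
    · refine (tendsto_eLpNorm_apply (tendsto_colFun_minus (stdCol b) g u hp0) a).congr' ?_
      filter_upwards [hpos, hdown] with γ h h'
      congr 1
      ext x
      rw [hsub, h1 _ (D.domain_eq ▸ ⟨by simpa using h, h' x⟩)]

lemma ae_eq_col {m : ℕ} {f g : ℝ → Col m} (h : ∀ a, ∀ᵐ x : ℝ, f x a = g x a) : f =ᵐ[volume] g := by
  filter_upwards [ae_all_iff.2 h] with x hx
  ext a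
  exact hx a

/-- Every solution of the Riemann–Hilbert problem comes from a solution of the singular integral
equation. -/
theorem IsRHSolution.exists_isDensity (hM : IsRHSolution r D y M) (hr : MemLp r 2 volume)
    (hr' : MemLp r ∞ volume) : ∃ f₁ f₂, IsDensity hr D y f₁ f₂ ∧
      ∀ z ∈ D.domain, M z = rhMatrix hr D y f₁ f₂ z := by
  obtain ⟨Mp, Mm, hMp, hMm, htp, htm, hjump⟩ := hM.jump
  choose u hu using fun j => (hM.residue j).exists_residue
  choose w hw using fun j => (hM.residue_conj j).exists_residue_conj
  -- The density is read off from the first column of `M₋` and the second column of `M₊`, the two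
  -- factors through which the jumps are expressed.
  have hf₁ : MemLp (fun x => (WithLp.toLp 2 fun a =>
      Mm x a 0 - (1 : Matrix (Fin 2) (Fin 2) ℂ) a 0 : Col 2)) 2 volume :=
    MemLp.of_eval_piLp fun a => hMm a 0
  have hf₂ : MemLp (fun x => (WithLp.toLp 2 fun a =>
      Mp x a 1 - (1 : Matrix (Fin 2) (Fin 2) ℂ) a 1 : Col 2)) 2 volume :=
    MemLp.of_eval_piLp fun a => hMp a 1
  set f₁ : L2 (Col 2) := hf₁.toLp with hf₁_def
  set f₂ : L2 (Col 2) := hf₂.toLp with hf₂_def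
  have hf₁a : ∀ a, ∀ᵐ x : ℝ, Mm x a 0 = (stdCol 0 + f₁ x : Col 2) a := fun a => by
    filter_upwards [hf₁.coeFn_toLp] with x hx
    rw [PiLp.add_apply, hx, stdCol_apply]
    exact (add_sub_cancel _ _).symm
  have hf₂a : ∀ a, ∀ᵐ x : ℝ, Mp x a 1 = (stdCol 1 + f₂ x : Col 2) a := fun a => by
    filter_upwards [hf₂.coeFn_toLp] with x hx
    rw [PiLp.add_apply, hx, stdCol_apply]
    exact (add_sub_cancel _ _).symm
  have hg₁ : ∀ a, ∀ᵐ x : ℝ, Mp x a 0 - Mm x a 0 = firstJump hr y f₂ x a := fun a => by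
    filter_upwards [hjump, hf₂a a, firstJump_ae hr y hr' f₂] with x hx h2 h1
    have hw : (‖r x‖ : ℂ) ^ 2 = conj (weight r y x) * weight r y x := by
      rw [← norm_weight r y x, conj_mul']
    rw [h1, PiLp.smul_apply, ← h2, hx]
    simp only [Matrix.mul_apply, Fin.sum_univ_two, jumpMatrix, Matrix.of_apply, Matrix.cons_val',
      Matrix.cons_val_zero, Matrix.cons_val_one, Matrix.cons_val_fin_one, hw, smul_eq_mul]
    ring
  have hg₂ : ∀ a, ∀ᵐ x : ℝ, Mp x a 1 - Mm x a 1 = secondJump hr y f₁ x a := fun a => by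
    filter_upwards [hjump, hf₁a a, secondJump_ae hr y hr' f₁] with x hx h2 h1
    rw [h1, PiLp.smul_apply, ← h2, hx]
    simp only [Matrix.mul_apply, Fin.sum_univ_two, jumpMatrix, Matrix.of_apply, Matrix.cons_val',
      Matrix.cons_val_zero, Matrix.cons_val_one, Matrix.cons_val_fin_one, smul_eq_mul]
    ring
  obtain ⟨hcol₁, -, hm₁⟩ := hM.col_eq_colFun 0 D.pole_injective (fun j => Or.inl ⟨j, rfl⟩)
    (fun j a => (hu j a).1) (D.forall_mem_poles.2 fun j =>
      ⟨fun h => absurd rfl (h j), fun _ a => (hw j a).2.1⟩)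
    (fun a => hMp a 0) (fun a => hMm a 0) (fun a => htp a 0) (fun a => htm a 0) hg₁
  obtain ⟨hcol₂, hp₂, -⟩ := hM.col_eq_colFun 1 D.conj_pole_injective (fun j => Or.inr ⟨j, rfl⟩)
    (fun j a => (hw j a).1) (D.forall_mem_poles.2 fun j =>
      ⟨fun _ a => (hu j a).2.1, fun h => absurd rfl (h j)⟩)
    (fun a => hMp a 1) (fun a => hMm a 1) (fun a => htp a 1) (fun a => htm a 1) hg₂
  -- The integral equations hold first with the unidentified residues `u` and `w`.
  have heq₁ : f₁ = cauchyMinus 2 (firstJump hr y f₂) +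
      ∑ j, poleFun 2 (D.pole j) (D.im_ne j) (u j) := by
    refine Lp.ext (ae_eq_col fun a => ?_)
    filter_upwards [hf₁a a, hm₁ a, coeFn_sum_poleFun u D.im_ne,
      Lp.coeFn_add (cauchyMinus 2 (firstJump hr y f₂))
        (∑ j, poleFun 2 (D.pole j) (D.im_ne j) (u j))] with x h1 h2 h3 h4
    rw [h4, Pi.add_apply, h3]
    rw [h1, add_assoc, PiLp.add_apply, PiLp.add_apply] at h2
    exact add_left_cancel h2
  have heq₂ : f₂ = cauchyPlus 2 (secondJump hr y f₁) +
      ∑ j, poleFun 2 (conj (D.pole j)) (D.conj_im_ne j) (w j) := by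
    refine Lp.ext (ae_eq_col fun a => ?_)
    filter_upwards [hf₂a a, hp₂ a, coeFn_sum_poleFun w D.conj_im_ne,
      Lp.coeFn_add (cauchyPlus 2 (secondJump hr y f₁))
        (∑ j, poleFun 2 (conj (D.pole j)) (D.conj_im_ne j) (w j))] with x h1 h2 h3 h4
    rw [h4, Pi.add_apply, h3]
    rw [h1, add_assoc, PiLp.add_apply, PiLp.add_apply] at h2
    exact add_left_cancel h2
  have hdom : ∀ e ∈ D.poles, ∀ᶠ z in 𝓝[≠] e, z ∈ D.domain := fun e he => by
    have h1 : {z : ℂ | z.im ≠ 0} \ (D.poles \ {e}) ∈ 𝓝 e :=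
      ((isOpen_ne_fun continuous_im continuous_const).sdiff
        (D.finite_poles.subset Set.sdiff_subset).isClosed).mem_nhds
        ⟨D.im_ne_of_mem_poles e he, fun h => h.2 rfl⟩
    filter_upwards [nhdsWithin_le_nhds h1, self_mem_nhdsWithin] with z hz hze
    rw [D.domain_eq]
    exact ⟨hz.1, fun h => hz.2 ⟨h, hze⟩⟩
  -- By the residue condition `u j` is the coefficient times the limit of the second column at
  -- `z_j`. That column is continuous there, and its value is `e₂` plus the Cauchy integral of `f₂`.
  have hu_eq : u = firstResidue D y f₂ := by
    funext j
    rw [firstResidue, cauchyAt_eq_colFun_upper (stdCol 1) (secondJump hr y f₁) w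
      D.conj_pole_im_neg heq₂ (D.pole_im_pos j)]
    ext a
    have h1 := (differentiableAt_colFun (stdCol 1) (secondJump hr y f₁) w (D.im_ne j)
      (D.pole_ne_conj j)).continuousAt.tendsto.mono_left
      (nhdsWithin_le_nhds (s := {D.pole j}ᶜ))
    refine tendsto_nhds_unique (hu j a).2.2 (((tendsto_col_apply h1 a).const_mul _).congr' ?_)
    filter_upwards [hdom _ (Or.inl ⟨j, rfl⟩)] with z hz
    rw [hcol₂ z hz a]
  have hw_eq : w = secondResidue D y f₁ := by
    funext j
    rw [secondResidue, cauchyAt_eq_colFun_lower (stdCol 0) (firstJump hr y f₂) u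
      D.pole_im_pos heq₁ (D.conj_pole_im_neg j)]
    ext a
    have h1 := (differentiableAt_colFun (stdCol 0) (firstJump hr y f₂) u (D.conj_im_ne j)
      fun k => (D.pole_ne_conj k j).symm).continuousAt.tendsto.mono_left
      (nhdsWithin_le_nhds (s := {conj (D.pole j)}ᶜ))
    refine tendsto_nhds_unique (hw j a).2.2 (((tendsto_col_apply h1 a).const_mul _).congr' ?_)
    filter_upwards [hdom _ (Or.inr ⟨j, rfl⟩)] with z hz
    rw [hcol₁ z hz a]
  rw [hu_eq] at heq₁ hcol₁
  rw [hw_eq] at heq₂ hcol₂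
  refine ⟨f₁, f₂, ⟨heq₁, heq₂⟩, fun z hz => ?_⟩
  ext a b
  revert b
  exact Fin.forall_fin_two.2 ⟨hcol₁ z hz a, hcol₂ z hz a⟩

end Uniqueness

end MCH

end

/-- Solutions are compared on `D.domain` only, since values on the real line and at the exceptional
points are not constrained by the problem. -/
theorem proposition3p1 (s : ℝ) (hs : 1 / 2 < s) (r : Lp ℂ 2 (volume : Measure ℝ))
    (hr : TemperedDistribution.MemSobolev s 2 (r : TemperedDistribution ℝ ℂ)) :
    MemLp r ∞ volume ∧
    ∀ (N : ℕ) (D : MCH.DiscreteData N) (y : ℝ), 0 ≤ y →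
      (∀ m : ℕ,
        (1 - MCH.opK m r D y).IsFredholm ∧
        (1 - MCH.opK m r D y).toLinearMap.index = 0 ∧
        ∃ T : MCH.MatL2 m →L[ℂ] MCH.MatL2 m,
          T * (1 - MCH.opK m r D y) = 1 ∧ (1 - MCH.opK m r D y) * T = 1 ∧
          ‖T‖ ≤ 1 + (eLpNorm r ∞ volume).toReal) ∧
      ∃ M : ℂ → Matrix (Fin 2) (Fin 2) ℂ, MCH.IsRHSolution r D y M ∧
        ∀ M' : ℂ → Matrix (Fin 2) (Fin 2) ℂ, MCH.IsRHSolution r D y M' →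
          ∀ z ∈ D.domain, M' z = M z := by
  have hr₂ : MemLp r 2 volume := Lp.memLp r
  have hr' : MemLp r ∞ volume := MCH.memLp_top_of_memSobolev hs r hr
  refine ⟨hr', fun N D y _ => ⟨fun m => ?_, ?_⟩⟩
  · obtain ⟨T, hT1, hT2, hT⟩ := MCH.exists_inverse_one_sub_opK m D y hr'
    obtain ⟨hF, hi⟩ := MCH.isFredholm_index_of_inverse (1 - MCH.opK m r D y) T hT1 hT2
    exact ⟨hF, hi, T, hT1, hT2, hT⟩
  · obtain ⟨f₁, f₂, hf, huniq⟩ := MCH.existsUnique_density hr₂ D y hr'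
    refine ⟨MCH.rhMatrix hr₂ D y f₁ f₂, hf.isRHSolution hr', fun M' hM' z hz => ?_⟩
    obtain ⟨g₁, g₂, hg, hMg⟩ := hM'.exists_isDensity hr₂ hr'
    obtain ⟨rfl, rfl⟩ := huniq g₁ g₂ hg
    exact hMg z hz
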